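/- Let $V$ be a model of ZF and let $\mathcal A=(A,B,\prec,\bot\!\!\!\bot)$ be a realizability algebra in $V$: $A,B\in V$, $B\neq\emptyset$; $\Lambda$ is the set of $V$ of closed $\lambda_c$-terms (built from variables, application, abstraction, $\mathsf{cc}$, continuation constants $\mathsf k_\pi$ for stacks $\pi$, and special instructions $\xi_\alpha$, $\alpha\in A$), $\Pi$ is the set of stacks (stack bottoms $\omega_\beta$, $\beta\in B$, and $t\cdot\pi$ with $t\in\Lambda$, $\pi\in\Pi$); $\prec\,\in V$ is a preorder on $\Lambda\times\Pi$ with $ts\star\pi\succ t\star s\cdot\pi$, $\ \lambda u.t\star s\cdot\pi\succ t[u:=s]\star\pi$, $\ \mathsf{cc}\star t\cdot\pi\succ t\star\mathsf k_\pi\cdot\pi$, $\ \mathsf k_\sigma\star t\cdot\pi\succ t\star\sigma$; and the pole $\bot\!\!\!\bot\in V$ is a subset of $\Lambda\times\Pi$ such that $p\succ q\in\bot\!\!\!\bot$ implies $p\in\bot\!\!\!\bot$. A realizer is a closed term without continuation constants. Names are the sets of $V$ all of whose elements are pairs $(b,\pi)$ with $b$ a name and $\pi\in\Pi$. A closed formula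 $\varphi$ with names as parameters has a falsity value $\|\varphi\|\subseteq\Pi$ and the truth value $|\varphi|=\{t\in\Lambda : t\star\pi\in\bot\!\!\!\bot \text{ for all } \pi\in\|\varphi\|\}$, where $\|\top\|=\emptyset$, $\|\bot\|=\Pi$, $\|a\not\mathrel\varepsilon b\|=\{\pi : (a,\pi)\in b\}$, $\|a\neq b\|=\Pi$ if $a=b$ and $\emptyset$ otherwise, $\|a\notin b\|=\{t\cdot t'\cdot\pi : (c,\pi)\in b,\ t\in|a\subseteq c|,\ t'\in|c\subseteq a|\}$, $\|a\subseteq b\|=\{t\cdot\pi : (c,\pi)\in a,\ t\in|c\notin b|\}$, $\|\varphi\to\psi\|=\{t\cdot\pi : t\in|\varphi|,\ \pi\in\|\psi\|\}$, $\|\forall x\,\varphi(x)\|=\bigcup_{a}\|\varphi(a)\|$ over all names $a$. The other connectives and $\exists$ are the usual De Morgan abbreviations, $x\in y$ is $x\notin y\to\bot$, $x\not\simeq y$ is $x\subseteq y\to(y\subseteq x\to\bot)$, and $x\simeq y$ is $(x\not\simeq y)\to\bot$. We write $t\Vdash\varphi$ for $t\in|\varphi|$. For $x\in V$ let $\rho(x)=\{(\rho(y),\pi)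 : y\in x,\ \pi\in\Pi\}$ (the reish name of $x$). Let $\|\forall x^{\rho(\omega)}\varphi(x)\|=\bigcup_{n\in\omega}\|\varphi(\rho(n))\|$, where $\omega$ is that of $V$, and let $\widetilde{\mathsf{succ}}$ be the lift of the map $\rho(\alpha)\mapsto\rho(\alpha+1)$ ($\alpha$ an ordinal of $V$), so that $\|\varphi(\widetilde{\mathsf{succ}}(x))\|$ is $\|\varphi(\rho(\alpha+1))\|$ if $x=\rho(\alpha)$, and $\Pi$ if $x$ is not of this form. Then: 1. If $w_1$ is a realizer with $w_1\Vdash\forall x\,(x\simeq x)$, then $\lambda u.w_1u$ is a realizer, free of special instructions if $w_1$ is, and $$\lambda u.w_1u\Vdash\forall x^{\rho(\omega)}\bigl(\forall y^{\rho(\omega)}(x\not\simeq\widetilde{\mathsf{succ}}(y))\to\forall y\,(y\not\mathrel\varepsilon x)\bigr).$$ Moreover $w_1=\lambda u.u\,w_0\,w_0$, with $w_0=\theta\theta$ and $\theta=\lambda u.\lambda v.\,v(uu)(uu)$, is such a realizer, without special instructions. 2. The name $\rho(\omega)$ exists, and in the realizability model it is extensionally equal to the first infinite ordinal: let $\Omega(z)$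 be the formula in $\in,\simeq,\subseteq$ saying that $z$ is the least nonzero limit ordinal (an ordinal being a transitive set of transitive sets). Then each of the formulas $\exists z\,(\Omega(z)\wedge\rho(\omega)\simeq z)$ and $\forall z\,(\Omega(z)\to\rho(\omega)\simeq z)$ is realized by a realizer that contains no special instruction. -/

import Mathlib

universe u

namespace Realizability

/-! ## Models of ZF -/

/-- The only symbol of the language of set theory: binary membership. -/
inductive SetRel : ℕ → Type
  | mem : SetRel 2

/-- The first-order language of set theory. -/
def setLang : FirstOrder.Language.{0, 0} := ⟨fun _ => Empty, SetRel⟩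

instance setStructure (V : Type u) [Membership V V] : setLang.Structure V where
  funMap := fun f => f.elim
  RelMap := fun {_} r => match r with
    | SetRel.mem => fun xs => xs 0 ∈ xs 1

/-- `e` is the empty set. -/
def IsEmp {V : Type u} [Membership V V] (e : V) : Prop := ∀ x : V, x ∉ e

/-- `s` is the successor `x ∪ {x}` of `x`. -/
def IsSuc {V : Type u} [Membership V V] (s x : V) : Prop := ∀ y : V, y ∈ s ↔ y ∈ x ∨ y = x

/-- `I` contains the empty set and is closed under successor. -/
def IsInductive {V : Type u} [Membership V V] (I : V) : Prop :=
  (∃ e, e ∈ I ∧ IsEmp e) ∧ ∀ x, x ∈ I → ∃ s, s ∈ I ∧ IsSuc s x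

/-- `V`, with its relation `∈`, is a model of first-order ZF (an arbitrary one: choice is not
assumed, and the membership relation of `V` need not be well founded from outside).
The two schemes range over the predicates that are first-order definable over `V`
with parameters from `V`. -/
class IsZFModel (V : Type u) [Membership V V] : Prop where
  extensionality : ∀ a b : V, (∀ x : V, x ∈ a ↔ x ∈ b) → a = b
  foundation : ∀ a : V, (∃ x : V, x ∈ a) → ∃ x : V, x ∈ a ∧ ∀ y : V, y ∈ a → y ∉ x
  pairing : ∀ a b : V, ∃ c : V, ∀ x : V, x ∈ c ↔ x = a ∨ x = b
  union : ∀ a : V, ∃ c : V, ∀ x : V, x ∈ c ↔ ∃ b : V, b ∈ a ∧ x ∈ b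
  powerset : ∀ a : V, ∃ c : V, ∀ x : V, x ∈ c ↔ ∀ y : V, y ∈ x → y ∈ a
  infinity : ∃ a : V, IsInductive a
  separation : ∀ P : V → Prop, (Set.univ : Set V).Definable₁ setLang {x | P x} →
    ∀ a : V, ∃ b : V, ∀ x : V, x ∈ b ↔ x ∈ a ∧ P x
  replacement : ∀ R : V → V → Prop, (Set.univ : Set V).Definable₂ setLang {p | R p.1 p.2} →
    ∀ a : V, (∀ x y z : V, x ∈ a → R x y → R x z → y = z) →
      ∃ b : V, ∀ y : V, y ∈ b ↔ ∃ x : V, x ∈ a ∧ R x y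

/-! ## Elementary set theory inside `V` -/

section Sets

variable {V : Type u} [Membership V V]

/-- `n` is an element of the set `ω` of `V`: it belongs to every inductive set of `V`. -/
def IsNat (n : V) : Prop := ∀ I : V, IsInductive I → n ∈ I

/-- `a` is an ordinal of `V`: a transitive set of transitive sets. -/
def IsOrd (a : V) : Prop :=
  (∀ x y : V, x ∈ a → y ∈ x → y ∈ a) ∧ ∀ x : V, x ∈ a → ∀ y z : V, y ∈ x → z ∈ y → z ∈ x

/-- `x` has an inductive derivation in `V` by the one-step rules `step`: some set `D` of `V`
contains `x`, and each element of `D` is justified by `step` from elements of `D`.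
In every use below, a step leads to sets that are structurally smaller, so that, by foundation in
`V`, this is derivability in the usual (least fixed point) sense. -/
def Derivable (step : V → V → Prop) (x : V) : Prop := ∃ D : V, x ∈ D ∧ ∀ y : V, y ∈ D → step D y

variable [IsZFModel V]

theorem exists_emp : ∃ e : V, IsEmp e := by
  obtain ⟨_, ⟨e, _, he⟩, _⟩ := IsZFModel.infinity (V := V)
  exact ⟨e, he⟩

/-- The empty set of `V`. -/
noncomputable def emp : V := (exists_emp (V := V)).choose

/-- The unordered pair `{a, b}` in `V`. -/
noncomputable def upair (a b : V) : V := (IsZFModel.pairing a b).choose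

/-- Kuratowski's ordered pair `{{a}, {a, b}}` in `V`. -/
noncomputable def opair (a b : V) : V := upair (upair a a) (upair a b)

/-- The union of a set in `V`. -/
noncomputable def sUnion (a : V) : V := (IsZFModel.union a).choose

/-- The successor `a ∪ {a}` in `V`. -/
noncomputable def succ (a : V) : V := sUnion (upair a (upair a a))

/-- The numerals `0, 1, 2, …` of `V`. -/
noncomputable def num : ℕ → V
  | 0 => emp
  | n + 1 => succ (num n)

theorem exists_omega : ∃ w : V, ∀ n : V, n ∈ w ↔ IsNat n := by
  have hdef : (Set.univ : Set V).Definable₁ setLang {n : V | IsNat n} := by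
    let m : ∀ {n : ℕ}, setLang.Term (Fin 1 ⊕ Fin n) → setLang.Term (Fin 1 ⊕ Fin n) →
        setLang.BoundedFormula (Fin 1) n :=
      fun s t => FirstOrder.Language.Relations.boundedFormula₂ (L := setLang) SetRel.mem s t
    let f : ∀ {n : ℕ}, setLang.Term (Fin 1 ⊕ Fin n) := fun {n} => .var (.inl 0)
    let b : ∀ {n : ℕ}, Fin n → setLang.Term (Fin 1 ⊕ Fin n) := fun i => .var (.inr i)
    have hm : ∀ {n : ℕ} (s t : setLang.Term (Fin 1 ⊕ Fin n)) (v : Fin 1 → V) (xs : Fin n → V),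
        (m s t).Realize v xs ↔ s.realize (Sum.elim v xs) ∈ t.realize (Sum.elim v xs) := by
      intro n s t v xs
      exact FirstOrder.Language.BoundedFormula.realize_rel₂
    let φ : setLang.BoundedFormula (Fin 1) 0 :=
      ((((m (b 1) (b 0)) ⊓ (m (b 2) (b 1)).not.all).ex ⊓
        ((m (b 1) (b 0)).imp (((m (b 2) (b 0)) ⊓
          ((m (b 3) (b 2)).iff ((m (b 3) (b 1)) ⊔ ((b 3).bdEqual (b 1)))).all).ex)).all).imp
        (m f (b 0))).all
    refine Set.Definable.mono (Set.empty_definable_iff.2 ⟨φ, ?_⟩) (Set.empty_subset _)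
    ext v
    simp [φ, hm, FirstOrder.Language.Formula.Realize, IsNat, IsInductive, IsEmp, IsSuc, b, f,
      Fin.snoc]
  obtain ⟨a, ha⟩ := IsZFModel.infinity (V := V)
  obtain ⟨w, hw⟩ := IsZFModel.separation _ hdef a
  exact ⟨w, fun n => ⟨fun h => ((hw n).1 h).2, fun h => (hw n).2 ⟨h a ha, h⟩⟩⟩

/-- The set `ω` of `V`. -/
noncomputable def omega : V := (exists_omega (V := V)).choose

end Sets

/-! ## Terms and stacks

Terms are coded by sets of `V`, with de Bruijn indices (taken in the `ω` of `V`) in place of named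
variables, which takes care of `α`-equivalence. -/

section Terms

variable {V : Type u} [Membership V V] [IsZFModel V]

/-- The variable with de Bruijn index `n`. -/
noncomputable def tVar (n : V) : V := opair (num 0) n

/-- The application `t s`. -/
noncomputable def tApp (t s : V) : V := opair (num 1) (opair t s)

/-- The abstraction of the variable with index `0` in `t`. -/
noncomputable def tLam (t : V) : V := opair (num 2) t

/-- The term `cc`. -/
noncomputable def tCC : V := opair (num 3) emp

/-- The continuation constant of the stack `π`. -/
noncomputable def tCont (π : V) : V := opair (num 4) π

/-- The special instruction with index `α`. -/
noncomputable def tSpecial (α : V) : V := opair (num 5) α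

/-- The stack bottom with index `β`. -/
noncomputable def sBot (β : V) : V := opair (num 6) β

/-- The stack `t . π`. -/
noncomputable def sPush (t π : V) : V := opair (num 7) (opair t π)

/-- The judgement that `t` is a term with free indices below `k`. -/
noncomputable def jTerm (k t : V) : V := opair (num 0) (opair k t)

/-- The judgement that `π` is a stack. -/
noncomputable def jStack (π : V) : V := opair (num 1) π

/-- The grammar of terms and stacks, with special instructions indexed by `A`, stack bottoms
indexed by `B`, and continuation constants only if `cont` holds. -/
inductive TermStep (A B : V) (cont : Prop) (D : V) : V → Prop
  | var (k n : V) : IsNat k → n ∈ k → TermStep A B cont D (jTerm k (tVar n))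
  | app (k t s : V) : IsNat k → jTerm k t ∈ D → jTerm k s ∈ D →
      TermStep A B cont D (jTerm k (tApp t s))
  | lam (k t : V) : IsNat k → jTerm (succ k) t ∈ D → TermStep A B cont D (jTerm k (tLam t))
  | cc (k : V) : IsNat k → TermStep A B cont D (jTerm k tCC)
  | cont (k π : V) : cont → IsNat k → jStack π ∈ D → TermStep A B cont D (jTerm k (tCont π))
  | special (k α : V) : IsNat k → α ∈ A → TermStep A B cont D (jTerm k (tSpecial α))
  | bot (β : V) : β ∈ B → TermStep A B cont D (jStack (sBot β))
  | push (t π : V) : jTerm emp t ∈ D → jStack π ∈ D → TermStep A B cont D (jStack (sPush t π))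

/-- `t` is a closed `λ_c`-term. -/
def IsTerm (A B t : V) : Prop := Derivable (TermStep A B True) (jTerm emp t)

/-- `π` is a stack. -/
def IsStack (A B π : V) : Prop := Derivable (TermStep A B True) (jStack π)

/-- `t` is a realizer: a closed `λ_c`-term without continuation constants. -/
def IsRealizer (A B t : V) : Prop := Derivable (TermStep A B False) (jTerm emp t)

/-- `t` is a realizer in which no special instruction occurs. -/
def IsPureRealizer (B t : V) : Prop := IsRealizer emp B t

/-- The judgement that replacing the index `k` by the closed term `s` in `t` gives `r`. -/
noncomputable def jSubst (k t r : V) : V := opair k (opair t r)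

/-- The rules of substitution of the closed term `s` for the index `k`, where `k` is the number of
abstractions that have been crossed. -/
inductive SubstStep (s D : V) : V → Prop
  | var_eq (k : V) : SubstStep s D (jSubst k (tVar k) s)
  | var_lt (k n : V) : n ∈ k → SubstStep s D (jSubst k (tVar n) (tVar n))
  | app (k t₁ t₂ r₁ r₂ : V) : jSubst k t₁ r₁ ∈ D → jSubst k t₂ r₂ ∈ D →
      SubstStep s D (jSubst k (tApp t₁ t₂) (tApp r₁ r₂))
  | lam (k t r : V) : jSubst (succ k) t r ∈ D → SubstStep s D (jSubst k (tLam t) (tLam r))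
  | cc (k : V) : SubstStep s D (jSubst k tCC tCC)
  | cont (k π : V) : SubstStep s D (jSubst k (tCont π) (tCont π))
  | special (k α : V) : SubstStep s D (jSubst k (tSpecial α) (tSpecial α))

/-- `r` is `t[u := s]`, where `λ u . t` is closed (so `u` is the index `0` of `t`), and so is `s`. -/
def IsSubst (t s r : V) : Prop := Derivable (SubstStep s) (jSubst emp t r)

end Terms

/-! ## Realizability algebras and names -/

/-- A realizability algebra in `V`. Both `prec` and `pole` are sets of `V`. The pair of `p` and `q`
is in `prec` when `p ≺ q`; this is any preorder on processes that extends the evaluation preorder,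
that is, that contains the four evaluation rules. -/
structure RealizabilityAlgebra (V : Type u) [Membership V V] [IsZFModel V] where
  A : V
  B : V
  prec : V
  pole : V
  B_nonempty : ∃ β : V, β ∈ B
  prec_sub : ∀ x : V, x ∈ prec → ∃ t π s σ : V, IsTerm A B t ∧ IsStack A B π ∧ IsTerm A B s ∧
    IsStack A B σ ∧ x = opair (opair t π) (opair s σ)
  prec_refl : ∀ t π : V, IsTerm A B t → IsStack A B π → opair (opair t π) (opair t π) ∈ prec
  prec_trans : ∀ p q r : V, opair p q ∈ prec → opair q r ∈ prec → opair p r ∈ prec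
  push : ∀ t s π : V, IsTerm A B t → IsTerm A B s → IsStack A B π →
    opair (opair t (sPush s π)) (opair (tApp t s) π) ∈ prec
  grab : ∀ t s r π : V, IsTerm A B (tLam t) → IsTerm A B s → IsStack A B π → IsSubst t s r →
    opair (opair r π) (opair (tLam t) (sPush s π)) ∈ prec
  save : ∀ t π : V, IsTerm A B t → IsStack A B π →
    opair (opair t (sPush (tCont π) π)) (opair tCC (sPush t π)) ∈ prec
  restore : ∀ t π σ : V, IsTerm A B t → IsStack A B π → IsStack A B σ →
    opair (opair t σ) (opair (tCont σ) (sPush t π)) ∈ prec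
  pole_sub : ∀ x : V, x ∈ pole → ∃ t π : V, IsTerm A B t ∧ IsStack A B π ∧ x = opair t π
  pole_up : ∀ p q : V, opair p q ∈ prec → p ∈ pole → q ∈ pole

namespace RealizabilityAlgebra

variable {V : Type u} [Membership V V] [IsZFModel V] (𝒜 : RealizabilityAlgebra V)

/-- A name is a set all of whose elements are pairs of a name and a stack. -/
def NameStep (D a : V) : Prop :=
  ∀ z : V, z ∈ a → ∃ b π : V, b ∈ D ∧ IsStack 𝒜.A 𝒜.B π ∧ z = opair b π

/-- The class of names, the union of the hierarchy `N_α = ⋃_{β < α} 𝒫(N_β × Π)`. -/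
def Name : Type u := {a : V // Derivable 𝒜.NameStep a}

/-- The set of stacks `S` is turned into the set of all closed terms `t` with `t ⋆ π` in the pole
for every `π` in `S`. -/
def orth (S : Set V) : Set V := {t | IsTerm 𝒜.A 𝒜.B t ∧ ∀ π ∈ S, opair t π ∈ 𝒜.pole}

/-- The judgement that the falsity value of `a ⊆ b` is `S`. -/
noncomputable def jSub (a b S : V) : V := opair (num 0) (opair (opair a b) S)

/-- The judgement that the falsity value of `a ∉ b` is `S`. -/
noncomputable def jNotin (a b S : V) : V := opair (num 1) (opair (opair a b) S)

/-- The simultaneous recursion that defines the falsity values of `a ⊆ b` and `a ∉ b`. -/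
inductive FalsStep (D : V) : V → Prop
  | sub (a b S : V) :
      (∀ c π : V, opair c π ∈ a → ∃ S' : V, jNotin c b S' ∈ D) →
      (∀ ρ : V, ρ ∈ S ↔ ∃ c π t S' : V, opair c π ∈ a ∧ jNotin c b S' ∈ D ∧
        t ∈ 𝒜.orth {σ | σ ∈ S'} ∧ ρ = sPush t π) →
      FalsStep D (jSub a b S)
  | notin (a b S : V) :
      (∀ c π : V, opair c π ∈ b → (∃ S' : V, jSub a c S' ∈ D) ∧ ∃ S' : V, jSub c a S' ∈ D) →
      (∀ ρ : V, ρ ∈ S ↔ ∃ c π t t' S' S'' : V, opair c π ∈ b ∧ jSub a c S' ∈ D ∧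
        jSub c a S'' ∈ D ∧ t ∈ 𝒜.orth {σ | σ ∈ S'} ∧ t' ∈ 𝒜.orth {σ | σ ∈ S''} ∧
        ρ = sPush t (sPush t' π)) →
      FalsStep D (jNotin a b S)

/-- The falsity value of `a ⊆ b`. -/
def falsSub (a b : V) : Set V := {π | ∃ S : V, Derivable 𝒜.FalsStep (jSub a b S) ∧ π ∈ S}

/-- The falsity value of `a ∉ b`. -/
def falsNotin (a b : V) : Set V := {π | ∃ S : V, Derivable 𝒜.FalsStep (jNotin a b S) ∧ π ∈ S}

/-! ## Formulas, truth values and falsity values -/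

/-- Closed formulas with parameters in the class of names. A quantified formula is given by its
instances. `allIn X φ` is the bounded quantifier over the names in `X`, which is written
`∀ x^{ℷ(X)} φ(x)` when `X` is a set of `V`. -/
inductive Fml : Type u
  | top : Fml
  | bot : Fml
  | notEps (a b : 𝒜.Name) : Fml
  | ne (a b : 𝒜.Name) : Fml
  | notMem (a b : 𝒜.Name) : Fml
  | sub (a b : 𝒜.Name) : Fml
  | imp (φ ψ : Fml) : Fml
  | all (φ : 𝒜.Name → Fml) : Fml
  | allIn (X : Set 𝒜.Name) (φ : 𝒜.Name → Fml) : Fml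

variable {𝒜}

/-- The falsity value of a formula, a set of stacks. -/
def falsity : 𝒜.Fml → Set V
  | .top => ∅
  | .bot => {π | IsStack 𝒜.A 𝒜.B π}
  | .notEps a b => {π | IsStack 𝒜.A 𝒜.B π ∧ opair a.1 π ∈ b.1}
  | .ne a b => {π | IsStack 𝒜.A 𝒜.B π ∧ a = b}
  | .notMem a b => 𝒜.falsNotin a.1 b.1
  | .sub a b => 𝒜.falsSub a.1 b.1
  | .imp φ ψ => {ρ | ∃ t π : V, t ∈ 𝒜.orth (falsity φ) ∧ π ∈ falsity ψ ∧ ρ = sPush t π}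
  | .all φ => {π | ∃ a : 𝒜.Name, π ∈ falsity (φ a)}
  | .allIn X φ => {π | ∃ a : 𝒜.Name, a ∈ X ∧ π ∈ falsity (φ a)}

/-- The truth value of a formula, a set of closed terms. -/
def verity (φ : 𝒜.Fml) : Set V := 𝒜.orth (falsity φ)

/-- `φ` belongs to the realizability theory, as witnessed by a realizer that contains no special
instruction. -/
def ForcesPurely (φ : 𝒜.Fml) : Prop :=
  ∃ t : V, IsRealizer 𝒜.A 𝒜.B t ∧ IsPureRealizer 𝒜.B t ∧ t ∈ verity φ

namespace Fml

/- The connectives other than `→` and the existential quantifier are abbreviations. -/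

def and (φ ψ : 𝒜.Fml) : 𝒜.Fml := imp (imp φ (imp ψ bot)) bot

def or (φ ψ : 𝒜.Fml) : 𝒜.Fml := imp (imp φ bot) (imp (imp ψ bot) bot)

def iff (φ ψ : 𝒜.Fml) : 𝒜.Fml := and (imp φ ψ) (imp ψ φ)

def ex (φ : 𝒜.Name → 𝒜.Fml) : 𝒜.Fml := imp (all fun x => imp (φ x) bot) bot

/-- Extensional membership `a ∈ b`. -/
def mem (a b : 𝒜.Name) : 𝒜.Fml := imp (notMem a b) bot

/-- Negated extensional equality `a ≄ b`, which is `a ⊆ b → (b ⊆ a → ⊥)`. -/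
def nexteq (a b : 𝒜.Name) : 𝒜.Fml := imp (sub a b) (imp (sub b a) bot)

/-- Extensional equality `a ≃ b`, which is `a ⊆ b ∧ b ⊆ a`, that is, `(a ≄ b) → ⊥`. -/
def exteq (a b : 𝒜.Name) : 𝒜.Fml := and (sub a b) (sub b a)

/-- `∀ x ∈ a, φ x`. -/
def allMem (a : 𝒜.Name) (φ : 𝒜.Name → 𝒜.Fml) : 𝒜.Fml := all fun x => imp (mem x a) (φ x)

/-- The formula saying that `a` is transitive. -/
def isTransitive (a : 𝒜.Name) : 𝒜.Fml := allMem a fun x => allMem x fun y => mem y a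

/-- The formula saying that `a` is an ordinal: a transitive set of transitive sets. -/
def isOrdinal (a : 𝒜.Name) : 𝒜.Fml := and (isTransitive a) (allMem a isTransitive)

/-- The formula saying that `e` is empty. -/
def isEmpty (e : 𝒜.Name) : 𝒜.Fml := all fun x => notMem x e

/-- The formula saying that `s` is the successor `x ∪ {x}` of `x`. -/
def isSuccessor (s x : 𝒜.Name) : 𝒜.Fml := all fun y => iff (mem y s) (or (mem y x) (exteq y x))

/-- The formula saying that `a` is a nonzero limit ordinal: an ordinal that contains the empty set
and is closed under successor. -/
def isLimitOrdinal (a : 𝒜.Name) : 𝒜.Fml :=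
  and (isOrdinal a) (and (ex fun e => and (isEmpty e) (mem e a))
    (allMem a fun x => ex fun s => and (isSuccessor s x) (mem s a)))

/-- The formula saying that `a` is the first infinite ordinal, that is, the least nonzero limit
ordinal. -/
def isFirstInfiniteOrdinal (a : 𝒜.Name) : 𝒜.Fml :=
  and (isLimitOrdinal a) (all fun b => imp (isLimitOrdinal b) (sub a b))

open Classical in
/-- `φ(f(x))` for the lift of a partial function `f` on names with graph `G`: the formula `φ(f(x))`
if `f` is defined at `x`, and one with the falsity value `Π` otherwise. -/
noncomputable def applyLift (G : 𝒜.Name → 𝒜.Name → Prop) (x : 𝒜.Name) (φ : 𝒜.Name → 𝒜.Fml) :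
    𝒜.Fml :=
  if h : ∃ y, G x y then φ h.choose else bot

end Fml

/-! ## Reish names -/

variable (𝒜)

/-- The recursion `ℸ x = {(ℸ y, π) | y ∈ x, π ∈ Π}`; the pair of `x` and `a` is in `D` when `a` is
the value at `x`. -/
def ReishStep (D p : V) : Prop :=
  ∃ x a : V, p = opair x a ∧ (∀ y : V, y ∈ x → ∃ b : V, opair y b ∈ D) ∧
    ∀ z : V, z ∈ a ↔ ∃ y b π : V, y ∈ x ∧ opair y b ∈ D ∧ IsStack 𝒜.A 𝒜.B π ∧ z = opair b π

/-- `a = ℸ x`. -/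
def IsReish (x a : V) : Prop := Derivable 𝒜.ReishStep (opair x a)

/-- The names `ℸ n` for `n ∈ ω`; the gimel name of this set is `ℸ ω`. -/
def reishNats : Set 𝒜.Name := {a | ∃ n : V, n ∈ (omega : V) ∧ 𝒜.IsReish n a.1}

/-- The graph of the function `ℸ α ↦ ℸ (α + 1)`, for the ordinals `α` of `V`. -/
def SuccGraph (a b : 𝒜.Name) : Prop :=
  ∃ α : V, IsOrd α ∧ 𝒜.IsReish α a.1 ∧ 𝒜.IsReish (succ α) b.1

/-- `∀ x (x ≃ x)`. -/
def reflFml : 𝒜.Fml := .all fun x => .exteq x x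

/-- `∀ x^{ℸ ω} (∀ y^{ℸ ω} (x ≄ succ(y)) → ∀ y (y is not a strong element of x))`, where `succ` is the
lifted successor function. -/
noncomputable def zeroOrSuccFml : 𝒜.Fml :=
  .allIn 𝒜.reishNats fun x =>
    .imp (.allIn 𝒜.reishNats fun y => .applyLift 𝒜.SuccGraph y fun z => .nexteq x z)
      (.all fun y => .notEps y x)

end RealizabilityAlgebra

/-! ## Particular terms -/

section

variable {V : Type u} [Membership V V] [IsZFModel V]

/-- `θ = λ u . λ v . (v (u u)) (u u)`. -/
noncomputable def theta : V :=
  tLam (tLam (tApp (tApp (tVar (num 0)) (tApp (tVar (num 1)) (tVar (num 1))))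
    (tApp (tVar (num 1)) (tVar (num 1)))))

/-- `w₀ = θ θ`. -/
noncomputable def wZero : V := tApp theta theta

/-- `w₁ = λ u . u w₀ w₀`. -/
noncomputable def wOne : V := tLam (tApp (tApp (tVar (num 0)) wZero) wZero)

/-- `λ u . w u`, for a closed term `w`. -/
noncomputable def etaTerm (w : V) : V := tLam (tApp w (tVar (num 0)))

end

end Realizability

/-!
# The reish name of `ω` is the first infinite ordinal of the realizability model

The term `λ u. w u` works because a strong element of `ℸ n` forces `n = m + 1` in `V`, so that the
premise, taken at `ℸ m`, realizes `ℸ n ≄ ℸ n`, which `w` refutes. The term `w₀ = θ θ` realizes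
`a ⊆ a` by induction on the name `a`, since `w₀ ⋆ t · π` reduces to `t ⋆ w₀ · w₀ · π`; in fact it
realizes `a ⊆ b` whenever `a` is a subset of `b` in `V`, as is `ℸ m` of `ℸ n` for `m ≤ n`.

For the identification of `ℸ ω`, the realizers are not written down. All combinators, that is,
closed terms without special instructions and continuation constants, are realizers, and the
families of formulas with a common combinator (`Valid`) are closed under classical first-order
deduction. Hence Henkin's argument (`Fo.valid_of_sat`) gives a completeness theorem: a first-order
formula about `ℸ ω` has such a realizer as soon as it holds in every Tarski structure in which all
formulas with such a realizer hold. It therefore suffices to realize a few axioms, collected in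
`Rels.IsReishModel`, and to derive from them, in ordinary mathematics, that `ℸ ω` is the first
infinite ordinal.

The axioms are the defining equivalences of `⊆` and `∉`, for which the two sides have the same
falsity values; induction along `ε`, which is realized by a fixed point combinator
(`Fo.valid_epsInduction`); and a description of the strong elements of `ℸ ω`: they are nested, each
nonempty one has a largest element with respect to `⊆`, and each is the largest element of another
one. The last two hold because the elements of `n + 1` are `n` and smaller numbers. From induction
it follows that an element of `ℸ ω` that is included in another belongs or is extensionally equal to
it (`Rels.IsReishModel.mem_or_sub`), so that the element with the largest element `m` is the
successor of `m`. This makes `ℸ ω` a limit ordinal, and one that is included in every other, by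
induction along `ε`.

As `V` is only a model of first-order ZF, whose membership need not be well founded, each induction
and recursion over names rests on separation or replacement for a predicate that must be shown to be
definable. The classes `DefPred` and `DefFun` find the definability proofs by instance
search, and `Derivable.recursion` provides the falsity values of `a ⊆ b` and `a ∉ b` and the names
`ℸ n` and `ℸ ω` from their derivations.
-/

namespace Realizability

open Set FirstOrder FirstOrder.Language

/-! ### Definability over `V` -/

section Definability

variable {V : Type u} [Membership V V]

/-- An assignment without its value at `0`. It is reducible because the instances below for bound
variables are found by unification with `e (n + 1)`. -/
abbrev tail {α : Type*} (e : ℕ → α) : ℕ → α := fun n => e (n + 1)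

/-- The assignment that sends `0` to `a` and `n + 1` to `e n`. -/
def push {α : Type*} (a : α) (e : ℕ → α) : ℕ → α
  | 0 => a
  | n + 1 => e n

/-- `P` is first-order definable over `V` with parameters. The free variables of `P` are the values
`e 0, e 1, …` of an assignment, and instances follow the form of `P`; a bound variable becomes the
value at `0` and shifts the others. -/
class DefPred (P : (ℕ → V) → Prop) : Prop where
  definable : (univ : Set V).Definable setLang {e | P e}

/-- The graph of `f` is first-order definable over `V` with parameters. -/
class DefFun (f : (ℕ → V) → V) : Prop where
  graph : DefPred fun e => e 0 = f (tail e)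

theorem DefPred.congr {P Q : (ℕ → V) → Prop} (h : DefPred P) (hPQ : ∀ e, Q e ↔ P e) : DefPred Q :=
  (funext fun e => propext (hPQ e) : Q = P) ▸ h

theorem DefPred.reindex {P : (ℕ → V) → Prop} (h : DefPred P) (g : ℕ → ℕ) :
    DefPred fun e => P fun n => e (g n) :=
  ⟨h.definable.preimage_comp g⟩

instance DefPred.and {P Q : (ℕ → V) → Prop} [hP : DefPred P] [hQ : DefPred Q] :
    DefPred fun e => P e ∧ Q e := ⟨hP.definable.inter hQ.definable⟩

instance DefPred.or {P Q : (ℕ → V) → Prop} [hP : DefPred P] [hQ : DefPred Q] :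
    DefPred fun e => P e ∨ Q e := ⟨hP.definable.union hQ.definable⟩

instance DefPred.not {P : (ℕ → V) → Prop} [hP : DefPred P] : DefPred fun e => ¬ P e :=
  ⟨hP.definable.compl⟩

instance DefPred.imp {P Q : (ℕ → V) → Prop} [hP : DefPred P] [hQ : DefPred Q] :
    DefPred fun e => P e → Q e :=
  DefPred.congr (P := fun e => ¬ P e ∨ Q e) inferInstance fun _ => imp_iff_not_or

instance DefPred.iff {P Q : (ℕ → V) → Prop} [hP : DefPred P] [hQ : DefPred Q] :
    DefPred fun e => P e ↔ Q e :=
  DefPred.congr (P := fun e => (P e → Q e) ∧ (Q e → P e)) inferInstance fun _ => iff_def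

theorem DefPred.exists_push {P : (ℕ → V) → Prop} (h : DefPred P) :
    DefPred fun e => ∃ x, P (push x e) := by
  obtain ⟨φ, hφ⟩ := h.definable
  let g : ℕ → ℕ ⊕ Fin 1 := fun n => Nat.casesOn n (.inr 0) .inl
  refine ⟨(BoundedFormula.relabel (k := 0) g φ).ex, ?_⟩
  ext e
  simp only [mem_ofPred_eq, Formula.Realize, BoundedFormula.realize_ex]
  refine exists_congr fun x => ?_
  rw [BoundedFormula.realize_relabel]
  have h1 : P (push x e) ↔ φ.Realize (push x e) := by
    have := congrArg (push x e ∈ ·) hφ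
    simpa using this
  rw [h1]
  have h2 : (Sum.elim e (Fin.snoc default x ∘ Fin.castAdd 0) ∘ g) = push x e := by
    funext n
    cases n with
    | zero => simp [g, push, Fin.snoc]
    | succ n => simp [g, push]
  rw [h2, Formula.Realize]
  exact iff_of_eq (congrArg _ (funext fun i => i.elim0))

omit [Membership V V] in
theorem push_eta (e : ℕ → V) : push (e 0) (tail e) = e := by
  funext n; cases n <;> rfl

instance DefPred.exists {P : (ℕ → V) → V → Prop} [h : DefPred fun e => P (tail e) (e 0)] :
    DefPred fun e => ∃ x, P e x :=
  DefPred.exists_push h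

instance DefPred.forall {P : (ℕ → V) → V → Prop} [h : DefPred fun e => P (tail e) (e 0)] :
    DefPred fun e => ∀ x, P e x :=
  DefPred.congr (P := fun e => ¬ ∃ x, ¬ P e x) inferInstance fun _ => by simp

theorem DefPred.mem_var (m n : ℕ) : DefPred fun e : ℕ → V => e m ∈ e n :=
  ⟨Definable.mono (empty_definable_iff.2
    ⟨(Relations.formula₂ (L := setLang) SetRel.mem (.var m) (.var n)), by
      ext e
      have : (Relations.formula₂ (L := setLang) SetRel.mem (.var m) (.var n)).Realize e ↔
          Structure.RelMap (L := setLang) (M := V) SetRel.mem ![e m, e n] :=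
        Formula.realize_rel₂
      exact this.symm⟩) (empty_subset _)⟩

theorem DefPred.eq_var (m n : ℕ) : DefPred fun e : ℕ → V => e m = e n :=
  ⟨Definable.mono (empty_definable_iff.2
    ⟨Term.equal (L := setLang) (.var m) (.var n), by
      ext e; simp⟩) (empty_subset _)⟩

theorem DefPred.eq_const (m : ℕ) (c : V) : DefPred fun e : ℕ → V => e m = c :=
  ⟨⟨Term.equal (.var m) (Constants.term (L := setLang[[(univ : Set V)]])
    (setLang.con (⟨c, mem_univ c⟩ : (univ : Set V)))), by
      ext e; simp⟩⟩

instance DefPred.const (p : Prop) : DefPred fun _ : ℕ → V => p := by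
  by_cases hp : p
  · exact ⟨by simp [hp]⟩
  · exact ⟨by simp [hp]⟩

instance DefFun.var (n : ℕ) : DefFun fun e : ℕ → V => e n := ⟨DefPred.eq_var 0 (n + 1)⟩

instance DefFun.const (c : V) : DefFun fun _ : ℕ → V => c := ⟨DefPred.eq_const 0 c⟩

theorem DefPred.subst {P : (ℕ → V) → Prop} {f : (ℕ → V) → V} (hP : DefPred P) (hf : DefFun f) :
    DefPred fun e => P (push (f e) e) := by
  have := hf.graph
  refine DefPred.congr (P := fun e => ∃ x, (x = f e ∧ P (push x e))) ?_ fun e => by simp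
  refine @DefPred.exists _ _ (fun e x => x = f e ∧ P (push x e)) ?_
  simpa only [push_eta] using! DefPred.and (P := fun e => e 0 = f (tail e)) (Q := P)

theorem DefFun.reindex {f : (ℕ → V) → V} (h : DefFun f) (g : ℕ → ℕ) :
    DefFun fun e => f fun n => e (g n) :=
  ⟨h.graph.reindex fun n => Nat.casesOn n 0 fun n => g n + 1⟩

/-- Variables may be replaced by other variables and by parameters, infinitely many at a time. -/
theorem DefPred.specialize {P : (ℕ → V) → Prop} (h : DefPred P) (g : ℕ → ℕ ⊕ V) :
    DefPred fun e => P fun n => Sum.elim e id (g n) := by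
  obtain ⟨φ, hφ⟩ := h.definable
  refine ⟨BoundedFormula.subst φ fun n => Sum.elim Term.var
    (fun c => Constants.term (L := setLang[[(univ : Set V)]])
      (setLang.con (⟨c, mem_univ c⟩ : (univ : Set V)))) (g n), ?_⟩
  ext e
  have h1 : ∀ e, P e ↔ φ.Realize e := fun e => by
    have := congrArg (e ∈ ·) hφ
    simpa using this
  simp only [mem_ofPred_eq, h1, Formula.Realize, BoundedFormula.realize_subst]
  refine iff_of_eq (congrArg (fun v => BoundedFormula.Realize φ v default) (funext fun n => ?_))
  rcases g n with k | c <;> simp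

theorem DefPred.comp₁ {R : V → Prop} (hR : DefPred fun e => R (e 0)) (f : (ℕ → V) → V)
    [hf : DefFun f] : DefPred fun e => R (f e) :=
  hR.subst hf

theorem DefPred.comp₂ {R : V → V → Prop} (hR : DefPred fun e => R (e 0) (e 1))
    (f g : (ℕ → V) → V) [hf : DefFun f] [hg : DefFun g] : DefPred fun e => R (f e) (g e) := by
  have h1 : DefPred fun e => R (e 0) (g (tail e)) :=
    (hR.reindex fun n => 1 - n).subst (hg.reindex (· + 1))
  exact h1.subst hf

theorem DefPred.comp₃ {R : V → V → V → Prop} (hR : DefPred fun e => R (e 0) (e 1) (e 2))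
    (f g h : (ℕ → V) → V) [hf : DefFun f] [hg : DefFun g] [hh : DefFun h] :
    DefPred fun e => R (f e) (g e) (h e) := by
  have h1 : DefPred fun e => R (e 0) (e 1) (h (tail (tail e))) :=
    (hR.reindex fun n => if n = 2 then 0 else n + 1).subst ((hh.reindex (· + 1)).reindex (· + 1))
  have h2 : DefPred fun e => R (e 0) (g (tail e)) (h (tail e)) :=
    (h1.reindex fun n => match n with
      | 0 => 1
      | 1 => 0
      | n + 2 => n + 2).subst (hg.reindex (· + 1))
  exact h2.subst hf

theorem DefFun.comp₁ {h : V → V} (hh : DefPred fun e => e 0 = h (e 1)) (f : (ℕ → V) → V)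
    [hf : DefFun f] : DefFun fun e => h (f e) :=
  have := hf.reindex (· + 1)
  ⟨DefPred.comp₂ (R := fun z x => z = h x) hh (fun e => e 0) (fun e => f (tail e))⟩

theorem DefFun.comp₂ {h : V → V → V} (hh : DefPred fun e => e 0 = h (e 1) (e 2))
    (f g : (ℕ → V) → V) [hf : DefFun f] [hg : DefFun g] : DefFun fun e => h (f e) (g e) :=
  have := hf.reindex (· + 1)
  have := hg.reindex (· + 1)
  ⟨DefPred.comp₃ (R := fun z x y => z = h x y) hh (fun e => e 0) (fun e => f (tail e))
    (fun e => g (tail e))⟩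

instance DefPred.mem (f g : (ℕ → V) → V) [DefFun f] [DefFun g] :
    DefPred fun e : ℕ → V => f e ∈ g e :=
  DefPred.comp₂ (R := fun x y => x ∈ y) (DefPred.mem_var 0 1) f g

instance DefPred.eq (f g : (ℕ → V) → V) [DefFun f] [DefFun g] : DefPred fun e => f e = g e :=
  DefPred.comp₂ (R := fun x y => x = y) (DefPred.eq_var 0 1) f g

end Definability

/-! ### Set theory inside `V` -/

section SetTheory

variable {V : Type u} [Membership V V] [IsZFModel V]

theorem set_ext {a b : V} (h : ∀ x, x ∈ a ↔ x ∈ b) : a = b := IsZFModel.extensionality a b h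

/-- Separation for definable predicates. -/
theorem exists_sep (P : V → Prop) (a : V) (h : DefPred fun e => P (e 0) := by infer_instance) :
    ∃ b : V, ∀ x, x ∈ b ↔ x ∈ a ∧ P x :=
  IsZFModel.separation P (h.definable.preimage_comp fun _ => (0 : Fin 1)) a

/-- Replacement for definable functions. -/
theorem exists_image (R : V → V → Prop) [h : DefPred fun e => R (e 0) (e 1)] (a : V)
    (hR : ∀ x y z, x ∈ a → R x y → R x z → y = z) : ∃ b : V, ∀ y, y ∈ b ↔ ∃ x, x ∈ a ∧ R x y :=
  IsZFModel.replacement R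
    (h.definable.preimage_comp fun n : ℕ => (if n = 0 then 0 else 1 : Fin 2)) a hR

@[simp] theorem not_mem_emp (x : V) : x ∉ (emp : V) := (exists_emp (V := V)).choose_spec x

@[simp] theorem mem_upair {a b x : V} : x ∈ upair a b ↔ x = a ∨ x = b :=
  (IsZFModel.pairing a b).choose_spec x

@[simp] theorem mem_sUnion {a x : V} : x ∈ sUnion a ↔ ∃ b, b ∈ a ∧ x ∈ b :=
  (IsZFModel.union a).choose_spec x

@[simp] theorem mem_succ {a x : V} : x ∈ succ a ↔ x ∈ a ∨ x = a := by
  simp [succ]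

theorem upair_inj {a b c d : V} : upair a b = upair c d ↔ a = c ∧ b = d ∨ a = d ∧ b = c := by
  constructor
  · intro h
    have h1 : ∀ x, x = a ∨ x = b ↔ x = c ∨ x = d := fun x => by
      rw [← mem_upair, h, mem_upair]
    have := h1 a; have := h1 b; have := h1 c; have := h1 d
    grind
  · rintro (⟨rfl, rfl⟩ | ⟨rfl, rfl⟩)
    · rfl
    · exact set_ext fun x => by simp [or_comm]

@[simp] theorem opair_inj {a b c d : V} : opair a b = opair c d ↔ a = c ∧ b = d := by
  simp only [opair, upair_inj]
  grind

instance (f g : (ℕ → V) → V) [DefFun f] [DefFun g] : DefFun fun e => upair (f e) (g e) :=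
  DefFun.comp₂ (h := upair) (DefPred.congr
    (P := fun e : ℕ → V => ∀ x, x ∈ e 0 ↔ x = e 1 ∨ x = e 2) inferInstance fun e =>
      ⟨fun h x => by rw [h, mem_upair], fun h => set_ext fun x => by rw [h, mem_upair]⟩) f g

instance (f g : (ℕ → V) → V) [DefFun f] [DefFun g] : DefFun fun e => opair (f e) (g e) := by
  unfold opair; infer_instance

instance (f : (ℕ → V) → V) [DefFun f] : DefFun fun e => sUnion (f e) :=
  DefFun.comp₁ (h := sUnion) (DefPred.congr
    (P := fun e : ℕ → V => ∀ x, x ∈ e 0 ↔ ∃ b, b ∈ e 1 ∧ x ∈ b) inferInstance fun e =>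
      ⟨fun h x => by rw [h, mem_sUnion], fun h => set_ext fun x => by rw [h, mem_sUnion]⟩) f

instance (f : (ℕ → V) → V) [DefFun f] : DefFun fun e => succ (f e) := by
  unfold succ; infer_instance

theorem exists_union (a b : V) : ∃ c : V, ∀ x, x ∈ c ↔ x ∈ a ∨ x ∈ b :=
  ⟨sUnion (upair a b), fun x => by simp⟩

theorem exists_insert (a b : V) : ∃ c : V, ∀ x, x ∈ c ↔ x ∈ a ∨ x = b := by
  obtain ⟨c, hc⟩ := exists_union a (upair b b)
  exact ⟨c, fun x => by simp [hc]⟩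

/-- Replacement for a binary definable function. -/
theorem exists_image₂ (R : V → V → V → Prop) [h : DefPred fun e => R (e 0) (e 1) (e 2)] (a b : V)
    (hR : ∀ x y z w, x ∈ a → y ∈ b → R x y z → R x y w → z = w) :
    ∃ c : V, ∀ z, z ∈ c ↔ ∃ x y, x ∈ a ∧ y ∈ b ∧ R x y z := by
  have hd : ∀ f g k : (ℕ → V) → V, [DefFun f] → [DefFun g] → [DefFun k] →
    DefPred fun e => R (f e) (g e) (k e) := fun f g k _ _ _ => DefPred.comp₃ h f g k
  have hrow : ∀ x, x ∈ a → ∃ c : V, ∀ z, z ∈ c ↔ ∃ y, y ∈ b ∧ R x y z := fun x hx => by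
    exact exists_image (R x) b fun y z w hy => hR x y z w hx hy
  obtain ⟨c, hc⟩ := exists_image (fun x c => ∀ z, z ∈ c ↔ ∃ y, y ∈ b ∧ R x y z) a
    fun x y z _ h1 h2 => set_ext fun w => by rw [h1, h2]
  refine ⟨sUnion c, fun z => ?_⟩
  simp only [mem_sUnion, hc]
  constructor
  · rintro ⟨d, ⟨x, hx, hd⟩, hz⟩
    obtain ⟨y, hy, hR⟩ := (hd z).1 hz
    exact ⟨x, y, hx, hy, hR⟩
  · rintro ⟨x, y, hx, hy, hz⟩
    obtain ⟨d, hd⟩ := hrow x hx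
    exact ⟨d, ⟨x, hx, hd⟩, (hd z).2 ⟨y, hy, hz⟩⟩

/-- Foundation as induction along the elements of a transitive set. -/
theorem mem_induction {K : V} (hK : ∀ x y, x ∈ K → y ∈ x → y ∈ K) (P : V → Prop)
    [h : DefPred fun e => P (e 0)] (step : ∀ x, x ∈ K → (∀ y, y ∈ x → P y) → P x) :
    ∀ x, x ∈ K → P x := by
  by_contra! hc
  obtain ⟨x, hxK, hx⟩ := hc
  obtain ⟨b, hb⟩ := exists_sep (fun x => ¬ P x) K
  obtain ⟨m, hm, hmin⟩ := IsZFModel.foundation b ⟨x, (hb x).2 ⟨hxK, hx⟩⟩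
  obtain ⟨hmK, hmP⟩ := (hb m).1 hm
  refine hmP (step m hmK fun y hy => ?_)
  by_contra hyP
  exact hmin y ((hb y).2 ⟨hK m y hmK hy, hyP⟩) hy

theorem mem_irrefl (x : V) : x ∉ x := fun h => by
  obtain ⟨y, hy, hmin⟩ := IsZFModel.foundation (upair x x) ⟨x, by simp⟩
  have : y = x := by simpa using hy
  subst this
  exact hmin y hy h

/-! ### Natural numbers -/

theorem isEmp_iff {e : V} : IsEmp e ↔ e = emp :=
  ⟨fun h => set_ext fun x => by simp [h x], fun h => h ▸ not_mem_emp⟩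

theorem isSuc_iff {s x : V} : IsSuc s x ↔ s = succ x :=
  ⟨fun h => set_ext fun y => by rw [h y, mem_succ], fun h y => by rw [h, mem_succ]⟩

theorem isInductive_iff {I : V} : IsInductive I ↔ emp ∈ I ∧ ∀ x, x ∈ I → succ x ∈ I := by
  simp only [IsInductive, isEmp_iff, isSuc_iff]
  simp

theorem mem_omega {n : V} : n ∈ (omega : V) ↔ IsNat n := (exists_omega (V := V)).choose_spec n

theorem emp_mem_omega : (emp : V) ∈ (omega : V) :=
  mem_omega.2 fun _ hI => (isInductive_iff.1 hI).1

theorem succ_mem_omega {n : V} (hn : n ∈ (omega : V)) : succ n ∈ (omega : V) :=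
  mem_omega.2 fun I hI => (isInductive_iff.1 hI).2 n (mem_omega.1 hn I hI)

theorem omega_induction (P : V → Prop) [DefPred fun e => P (e 0)] (h0 : P emp)
    (hs : ∀ n, n ∈ (omega : V) → P n → P (succ n)) {n : V} (hn : n ∈ (omega : V)) : P n := by
  obtain ⟨I, hI⟩ := exists_sep P (omega : V)
  refine ((hI n).1 (mem_omega.1 hn I (isInductive_iff.2 ⟨(hI _).2 ⟨emp_mem_omega, h0⟩, ?_⟩))).2
  intro x hx
  obtain ⟨hx, hP⟩ := (hI x).1 hx
  exact (hI _).2 ⟨succ_mem_omega hx, hs x hx hP⟩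

theorem eq_emp_or_succ {n : V} (hn : n ∈ (omega : V)) :
    n = emp ∨ ∃ m, m ∈ (omega : V) ∧ n = succ m :=
  omega_induction (fun n => n = emp ∨ ∃ m, m ∈ (omega : V) ∧ n = succ m) (.inl rfl)
    (fun m hm _ => .inr ⟨m, hm, rfl⟩) hn

theorem omega_transitive {n x : V} (hn : n ∈ (omega : V)) : x ∈ n → x ∈ (omega : V) :=
  omega_induction (fun n => ∀ x, x ∈ n → x ∈ (omega : V)) (by simp)
    (fun n hn ih x hx => (mem_succ.1 hx).elim (ih x) (· ▸ hn)) hn x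

theorem nat_transitive {n x y : V} (hn : n ∈ (omega : V)) : x ∈ n → y ∈ x → y ∈ n :=
  omega_induction (fun n => ∀ x y, x ∈ n → y ∈ x → y ∈ n) (by simp)
    (fun n _ ih x y hx hy => by
      rcases mem_succ.1 hx with hx | rfl
      · exact mem_succ.2 (.inl (ih x y hx hy))
      · exact mem_succ.2 (.inl hy)) hn x y

theorem isOrd_of_mem_omega {n : V} (hn : n ∈ (omega : V)) : IsOrd n :=
  ⟨fun _ _ => nat_transitive hn, fun _ hx _ _ => nat_transitive (omega_transitive hn hx)⟩

theorem emp_mem_succ {k : V} (hk : k ∈ (omega : V)) : (emp : V) ∈ succ k :=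
  omega_induction (fun k => (emp : V) ∈ succ k) (by simp)
    (fun _ _ ih => mem_succ.2 (.inl ih)) hk

theorem succ_mem_succ {k l : V} (hk : k ∈ (omega : V)) : l ∈ k → succ l ∈ succ k :=
  omega_induction (fun k => ∀ l, l ∈ k → succ l ∈ succ k) (by simp)
    (fun k _ ih l hl => by
      rcases mem_succ.1 hl with hl | rfl
      · exact mem_succ.2 (.inl (ih l hl))
      · simp) hk l

theorem num_mem_omega (n : ℕ) : (num n : V) ∈ (omega : V) := by
  induction n with
  | zero => exact emp_mem_omega
  | succ n ih => exact succ_mem_omega ih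

theorem num_mem_num {m n : ℕ} (h : m < n) : (num m : V) ∈ (num n : V) := by
  induction h with
  | refl => exact mem_succ.2 (.inr rfl)
  | step _ ih => exact mem_succ.2 (.inl ih)

@[simp] theorem num_inj {m n : ℕ} : (num m : V) = num n ↔ m = n := by
  refine ⟨fun h => ?_, fun h => h ▸ rfl⟩
  by_contra hmn
  rcases Nat.lt_or_gt_of_ne hmn with h1 | h1
  · have := num_mem_num (V := V) h1
    rw [h] at this
    exact mem_irrefl _ this
  · have := num_mem_num (V := V) h1
    rw [h] at this
    exact mem_irrefl _ this

end SetTheory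

/-! ### Grammar of terms and stacks -/

section Terms

variable {V : Type u} [Membership V V] [IsZFModel V]

theorem TermStep.mono {A A' B : V} {cont cont' : Prop} {D D' y : V} (hA : ∀ x, x ∈ A → x ∈ A')
    (hc : cont → cont') (hD : ∀ x, x ∈ D → x ∈ D') (h : TermStep A B cont D y) :
    TermStep A' B cont' D' y := by
  cases h with
  | var k n hk hn => exact .var k n hk hn
  | app k t s hk ht hs => exact .app k t s hk (hD _ ht) (hD _ hs)
  | lam k t hk ht => exact .lam k t hk (hD _ ht)
  | cc k hk => exact .cc k hk
  | cont k π h hk hπ => exact .cont k π (hc h) hk (hD _ hπ)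
  | special k α hk hα => exact .special k α hk (hA _ hα)
  | bot β hβ => exact .bot β hβ
  | push t π ht hπ => exact .push t π (hD _ ht) (hD _ hπ)

theorem SubstStep.mono {s D D' y : V} (hD : ∀ x, x ∈ D → x ∈ D') (h : SubstStep s D y) :
    SubstStep s D' y := by
  cases h with
  | var_eq k => exact .var_eq k
  | var_lt k n hn => exact .var_lt k n hn
  | app k t₁ t₂ r₁ r₂ h₁ h₂ => exact .app k t₁ t₂ r₁ r₂ (hD _ h₁) (hD _ h₂)
  | lam k t r h => exact .lam k t r (hD _ h)
  | cc k => exact .cc k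
  | cont k π => exact .cont k π
  | special k α => exact .special k α

/-- Rules that are monotone in the set of earlier judgements apply to derivable premises. -/
theorem Derivable.intro₂ {step : V → V → Prop}
    (mono : ∀ D D' y, (∀ x, x ∈ D → x ∈ D') → step D y → step D' y) {x y z : V}
    (hx : Derivable step x) (hy : Derivable step y) (h : ∀ D, x ∈ D → y ∈ D → step D z) :
    Derivable step z := by
  obtain ⟨D₁, hx, h₁⟩ := hx
  obtain ⟨D₂, hy, h₂⟩ := hy
  obtain ⟨D₃, h₃⟩ := exists_union D₁ D₂
  obtain ⟨D, hD⟩ := exists_insert D₃ z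
  have i₁ : ∀ w, w ∈ D₁ → w ∈ D := fun w hw => (hD w).2 (.inl ((h₃ w).2 (.inl hw)))
  have i₂ : ∀ w, w ∈ D₂ → w ∈ D := fun w hw => (hD w).2 (.inl ((h₃ w).2 (.inr hw)))
  refine ⟨D, (hD z).2 (.inr rfl), fun w hw => ?_⟩
  rcases (hD w).1 hw with hw | rfl
  · rcases (h₃ w).1 hw with hw | hw
    · exact mono _ _ _ i₁ (h₁ w hw)
    · exact mono _ _ _ i₂ (h₂ w hw)
  · exact h D (i₁ x hx) (i₂ y hy)

theorem Derivable.intro₁ {step : V → V → Prop}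
    (mono : ∀ D D' y, (∀ x, x ∈ D → x ∈ D') → step D y → step D' y) {x z : V}
    (hx : Derivable step x) (h : ∀ D, x ∈ D → step D z) : Derivable step z :=
  .intro₂ mono hx hx fun D hD _ => h D hD

theorem Derivable.intro₀ {step : V → V → Prop} {z : V} (h : ∀ D, step D z) : Derivable step z :=
  ⟨upair z z, by simp, fun y hy => by
    have : y = z := by simpa using hy
    exact this.symm ▸ h _⟩

/-- `t` is a term of the grammar with special instructions in `A`, stack bottoms in `B` and
continuation constants if `cont` holds, whose free indices are below `k`. -/
def IsOpenTerm (A B : V) (cont : Prop) (k t : V) : Prop :=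
  Derivable (TermStep A B cont) (jTerm k t)

section Grammar

variable {A B : V} {cont : Prop}

theorem termStep_mono : ∀ D D' y : V, (∀ x, x ∈ D → x ∈ D') → TermStep A B cont D y →
    TermStep A B cont D' y :=
  fun _ _ _ hD h => h.mono (fun _ => id) id hD

theorem IsOpenTerm.mono {A' k t : V} {cont' : Prop} (hA : ∀ x, x ∈ A → x ∈ A') (hc : cont → cont')
    (h : IsOpenTerm A B cont k t) : IsOpenTerm A' B cont' k t := by
  obtain ⟨D, ht, hD⟩ := h
  exact ⟨D, ht, fun y hy => (hD y hy).mono hA hc fun _ => id⟩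

theorem IsRealizer.isTerm {t : V} (h : IsRealizer A B t) : IsTerm A B t :=
  IsOpenTerm.mono (fun _ => id) False.elim h

theorem isOpenTerm_var {k n : V} (hk : k ∈ (omega : V)) (hn : n ∈ k) :
    IsOpenTerm A B cont k (tVar n) :=
  .intro₀ fun _ => .var k n (mem_omega.1 hk) hn

theorem IsOpenTerm.app {k t s : V} (hk : k ∈ (omega : V)) (ht : IsOpenTerm A B cont k t)
    (hs : IsOpenTerm A B cont k s) : IsOpenTerm A B cont k (tApp t s) :=
  .intro₂ termStep_mono ht hs fun _ h₁ h₂ => .app k t s (mem_omega.1 hk) h₁ h₂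

theorem IsOpenTerm.lam {k t : V} (hk : k ∈ (omega : V)) (ht : IsOpenTerm A B cont (succ k) t) :
    IsOpenTerm A B cont k (tLam t) :=
  .intro₁ termStep_mono ht fun _ h => .lam k t (mem_omega.1 hk) h

theorem isOpenTerm_cc {k : V} (hk : k ∈ (omega : V)) : IsOpenTerm A B cont k tCC :=
  .intro₀ fun _ => .cc k (mem_omega.1 hk)

theorem IsStack.isTerm_cont {π : V} (hπ : IsStack A B π) : IsTerm A B (tCont π) :=
  .intro₁ termStep_mono hπ fun _ h => .cont emp π trivial (mem_omega.1 emp_mem_omega) h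

theorem IsStack.push {t π : V} (hπ : IsStack A B π) (ht : IsTerm A B t) :
    IsStack A B (sPush t π) :=
  .intro₂ termStep_mono ht hπ fun _ h₁ h₂ => .push t π h₁ h₂

theorem isStack_bot {β : V} (hβ : β ∈ B) : IsStack A B (sBot β) :=
  .intro₀ fun _ => .bot β hβ

/-- Inversion of the grammar. -/
theorem TermStep.cases_term {D k t : V} (h : TermStep A B cont D (jTerm k t)) :
    (∃ n, n ∈ k ∧ t = tVar n) ∨
    (∃ t₁ t₂, jTerm k t₁ ∈ D ∧ jTerm k t₂ ∈ D ∧ t = tApp t₁ t₂) ∨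
    (∃ t', jTerm (succ k) t' ∈ D ∧ t = tLam t') ∨ t = tCC ∨
    (∃ π, cont ∧ jStack π ∈ D ∧ t = tCont π) ∨ ∃ α, α ∈ A ∧ t = tSpecial α := by
  generalize hz : jTerm k t = z at h
  cases h <;> simp only [jTerm, jStack, opair_inj, num_inj, true_and, zero_ne_one, false_and]
    at hz <;> obtain ⟨rfl, rfl⟩ := hz
  · exact .inl ⟨_, ‹_›, rfl⟩
  · exact .inr (.inl ⟨_, _, ‹_›, ‹_›, rfl⟩)
  · exact .inr (.inr (.inl ⟨_, ‹_›, rfl⟩))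
  · exact .inr (.inr (.inr (.inl rfl)))
  · exact .inr (.inr (.inr (.inr (.inl ⟨_, ‹_›, ‹_›, rfl⟩))))
  · exact .inr (.inr (.inr (.inr (.inr ⟨_, ‹_›, rfl⟩))))

/-- In a derivation, the judgement about `t` may be restated for any larger bound on the indices. -/
theorem exists_weakening (D : V) (f : V → V → V) [DefPred fun e => e 0 = f (e 1) (e 2)] :
    ∃ D' : V, ∀ z, z ∈ D' ↔ ∃ l k t, k ∈ (omega : V) ∧ l ∈ succ k ∧ jTerm l t ∈ D ∧ z = f k t := by
  have h : ∀ g h : (ℕ → V) → V, [DefFun g] → [DefFun h] → DefFun fun e => f (g e) (h e) :=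
    fun g h _ _ => DefFun.comp₂ inferInstance g h
  obtain ⟨D', hD'⟩ := exists_image₂ (fun y k z => ∃ l t, y = opair (num 0) (opair l t) ∧
    l ∈ succ k ∧ z = f k t) D (omega : V) (by
      rintro x y z w - - ⟨l, t, rfl, -, rfl⟩ ⟨l', t', h, -, rfl⟩
      simp only [opair_inj] at h
      rw [h.2.2])
  refine ⟨D', fun z => (hD' z).trans ⟨?_, ?_⟩⟩
  · rintro ⟨y, k, hy, hk, l, t, rfl, hl, rfl⟩
    exact ⟨l, k, t, hk, hl, hy, rfl⟩
  · rintro ⟨l, k, t, hk, hl, hy, rfl⟩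
    exact ⟨_, k, hy, hk, l, t, rfl, hl, rfl⟩

theorem mem_of_mem_of_mem_succ {n l k : V} (hk : k ∈ (omega : V)) (hl : l ∈ succ k) (hn : n ∈ l) :
    n ∈ k := by
  rcases mem_succ.1 hl with hl | rfl
  · exact nat_transitive hk hl hn
  · exact hn

/-- Weakening: a closed term is a term in every context. -/
theorem IsOpenTerm.weaken {t k : V} (hk : k ∈ (omega : V)) (h : IsOpenTerm A B cont emp t) :
    IsOpenTerm A B cont k t := by
  obtain ⟨D, ht, hD⟩ := h
  have : DefPred fun e : ℕ → V => e 0 = jTerm (e 1) (e 2) := by unfold jTerm; infer_instance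
  obtain ⟨D₁, hD₁⟩ := exists_weakening D jTerm
  obtain ⟨D', hD'⟩ := exists_union D D₁
  refine ⟨D', (hD' _).2 (.inr ((hD₁ _).2 ⟨emp, k, t, hk, emp_mem_succ hk, ht, rfl⟩)),
    fun y hy => ?_⟩
  rcases (hD' y).1 hy with hy | hy
  · exact (hD y hy).mono (fun _ => id) id fun x hx => (hD' x).2 (.inl hx)
  · obtain ⟨l, k, t, hk, hl, ht, rfl⟩ := (hD₁ y).1 hy
    have hk' := mem_omega.1 hk
    have up : ∀ {t}, jTerm l t ∈ D → jTerm k t ∈ D' := fun {t} ht =>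
      (hD' _).2 (.inr ((hD₁ _).2 ⟨l, k, t, hk, hl, ht, rfl⟩))
    rcases (hD _ ht).cases_term with ⟨n, hn, rfl⟩ | ⟨t, s, h₁, h₂, rfl⟩ | ⟨t, h₁, rfl⟩ | rfl |
      ⟨π, hc, hπ, rfl⟩ | ⟨α, hα, rfl⟩
    · exact .var k n hk' (mem_of_mem_of_mem_succ hk hl hn)
    · exact .app k t s hk' (up h₁) (up h₂)
    · exact .lam k t hk' ((hD' _).2 (.inr ((hD₁ _).2 ⟨succ l, succ k, t, succ_mem_omega hk,
        succ_mem_succ (succ_mem_omega hk) hl, h₁, rfl⟩)))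
    · exact .cc k hk'
    · exact .cont k π hc hk' ((hD' _).2 (.inl hπ))
    · exact .special k α hk' hα

/-- Substitution leaves closed terms unchanged. -/
theorem IsOpenTerm.subst_self {t k s : V} (hk : k ∈ (omega : V)) (h : IsOpenTerm A B cont emp t) :
    Derivable (SubstStep s) (jSubst k t t) := by
  obtain ⟨D, ht, hD⟩ := h
  have : DefPred fun e : ℕ → V => e 0 = jSubst (e 1) (e 2) (e 2) := by
    unfold jSubst; infer_instance
  obtain ⟨D', hD'⟩ := exists_weakening D fun k t => jSubst k t t
  refine ⟨D', (hD' _).2 ⟨emp, k, t, hk, emp_mem_succ hk, ht, rfl⟩, fun y hy => ?_⟩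
  obtain ⟨l, k, t, hk, hl, ht, rfl⟩ := (hD' y).1 hy
  have up : ∀ {t}, jTerm l t ∈ D → jSubst k t t ∈ D' := fun {t} ht =>
    (hD' _).2 ⟨l, k, t, hk, hl, ht, rfl⟩
  rcases (hD _ ht).cases_term with ⟨n, hn, rfl⟩ | ⟨t, s, h₁, h₂, rfl⟩ | ⟨t, h₁, rfl⟩ | rfl |
    ⟨π, hc, hπ, rfl⟩ | ⟨α, hα, rfl⟩
  · exact .var_lt k n (mem_of_mem_of_mem_succ hk hl hn)
  · exact .app k t s t s (up h₁) (up h₂)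
  · exact .lam k t t ((hD' _).2 ⟨succ l, succ k, t, succ_mem_omega hk,
      succ_mem_succ (succ_mem_omega hk) hl, h₁, rfl⟩)
  · exact .cc k
  · exact .cont k π
  · exact .special k α

end Grammar

/-! ### Programs -/

/-- Terms of standard finite size, built from closed terms `c` of `V`. -/
inductive Tm (V : Type u) : Type u
  | var (n : ℕ)
  | app (t s : Tm V)
  | lam (t : Tm V)
  | cc
  | const (c : V)

namespace Tm

/-- The term of `V` that is denoted by a program. -/
noncomputable def toV : Tm V → V
  | var n => tVar (num n)
  | app t s => tApp t.toV s.toV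
  | lam t => tLam t.toV
  | cc => tCC
  | const c => c

/-- Substitution of the closed term `s` for the index `k`. -/
def subst (s : V) : ℕ → Tm V → Tm V
  | k, var n => if n = k then const s else var n
  | k, app t r => app (t.subst s k) (r.subst s k)
  | k, lam t => lam (t.subst s (k + 1))
  | _, cc => cc
  | _, const c => const c

/-- The free indices of the program are below `k`, and its constants are closed terms. -/
def Ok (A B : V) (cont : Prop) : ℕ → Tm V → Prop
  | k, var n => n < k
  | k, app t r => t.Ok A B cont k ∧ r.Ok A B cont k
  | k, lam t => t.Ok A B cont (k + 1)
  | _, cc => True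
  | _, const c => IsOpenTerm A B cont emp c

variable {A B : V} {cont : Prop}

theorem Ok.isOpenTerm {t : Tm V} : ∀ {k : ℕ}, t.Ok A B cont k →
    IsOpenTerm A B cont (num k) t.toV := by
  induction t with
  | var n => exact fun h => isOpenTerm_var (num_mem_omega _) (num_mem_num h)
  | app t r iht ihr => exact fun h => .app (num_mem_omega _) (iht h.1) (ihr h.2)
  | lam t ih => exact fun h => .lam (num_mem_omega _) (ih h)
  | cc => exact fun _ => isOpenTerm_cc (num_mem_omega _)
  | const c => exact fun h => h.weaken (num_mem_omega _)

theorem Ok.derivable_subst {s : V} {t : Tm V} : ∀ {k : ℕ}, t.Ok A B cont (k + 1) →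
    Derivable (SubstStep s) (jSubst (num k) t.toV (t.subst s k).toV) := by
  induction t with
  | var n =>
    intro k h
    unfold subst
    split
    · rename_i h
      exact .intro₀ fun _ => h ▸ .var_eq _
    · rename_i h'
      exact .intro₀ fun _ => .var_lt _ _ (num_mem_num (lt_of_le_of_ne (Nat.le_of_lt_succ h) h'))
  | app t r iht ihr =>
    exact fun h => .intro₂ (step := SubstStep s) (fun _ _ _ => SubstStep.mono) (iht h.1) (ihr h.2)
      fun _ h₁ h₂ => .app _ _ _ _ _ h₁ h₂
  | lam t ih =>
    exact fun h => .intro₁ (step := SubstStep s) (fun _ _ _ => SubstStep.mono) (ih h)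
      fun _ h => .lam _ _ _ h
  | cc => exact fun _ => .intro₀ fun _ => .cc _
  | const c => exact fun h => IsOpenTerm.subst_self (num_mem_omega _) h

end Tm

end Terms

/-! ### Definable recursion -/

section Recursion

variable {V : Type u} [Membership V V] [IsZFModel V]

omit [IsZFModel V] in
theorem Derivable.defPred {step : V → V → Prop} (h : DefPred fun e => step (e 0) (e 1))
    (f : (ℕ → V) → V) [hf : DefFun f] : DefPred fun e => Derivable step (f e) := by
  have : ∀ g k : (ℕ → V) → V, [DefFun g] → [DefFun k] → DefPred fun e => step (g e) (k e) :=
    fun g k _ _ => DefPred.comp₂ h g k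
  refine DefPred.comp₁ (R := Derivable step) ?_ f
  unfold Derivable
  infer_instance

/-- Definable recursion in `V`. The judgement `J k s` says that the value at the key `k` is `s`; it
is justified by the rule `Val` from the values at the keys `k'` with `dep k' k`. If the keys are
well founded for definable induction and `Val` determines a value, then every key has exactly one
derivable value, and the derivable values satisfy the recursion equation. -/
theorem Derivable.recursion {step : V → V → Prop} (hd : DefPred fun e => step (e 0) (e 1))
    {K : V} {J : V → V → V} [hJd : DefPred fun e => e 0 = J (e 1) (e 2)]
    (hJ : ∀ k s k' s', k ∈ K → k' ∈ K → J k s = J k' s' → k = k' ∧ s = s')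
    {dep : V → V → Prop} [hdep : DefPred fun e => dep (e 0) (e 1)]
    (hK : ∀ k k', k ∈ K → dep k' k → k' ∈ K)
    (wf : ∀ P : V → Prop, DefPred (fun e => P (e 0)) →
      (∀ k, k ∈ K → (∀ k', dep k' k → P k') → P k) → ∀ k, k ∈ K → P k)
    {Val : V → (V → V → Prop) → V → Prop}
    (hVal : ∀ k, k ∈ K → ∀ G G' : V → V → Prop, (∀ k' s, dep k' k → (G k' s ↔ G' k' s)) →
      ∀ s, Val k G s → Val k G' s)
    (hstep : ∀ k, k ∈ K → ∀ D s, step D (J k s) ↔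
      (∀ k', dep k' k → ∃ s', J k' s' ∈ D) ∧ Val k (fun k' s' => J k' s' ∈ D) s)
    (unique : ∀ k, k ∈ K → ∀ G s s', Val k G s → Val k G s' → s = s')
    (exist : ∀ k, k ∈ K → ∀ G : V → V → Prop, DefPred (fun e => G (e 0) (e 1)) →
      (∀ k', dep k' k → ∃! s, G k' s) → ∃ s, Val k G s) :
    ∀ k, k ∈ K → (∃! s, Derivable step (J k s)) ∧
      ∀ s, Derivable step (J k s) ↔ Val k (fun k' s' => Derivable step (J k' s')) s := by
  have hJf : ∀ f g : (ℕ → V) → V, [DefFun f] → [DefFun g] → DefFun fun e => J (f e) (g e) :=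
    fun f g _ _ => DefFun.comp₂ hJd f g
  have hdepf : ∀ f g : (ℕ → V) → V, [DefFun f] → [DefFun g] → DefPred fun e => dep (f e) (g e) :=
    fun f g _ _ => DefPred.comp₂ hdep f g
  have hDer : ∀ f : (ℕ → V) → V, [DefFun f] → DefPred fun e => Derivable step (f e) :=
    fun f _ => Derivable.defPred hd f
  -- a derivable value satisfies the recursion equation once the earlier values are unique
  have eqn : ∀ k, k ∈ K → (∀ k', dep k' k → ∀ s s', Derivable step (J k' s) →
      Derivable step (J k' s') → s = s') → ∀ s, Derivable step (J k s) →
      Val k (fun k' s' => Derivable step (J k' s')) s := by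
    rintro k hk huniq s ⟨D, hs, hD⟩
    obtain ⟨h₁, h₂⟩ := (hstep k hk D s).1 (hD _ hs)
    refine hVal k hk _ _ (fun k' s' hk' => ⟨fun h => ⟨D, h, hD⟩, fun h => ?_⟩) s h₂
    obtain ⟨s'', hs''⟩ := h₁ k' hk'
    rwa [huniq k' hk' s' s'' h ⟨D, hs'', hD⟩]
  have uniq : ∀ k, k ∈ K → ∀ s s', Derivable step (J k s) → Derivable step (J k s') → s = s' :=
    wf (fun k => ∀ s s', Derivable step (J k s) → Derivable step (J k s') → s = s')
      inferInstance fun k hk ih s s' hs hs' =>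
        unique k hk _ s s' (eqn k hk ih s hs) (eqn k hk ih s' hs')
  obtain ⟨D₀, hD₀⟩ := exists_image (fun k z => ∃ s, Derivable step (J k s) ∧ z = J k s) K (by
    rintro k y z hk ⟨s, hs, rfl⟩ ⟨s', hs', rfl⟩
    rw [uniq k hk s s' hs hs'])
  have ex : ∀ k, k ∈ K → ∃ s, Derivable step (J k s) := by
    refine wf (fun k => ∃ s, Derivable step (J k s)) inferInstance fun k hk ih => ?_
    by_contra hne
    obtain ⟨s, hs⟩ := exist k hk (fun k' s' => Derivable step (J k' s')) inferInstance
      fun k' hk' => (ih k' hk').elim fun s' hs' =>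
        ⟨s', hs', fun s'' hs'' => uniq k' (hK k k' hk hk') _ _ hs'' hs'⟩
    obtain ⟨D, hD⟩ := exists_insert D₀ (J k s)
    have sub : ∀ k', k' ∈ K → ∀ s', Derivable step (J k' s') → J k' s' ∈ D :=
      fun k' hk' s' h => (hD _).2 (.inl ((hD₀ _).2 ⟨k', hk', s', h, rfl⟩))
    have der : ∀ k', k' ∈ K → ∀ s', J k' s' ∈ D → (∃ s'', Derivable step (J k' s'')) →
        Derivable step (J k' s') := by
      intro k' hk' s' h hex
      rcases (hD _).1 h with h | h
      · obtain ⟨k'', hk'', s'', hs'', h⟩ := (hD₀ _).1 h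
        obtain ⟨rfl, rfl⟩ := hJ _ _ _ _ hk' hk'' h
        exact hs''
      · obtain ⟨rfl, rfl⟩ := hJ _ _ _ _ hk' hk h
        exact absurd hex hne
    refine hne ⟨s, D, (hD _).2 (.inr rfl), fun z hz => ?_⟩
    rcases (hD z).1 hz with hz | rfl
    · obtain ⟨k', hk', s', ⟨D', hs', hD'⟩, rfl⟩ := (hD₀ z).1 hz
      obtain ⟨h₁, h₂⟩ := (hstep k' hk' D' s').1 (hD' _ hs')
      refine (hstep k' hk' D s').2 ⟨fun k'' hk'' => ?_, hVal k' hk' _ _ ?_ s' h₂⟩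
      · obtain ⟨s'', hs''⟩ := h₁ k'' hk''
        exact ⟨s'', sub k'' (hK _ _ hk' hk'') s'' ⟨D', hs'', hD'⟩⟩
      · intro k'' s'' hk''
        have hkk := hK _ _ hk' hk''
        obtain ⟨r, hr⟩ := h₁ k'' hk''
        refine ⟨fun h => sub k'' hkk s'' ⟨D', h, hD'⟩, fun h => ?_⟩
        rwa [uniq k'' hkk s'' r (der k'' hkk s'' h ⟨r, D', hr, hD'⟩) ⟨D', hr, hD'⟩]
    · refine (hstep k hk D s).2 ⟨fun k' hk' => ?_, hVal k hk _ _ ?_ s hs⟩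
      · obtain ⟨s', hs'⟩ := ih k' hk'
        exact ⟨s', sub k' (hK _ _ hk hk') s' hs'⟩
      · intro k' s' hk'
        exact ⟨sub k' (hK _ _ hk hk') s', fun h => der k' (hK _ _ hk hk') s' h (ih k' hk')⟩
  intro k hk
  obtain ⟨s, hs⟩ := ex k hk
  have eqn' := eqn k hk fun k' hk' => uniq k' (hK k k' hk hk')
  refine ⟨⟨s, hs, fun s' hs' => uniq k hk s' s hs' hs⟩, fun s' => ⟨eqn' s', fun h => ?_⟩⟩
  rwa [unique k hk _ s' s h (eqn' s hs)]

end Recursion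

namespace RealizabilityAlgebra

variable {V : Type u} [Membership V V] [IsZFModel V] (𝒜 : RealizabilityAlgebra V)

/-! ### Stacks and names -/

theorem isTerm_cc : IsTerm 𝒜.A 𝒜.B tCC := isOpenTerm_cc emp_mem_omega

theorem exists_isStack : ∃ π, IsStack 𝒜.A 𝒜.B π :=
  𝒜.B_nonempty.elim fun _ hβ => ⟨_, isStack_bot hβ⟩

theorem mem_prec {t π s σ : V} (h : opair (opair t π) (opair s σ) ∈ 𝒜.prec) :
    IsTerm 𝒜.A 𝒜.B t ∧ IsStack 𝒜.A 𝒜.B π := by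
  obtain ⟨t', π', s', σ', ht, hπ, -, -, h⟩ := 𝒜.prec_sub _ h
  simp only [opair_inj] at h
  obtain ⟨⟨rfl, rfl⟩, -⟩ := h
  exact ⟨ht, hπ⟩

theorem isStack_iff {π : V} :
    IsStack 𝒜.A 𝒜.B π ↔ opair (opair tCC π) (opair tCC π) ∈ 𝒜.prec :=
  ⟨fun h => 𝒜.prec_refl _ _ 𝒜.isTerm_cc h, fun h => (𝒜.mem_prec h).2⟩

theorem isTerm_iff {t : V} : IsTerm 𝒜.A 𝒜.B t ↔ ∃ π, opair (opair t π) (opair t π) ∈ 𝒜.prec :=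
  ⟨fun h => 𝒜.exists_isStack.imp fun _ hπ => 𝒜.prec_refl _ _ h hπ,
    fun ⟨_, h⟩ => (𝒜.mem_prec h).1⟩

/- Definability of the grammar need not be spelled out, since `≺` determines the stacks and the
terms. -/

instance (f : (ℕ → V) → V) [DefFun f] : DefPred fun e => IsStack 𝒜.A 𝒜.B (f e) :=
  DefPred.comp₁ (R := fun π => IsStack 𝒜.A 𝒜.B π)
    (by simp only [isStack_iff]; infer_instance) f

instance (f : (ℕ → V) → V) [DefFun f] : DefPred fun e => IsTerm 𝒜.A 𝒜.B (f e) :=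
  DefPred.comp₁ (R := fun t => IsTerm 𝒜.A 𝒜.B t) (by simp only [isTerm_iff]; infer_instance) f

/-- The stacks form a set of `V`. -/
theorem exists_stacks : ∃ P : V, ∀ π, π ∈ P ↔ IsStack 𝒜.A 𝒜.B π := by
  obtain ⟨P, hP⟩ := exists_sep (fun π => IsStack 𝒜.A 𝒜.B π)
    (sUnion (sUnion (sUnion (sUnion 𝒜.prec))))
  refine ⟨P, fun π => (hP π).trans (and_iff_right_of_imp fun h => ?_)⟩
  have h := 𝒜.isStack_iff.1 h
  have key : ∀ {a b x : V}, opair a b ∈ x → a ∈ sUnion (sUnion x) ∧ b ∈ sUnion (sUnion x) := by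
    intro a b x h
    simp only [mem_sUnion]
    exact ⟨⟨upair a b, ⟨_, h, by simp [opair]⟩, by simp⟩,
      ⟨upair a b, ⟨_, h, by simp [opair]⟩, by simp⟩⟩
  exact (key (key h).1).2

/-- `N` is a set of names that contains the components of its elements. -/
def IsNameSet (N : V) : Prop := ∀ a, a ∈ N → 𝒜.NameStep N a

variable {𝒜}

theorem IsNameSet.mem {N a c π : V} (h : 𝒜.IsNameSet N) (ha : a ∈ N) (hc : opair c π ∈ a) :
    c ∈ N ∧ IsStack 𝒜.A 𝒜.B π := by
  obtain ⟨b, σ, hb, hσ, h⟩ := h a ha _ hc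
  obtain ⟨rfl, rfl⟩ := opair_inj.1 h
  exact ⟨hb, hσ⟩

theorem IsNameSet.union {N N' : V} (h : 𝒜.IsNameSet N) (h' : 𝒜.IsNameSet N') :
    ∃ M, 𝒜.IsNameSet M ∧ (∀ a, a ∈ N → a ∈ M) ∧ ∀ a, a ∈ N' → a ∈ M := by
  obtain ⟨M, hM⟩ := exists_union N N'
  refine ⟨M, fun a ha z hz => ?_, fun a ha => (hM a).2 (.inl ha), fun a ha => (hM a).2 (.inr ha)⟩
  rcases (hM a).1 ha with ha | ha
  · obtain ⟨b, π, hb, h⟩ := h a ha z hz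
    exact ⟨b, π, (hM b).2 (.inl hb), h⟩
  · obtain ⟨b, π, hb, h⟩ := h' a ha z hz
    exact ⟨b, π, (hM b).2 (.inr hb), h⟩

/-- Induction along the components of names. A set of names without a minimal element would, with
the pairs and singletons through which `b` lies below `{(b, π), …}` added, contradict foundation. -/
theorem IsNameSet.induction {N : V} (hN : 𝒜.IsNameSet N) (P : V → Prop)
    [h : DefPred fun e => P (e 0)]
    (step : ∀ a, a ∈ N → (∀ c π, opair c π ∈ a → P c) → P a) : ∀ a, a ∈ N → P a := by
  have hP : ∀ f : (ℕ → V) → V, [DefFun f] → DefPred fun e => P (f e) :=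
    fun f _ => DefPred.comp₁ h f
  by_contra! hc
  obtain ⟨a₀, ha₀, hPa₀⟩ := hc
  obtain ⟨X, hX⟩ := exists_sep (fun a => ¬ P a) N
  obtain ⟨Y₁, hY₁⟩ := exists_sep (fun z => ∃ c π, c ∈ X ∧ z = opair c π) (sUnion X)
  obtain ⟨Y₂, hY₂⟩ := exists_sep (fun z => ∃ c, c ∈ X ∧ z = upair c c) (sUnion (sUnion X))
  obtain ⟨Y₃, hY₃⟩ := exists_union X Y₁
  obtain ⟨Y, hY⟩ := exists_union Y₃ Y₂
  have hYX : ∀ z, z ∈ X → z ∈ Y := fun z hz => (hY z).2 (.inl ((hY₃ z).2 (.inl hz)))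
  have low : ∀ a, a ∈ X → ∃ c π, opair c π ∈ a ∧ c ∈ X := by
    intro a ha
    obtain ⟨haN, haP⟩ := (hX a).1 ha
    by_contra! hcon
    refine haP (step a haN fun c π hc => ?_)
    by_contra hcP
    exact hcon c π hc ((hX c).2 ⟨(hN.mem haN hc).1, hcP⟩)
  obtain ⟨m, hm, hmin⟩ := IsZFModel.foundation Y ⟨a₀, hYX _ ((hX a₀).2 ⟨ha₀, hPa₀⟩)⟩
  rcases (hY m).1 hm with hm | hm
  · rcases (hY₃ m).1 hm with hm | hm
    · obtain ⟨c, π, hc, hcX⟩ := low m hm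
      refine hmin _ ((hY _).2 (.inl ((hY₃ _).2 (.inr ((hY₁ _).2 ⟨?_, c, π, hcX, rfl⟩))))) hc
      exact mem_sUnion.2 ⟨m, hm, hc⟩
    · obtain ⟨hm, c, π, hc, rfl⟩ := (hY₁ m).1 hm
      refine hmin (upair c c) ((hY _).2 (.inr ((hY₂ _).2 ⟨?_, c, hc, rfl⟩))) (by simp [opair])
      exact mem_sUnion.2 ⟨_, hm, by simp [opair]⟩
  · obtain ⟨-, c, hc, rfl⟩ := (hY₂ m).1 hm
    exact hmin c (hYX c hc) (by simp)

variable (𝒜)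

instance (f : (ℕ → V) → V) [DefFun f] : DefPred fun e => Derivable 𝒜.NameStep (f e) :=
  Derivable.defPred (by unfold NameStep; infer_instance) f

end RealizabilityAlgebra

/-! ### Projections of pairs -/

section Projections

variable {V : Type u} [Membership V V] [IsZFModel V]

open Classical in
/-- The first component of a pair, and `p` itself if `p` is not a pair. -/
noncomputable def fst (p : V) : V := if h : ∃ a b, p = opair a b then h.choose else p

open Classical in
/-- The second component of a pair, and `p` itself if `p` is not a pair. -/
noncomputable def snd (p : V) : V := if h : ∃ b a, p = opair a b then h.choose else p

@[simp] theorem fst_opair (a b : V) : fst (opair a b) = a := by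
  have h : ∃ a' b', opair a b = opair a' b' := ⟨a, b, rfl⟩
  obtain ⟨b', hb⟩ := h.choose_spec
  rw [fst, dif_pos h]
  exact (opair_inj.1 hb).1.symm

@[simp] theorem snd_opair (a b : V) : snd (opair a b) = b := by
  have h : ∃ b' a', opair a b = opair a' b' := ⟨b, a, rfl⟩
  obtain ⟨a', ha⟩ := h.choose_spec
  rw [snd, dif_pos h]
  exact (opair_inj.1 ha).2.symm

instance (f : (ℕ → V) → V) [DefFun f] : DefFun fun e => fst (f e) :=
  DefFun.comp₁ (h := fst) (DefPred.congr (P := fun e : ℕ → V => (∃ b, e 1 = opair (e 0) b) ∨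
    (¬ ∃ a b, e 1 = opair a b) ∧ e 0 = e 1) inferInstance fun e => by
      by_cases h : ∃ a b, e 1 = opair a b
      · obtain ⟨a, b, h⟩ := h
        simp [h, eq_comm]
      · simp only [fst, h, not_false_eq_true, true_and]
        exact ⟨.inr, fun h' => h'.elim (fun ⟨b, hb⟩ => (h ⟨_, b, hb⟩).elim) id⟩) f

instance (f : (ℕ → V) → V) [DefFun f] : DefFun fun e => snd (f e) :=
  DefFun.comp₁ (h := snd) (DefPred.congr (P := fun e : ℕ → V => (∃ a, e 1 = opair a (e 0)) ∨
    (¬ ∃ b a, e 1 = opair a b) ∧ e 0 = e 1) inferInstance fun e => by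
      by_cases h : ∃ b a, e 1 = opair a b
      · obtain ⟨b, a, h⟩ := h
        simp [h, eq_comm]
      · simp only [snd, h, not_false_eq_true, true_and]
        exact ⟨.inr, fun h' => h'.elim (fun ⟨b, hb⟩ => (h ⟨_, b, hb⟩).elim) id⟩) f

end Projections

namespace RealizabilityAlgebra

variable {V : Type u} [Membership V V] [IsZFModel V] (𝒜 : RealizabilityAlgebra V)

/-! ### Falsity values of atomic formulas -/

theorem orth_def {S t : V} : t ∈ 𝒜.orth {σ | σ ∈ S} ↔
    IsTerm 𝒜.A 𝒜.B t ∧ ∀ π, π ∈ S → opair t π ∈ 𝒜.pole := Iff.rfl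

instance (f g : (ℕ → V) → V) [DefFun f] [DefFun g] :
    DefPred fun e => f e ∈ 𝒜.orth {σ | σ ∈ g e} :=
  DefPred.comp₂ (R := fun t S => t ∈ 𝒜.orth {σ | σ ∈ S})
    (by simp only [orth_def]; infer_instance) f g

theorem falsStep_iff {D y : V} : 𝒜.FalsStep D y ↔
    (∃ a b S, y = jSub a b S ∧ (∀ c π : V, opair c π ∈ a → ∃ S' : V, jNotin c b S' ∈ D) ∧
      ∀ ρ : V, ρ ∈ S ↔ ∃ c π t S' : V, opair c π ∈ a ∧ jNotin c b S' ∈ D ∧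
        t ∈ 𝒜.orth {σ | σ ∈ S'} ∧ ρ = sPush t π) ∨
    (∃ a b S, y = jNotin a b S ∧
      (∀ c π : V, opair c π ∈ b → (∃ S' : V, jSub a c S' ∈ D) ∧ ∃ S' : V, jSub c a S' ∈ D) ∧
      ∀ ρ : V, ρ ∈ S ↔ ∃ c π t t' S' S'' : V, opair c π ∈ b ∧ jSub a c S' ∈ D ∧
        jSub c a S'' ∈ D ∧ t ∈ 𝒜.orth {σ | σ ∈ S'} ∧ t' ∈ 𝒜.orth {σ | σ ∈ S''} ∧
        ρ = sPush t (sPush t' π)) := by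
  constructor
  · rintro (⟨a, b, S, h₁, h₂⟩ | ⟨a, b, S, h₁, h₂⟩)
    · exact .inl ⟨a, b, S, rfl, h₁, h₂⟩
    · exact .inr ⟨a, b, S, rfl, h₁, h₂⟩
  · rintro (⟨a, b, S, rfl, h₁, h₂⟩ | ⟨a, b, S, rfl, h₁, h₂⟩)
    · exact .sub a b S h₁ h₂
    · exact .notin a b S h₁ h₂

instance (f g h : (ℕ → V) → V) [DefFun f] [DefFun g] [DefFun h] :
    DefFun fun e => jSub (f e) (g e) (h e) := by unfold jSub; infer_instance

instance (f g h : (ℕ → V) → V) [DefFun f] [DefFun g] [DefFun h] :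
    DefFun fun e => jNotin (f e) (g e) (h e) := by unfold jNotin; infer_instance

instance (f g : (ℕ → V) → V) [DefFun f] [DefFun g] : DefFun fun e => sPush (f e) (g e) := by
  unfold sPush; infer_instance

theorem falsStep_def : DefPred fun e : ℕ → V => 𝒜.FalsStep (e 0) (e 1) := by
  simp only [falsStep_iff]
  refine @DefPred.or _ _ _ _ ?_ ?_ <;> infer_instance

instance (f : (ℕ → V) → V) [DefFun f] : DefPred fun e => Derivable 𝒜.FalsStep (f e) :=
  Derivable.defPred 𝒜.falsStep_def f

instance (f g h : (ℕ → V) → V) [DefFun f] [DefFun g] [DefFun h] :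
    DefPred fun e => f e ∈ 𝒜.falsSub (g e) (h e) :=
  DefPred.comp₃ (R := fun ρ a b => ρ ∈ 𝒜.falsSub a b)
    (inferInstanceAs (DefPred fun e : ℕ → V =>
      ∃ S, Derivable 𝒜.FalsStep (jSub (e 1) (e 2) S) ∧ e 0 ∈ S)) f g h

instance (f g h : (ℕ → V) → V) [DefFun f] [DefFun g] [DefFun h] :
    DefPred fun e => f e ∈ 𝒜.falsNotin (g e) (h e) :=
  DefPred.comp₃ (R := fun ρ a b => ρ ∈ 𝒜.falsNotin a b)
    (inferInstanceAs (DefPred fun e : ℕ → V =>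
      ∃ S, Derivable 𝒜.FalsStep (jNotin (e 1) (e 2) S) ∧ e 0 ∈ S)) f g h

/-- The order in which the falsity values are computed: the one of `a ⊆ b`, whose key is
`(0, (a, b))`, from those of `c ∉ b`, and the one of `a ∉ b`, whose key is `(1, (a, b))`, from those
of `a ⊆ c` and `c ⊆ a`. -/
def FalsDep (k' k : V) : Prop :=
  (∃ a b c π, k = opair (num 0) (opair a b) ∧ opair c π ∈ a ∧ k' = opair (num 1) (opair c b)) ∨
  ∃ a b c π, k = opair (num 1) (opair a b) ∧ opair c π ∈ b ∧
    (k' = opair (num 0) (opair a c) ∨ k' = opair (num 0) (opair c a))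

/-- The recursion equations for the falsity values of `a ⊆ b` and `a ∉ b`, where `G k S` says that
`S` is the value at the key `k`. -/
def FalsVal (k : V) (G : V → V → Prop) (S : V) : Prop :=
  (∃ a b, k = opair (num 0) (opair a b) ∧ ∀ ρ : V, ρ ∈ S ↔ ∃ c π t S' : V, opair c π ∈ a ∧
    G (opair (num 1) (opair c b)) S' ∧ t ∈ 𝒜.orth {σ | σ ∈ S'} ∧ ρ = sPush t π) ∨
  ∃ a b, k = opair (num 1) (opair a b) ∧ ∀ ρ : V, ρ ∈ S ↔ ∃ c π t t' S' S'' : V, opair c π ∈ b ∧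
    G (opair (num 0) (opair a c)) S' ∧ G (opair (num 0) (opair c a)) S'' ∧
    t ∈ 𝒜.orth {σ | σ ∈ S'} ∧ t' ∈ 𝒜.orth {σ | σ ∈ S''} ∧ ρ = sPush t (sPush t' π)

/-- The falsity values of `a ⊆ b` and `a ∉ b` exist as sets of `V`, are unique, and satisfy the
recursion equations. -/
theorem fals_recursion {N : V} (hN : 𝒜.IsNameSet N) {a b i : V} (ha : a ∈ N) (hb : b ∈ N)
    (hi : i = num 0 ∨ i = num 1) :
    (∃! S, Derivable 𝒜.FalsStep (opair i (opair (opair a b) S))) ∧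
      ∀ S, Derivable 𝒜.FalsStep (opair i (opair (opair a b) S)) ↔
        𝒜.FalsVal (opair i (opair a b))
          (fun k S => Derivable 𝒜.FalsStep (opair (fst k) (opair (snd k) S))) S := by
  obtain ⟨NN, hNN⟩ := exists_image₂ (fun a b z : V => z = opair a b) N N
    (by rintro _ _ _ _ - - rfl rfl; rfl)
  obtain ⟨K, hK⟩ := exists_image₂ (fun i p z : V => z = opair i p) (upair (num 0) (num 1)) NN
    (by rintro _ _ _ _ - - rfl rfl; rfl)
  have hK' : ∀ k, k ∈ K ↔ ∃ i a b, (i = num 0 ∨ i = num 1) ∧ a ∈ N ∧ b ∈ N ∧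
      k = opair i (opair a b) := by
    intro k
    simp only [hK, hNN, mem_upair]
    constructor
    · rintro ⟨i, p, hi, ⟨a, b, ha, hb, rfl⟩, rfl⟩
      exact ⟨i, a, b, hi, ha, hb, rfl⟩
    · rintro ⟨i, a, b, hi, ha, hb, rfl⟩
      exact ⟨i, _, hi, ⟨a, b, ha, hb, rfl⟩, rfl⟩
  have hdep : DefPred fun e : ℕ → V => FalsDep (e 0) (e 1) := by
    unfold FalsDep; infer_instance
  obtain ⟨P, hP⟩ := 𝒜.exists_stacks
  have main := Derivable.recursion (step := 𝒜.FalsStep) 𝒜.falsStep_def (K := K)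
    (J := fun k S => opair (fst k) (opair (snd k) S)) ?hJ (dep := FalsDep) ?hKdep ?wf
    (Val := 𝒜.FalsVal) ?hVal ?hstep ?unique ?exist _ ((hK' _).2 ⟨i, a, b, hi, ha, hb, rfl⟩)
  · simpa using main
  case hJ =>
    intro k s k' s' hk hk' h
    obtain ⟨i, a, b, -, -, -, rfl⟩ := (hK' k).1 hk
    obtain ⟨i', a', b', -, -, -, rfl⟩ := (hK' k').1 hk'
    simp only [fst_opair, snd_opair, opair_inj] at h ⊢
    tauto
  case hKdep =>
    rintro k k' hk (⟨a, b, c, π, rfl, hc, rfl⟩ | ⟨a, b, c, π, rfl, hc, h⟩)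
    · obtain ⟨i, a', b', -, ha, hb, h⟩ := (hK' _).1 hk
      simp only [opair_inj] at h
      obtain ⟨rfl, rfl, rfl⟩ := h
      exact (hK' _).2 ⟨_, c, b, .inr rfl, (hN.mem ha hc).1, hb, rfl⟩
    · obtain ⟨i, a', b', -, ha, hb, h'⟩ := (hK' _).1 hk
      simp only [opair_inj] at h'
      obtain ⟨rfl, rfl, rfl⟩ := h'
      rcases h with rfl | rfl
      · exact (hK' _).2 ⟨_, a, c, .inl rfl, ha, (hN.mem hb hc).1, rfl⟩
      · exact (hK' _).2 ⟨_, c, a, .inl rfl, (hN.mem hb hc).1, ha, rfl⟩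
  case wf =>
    intro Q hQ step
    have hQ' : ∀ f : (ℕ → V) → V, [DefFun f] → DefPred fun e => Q (f e) :=
      fun f _ => DefPred.comp₁ hQ f
    have one : ∀ a b, a ∈ N → b ∈ N → (∀ c π, opair c π ∈ b →
        Q (opair (num 0) (opair a c)) ∧ Q (opair (num 0) (opair c a))) →
        Q (opair (num 1) (opair a b)) := by
      intro a b ha hb h
      refine step _ ((hK' _).2 ⟨_, a, b, .inr rfl, ha, hb, rfl⟩) fun k' hk' => ?_
      rcases hk' with ⟨a', b', c, π, h', hc, rfl⟩ | ⟨a', b', c, π, h', hc, hk'⟩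
      · simp at h'
      · simp only [opair_inj, true_and] at h'
        obtain ⟨rfl, rfl⟩ := h'
        rcases hk' with rfl | rfl
        · exact (h c π hc).1
        · exact (h c π hc).2
    have zero : ∀ a b, a ∈ N → b ∈ N → (∀ c π, opair c π ∈ a → Q (opair (num 1) (opair c b))) →
        Q (opair (num 0) (opair a b)) := by
      intro a b ha hb h
      refine step _ ((hK' _).2 ⟨_, a, b, .inl rfl, ha, hb, rfl⟩) fun k' hk' => ?_
      rcases hk' with ⟨a', b', c, π, h', hc, rfl⟩ | ⟨a', b', c, π, h', hc, hk'⟩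
      · simp only [opair_inj, true_and] at h'
        obtain ⟨rfl, rfl⟩ := h'
        exact h c π hc
      · simp at h'
    have both : ∀ a, a ∈ N → ∀ b, b ∈ N →
        Q (opair (num 0) (opair a b)) ∧ Q (opair (num 0) (opair b a)) := by
      refine hN.induction (fun a => ∀ b, b ∈ N →
        Q (opair (num 0) (opair a b)) ∧ Q (opair (num 0) (opair b a))) fun a ha ih b hb => ⟨?_, ?_⟩
      · refine zero a b ha hb fun c π hc => one c b (hN.mem ha hc).1 hb fun d σ hd => ?_
        exact ih c π hc d (hN.mem hb hd).1
      · refine zero b a hb ha fun d σ hd => one d a (hN.mem hb hd).1 ha fun c π hc => ?_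
        exact (ih c π hc d (hN.mem hb hd).1).symm
    intro k hk
    obtain ⟨i, a, b, rfl | rfl, ha, hb, rfl⟩ := (hK' k).1 hk
    · exact (both a ha b hb).1
    · exact one a b ha hb fun c π hc => both a ha c (hN.mem hb hc).1
  case hVal =>
    rintro k hk G G' hG S (⟨a, b, rfl, h⟩ | ⟨a, b, rfl, h⟩)
    · refine .inl ⟨a, b, rfl, fun ρ => (h ρ).trans ?_⟩
      refine exists_congr fun c => exists_congr fun π => exists_congr fun t =>
        exists_congr fun S' =>
        and_congr_right fun hc => ?_
      rw [hG _ S' (.inl ⟨a, b, c, π, rfl, hc, rfl⟩)]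
    · refine .inr ⟨a, b, rfl, fun ρ => (h ρ).trans ?_⟩
      refine exists_congr fun c => exists_congr fun π => exists_congr fun t =>
        exists_congr fun t' =>
        exists_congr fun S' => exists_congr fun S'' => and_congr_right fun hc => ?_
      rw [hG _ S' (.inr ⟨a, b, c, π, rfl, hc, .inl rfl⟩),
        hG _ S'' (.inr ⟨a, b, c, π, rfl, hc, .inr rfl⟩)]
  case hstep =>
    intro k hk D S
    obtain ⟨i, a, b, hi, ha, hb, rfl⟩ := (hK' k).1 hk
    rw [falsStep_iff]
    rcases hi with rfl | rfl
    · simp only [jSub, jNotin, FalsDep, FalsVal, fst_opair, snd_opair, opair_inj, num_inj, true_and,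
        zero_ne_one, false_and, exists_false, or_false]
      constructor
      · rintro ⟨a', b', S', ⟨⟨rfl, rfl⟩, rfl⟩, h₁, h₂⟩
        refine ⟨?_, a, b, ⟨rfl, rfl⟩, h₂⟩
        rintro k' ⟨a', b', c, π, ⟨rfl, rfl⟩, hc, rfl⟩
        simpa using h₁ c π hc
      · rintro ⟨h₁, a', b', ⟨rfl, rfl⟩, h₂⟩
        refine ⟨a, b, S, ⟨⟨rfl, rfl⟩, rfl⟩, fun c π hc => ?_, h₂⟩
        simpa using h₁ _ ⟨a, b, c, π, ⟨rfl, rfl⟩, hc, rfl⟩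
    · simp only [jSub, jNotin, FalsDep, FalsVal, fst_opair, snd_opair, opair_inj, num_inj, true_and,
        one_ne_zero, false_and, exists_false, false_or]
      constructor
      · rintro ⟨a', b', S', ⟨⟨rfl, rfl⟩, rfl⟩, h₁, h₂⟩
        refine ⟨?_, a, b, ⟨rfl, rfl⟩, h₂⟩
        rintro k' ⟨a', b', c, π, ⟨rfl, rfl⟩, hc, rfl | rfl⟩
        · simpa using (h₁ c π hc).1
        · simpa using (h₁ c π hc).2
      · rintro ⟨h₁, a', b', ⟨rfl, rfl⟩, h₂⟩
        refine ⟨a, b, S, ⟨⟨rfl, rfl⟩, rfl⟩, fun c π hc => ⟨?_, ?_⟩, h₂⟩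
        · simpa using h₁ _ ⟨a, b, c, π, ⟨rfl, rfl⟩, hc, .inl rfl⟩
        · simpa using h₁ _ ⟨a, b, c, π, ⟨rfl, rfl⟩, hc, .inr rfl⟩
  case unique =>
    rintro k - G S S' (⟨a, b, rfl, h⟩ | ⟨a, b, rfl, h⟩) (⟨a', b', e, h'⟩ | ⟨a', b', e, h'⟩) <;>
      simp only [opair_inj, num_inj, true_and, zero_ne_one, one_ne_zero, false_and] at e <;>
      obtain ⟨rfl, rfl⟩ := e <;> exact set_ext fun ρ => (h ρ).trans (h' ρ).symm
  case exist =>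
    intro k hk G hG _
    have hG' : ∀ f g : (ℕ → V) → V, [DefFun f] → [DefFun g] → DefPred fun e => G (f e) (g e) :=
      fun f g _ _ => DefPred.comp₂ hG f g
    obtain ⟨i, a, b, rfl | rfl, ha, hb, rfl⟩ := (hK' k).1 hk
    · obtain ⟨S, hS⟩ := exists_sep (V := V) (fun ρ : V => ∃ c π t S' : V, opair c π ∈ a ∧
        G (opair (num 1) (opair c b)) S' ∧ t ∈ 𝒜.orth {σ | σ ∈ S'} ∧ ρ = sPush t π) P
      refine ⟨S, .inl ⟨a, b, rfl, fun ρ => (hS ρ).trans (and_iff_right_of_imp ?_)⟩⟩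
      rintro ⟨c, π, t, S', hc, -, ht, rfl⟩
      exact (hP _).2 ((hN.mem ha hc).2.push ht.1)
    · obtain ⟨S, hS⟩ := exists_sep (V := V) (fun ρ : V => ∃ c π t t' S' S'' : V, opair c π ∈ b ∧
        G (opair (num 0) (opair a c)) S' ∧ G (opair (num 0) (opair c a)) S'' ∧
        t ∈ 𝒜.orth {σ | σ ∈ S'} ∧ t' ∈ 𝒜.orth {σ | σ ∈ S''} ∧ ρ = sPush t (sPush t' π)) P
      refine ⟨S, .inr ⟨a, b, rfl, fun ρ => (hS ρ).trans (and_iff_right_of_imp ?_)⟩⟩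
      rintro ⟨c, π, t, t', S', S'', hc, -, -, ht, ht', rfl⟩
      exact (hP _).2 (((hN.mem hb hc).2.push ht'.1).push ht.1)

variable {𝒜}

theorem Name.exists_nameSet (a b : 𝒜.Name) : ∃ N, 𝒜.IsNameSet N ∧ a.1 ∈ N ∧ b.1 ∈ N := by
  obtain ⟨N, ha, hN⟩ := a.2
  obtain ⟨N', hb, hN'⟩ := b.2
  obtain ⟨M, hM, h₁, h₂⟩ := IsNameSet.union hN hN'
  exact ⟨M, hM, h₁ _ ha, h₂ _ hb⟩

theorem falsSub_eq {a b : 𝒜.Name} {S : V} (h : Derivable 𝒜.FalsStep (jSub a.1 b.1 S)) :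
    𝒜.falsSub a.1 b.1 = {σ | σ ∈ S} := by
  obtain ⟨N, hN, ha, hb⟩ := Name.exists_nameSet a b
  obtain ⟨⟨S₀, -, hu⟩, -⟩ := 𝒜.fals_recursion hN ha hb (.inl rfl)
  ext σ
  exact ⟨fun ⟨S', h', hσ⟩ => by rwa [hu S' h', ← hu S h] at hσ, fun hσ => ⟨S, h, hσ⟩⟩

theorem falsNotin_eq {a b : 𝒜.Name} {S : V} (h : Derivable 𝒜.FalsStep (jNotin a.1 b.1 S)) :
    𝒜.falsNotin a.1 b.1 = {σ | σ ∈ S} := by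
  obtain ⟨N, hN, ha, hb⟩ := Name.exists_nameSet a b
  obtain ⟨⟨S₀, -, hu⟩, -⟩ := 𝒜.fals_recursion hN ha hb (.inr rfl)
  ext σ
  exact ⟨fun ⟨S', h', hσ⟩ => by rwa [hu S' h', ← hu S h] at hσ, fun hσ => ⟨S, h, hσ⟩⟩

/-- The components of a name are names. -/
theorem Name.component (a : 𝒜.Name) {c π : V} (h : opair c π ∈ a.1) :
    Derivable 𝒜.NameStep c ∧ IsStack 𝒜.A 𝒜.B π := by
  obtain ⟨N, ha, hN⟩ := a.2
  obtain ⟨hc, hπ⟩ := IsNameSet.mem hN ha h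
  exact ⟨⟨N, hc, hN⟩, hπ⟩

/-- The recursive description of the falsity value of `a ⊆ b`. -/
theorem mem_falsSub {a b : 𝒜.Name} {ρ : V} : ρ ∈ 𝒜.falsSub a.1 b.1 ↔ ∃ (c : 𝒜.Name) (π t : V),
    opair c.1 π ∈ a.1 ∧ t ∈ 𝒜.orth (𝒜.falsNotin c.1 b.1) ∧ ρ = sPush t π := by
  obtain ⟨N, hN, ha, hb⟩ := Name.exists_nameSet a b
  obtain ⟨⟨S, hS, -⟩, hval⟩ := 𝒜.fals_recursion hN ha hb (.inl rfl)
  rw [falsSub_eq hS]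
  rcases (hval S).1 hS with ⟨a', b', e, h⟩ | ⟨a', b', e, h⟩
  · simp only [opair_inj, true_and] at e
    obtain ⟨rfl, rfl⟩ := e
    refine (h ρ).trans ⟨?_, ?_⟩
    · rintro ⟨c, π, t, S', hc, hS', ht, rfl⟩
      rw [fst_opair, snd_opair] at hS'
      refine ⟨⟨c, (a.component hc).1⟩, π, t, hc, ?_, rfl⟩
      rwa [falsNotin_eq (a := ⟨c, (a.component hc).1⟩) hS']
    · rintro ⟨c, π, t, hc, ht, rfl⟩
      obtain ⟨⟨S', hS', -⟩, -⟩ := 𝒜.fals_recursion hN (hN.mem ha hc).1 hb (.inr rfl)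
      rw [falsNotin_eq hS'] at ht
      exact ⟨c.1, π, t, S', hc, by simpa using hS', ht, rfl⟩
  · simp at e

/-- The recursive description of the falsity value of `a ∉ b`. -/
theorem mem_falsNotin {a b : 𝒜.Name} {ρ : V} :
    ρ ∈ 𝒜.falsNotin a.1 b.1 ↔ ∃ (c : 𝒜.Name) (π t t' : V), opair c.1 π ∈ b.1 ∧
      t ∈ 𝒜.orth (𝒜.falsSub a.1 c.1) ∧ t' ∈ 𝒜.orth (𝒜.falsSub c.1 a.1) ∧
      ρ = sPush t (sPush t' π) := by
  obtain ⟨N, hN, ha, hb⟩ := Name.exists_nameSet a b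
  obtain ⟨⟨S, hS, -⟩, hval⟩ := 𝒜.fals_recursion hN ha hb (.inr rfl)
  rw [falsNotin_eq hS]
  rcases (hval S).1 hS with ⟨a', b', e, h⟩ | ⟨a', b', e, h⟩
  · simp at e
  · simp only [opair_inj, true_and] at e
    obtain ⟨rfl, rfl⟩ := e
    refine (h ρ).trans ⟨?_, ?_⟩
    · rintro ⟨c, π, t, t', S', S'', hc, hS', hS'', ht, ht', rfl⟩
      rw [fst_opair, snd_opair] at hS' hS''
      refine ⟨⟨c, (b.component hc).1⟩, π, t, t', hc, ?_, ?_, rfl⟩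
      · rwa [falsSub_eq (b := ⟨c, (b.component hc).1⟩) hS']
      · rwa [falsSub_eq (a := ⟨c, (b.component hc).1⟩) hS'']
    · rintro ⟨c, π, t, t', hc, ht, ht', rfl⟩
      have hcN := (hN.mem hb hc).1
      obtain ⟨⟨S', hS', -⟩, -⟩ := 𝒜.fals_recursion hN ha hcN (.inl rfl)
      obtain ⟨⟨S'', hS'', -⟩, -⟩ := 𝒜.fals_recursion hN hcN ha (.inl rfl)
      rw [falsSub_eq hS'] at ht
      rw [falsSub_eq hS''] at ht'
      exact ⟨c.1, π, t, t', S', S'', hc, by simpa using hS', by simpa using hS'', ht, ht', rfl⟩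

end RealizabilityAlgebra

namespace RealizabilityAlgebra

variable {V : Type u} [Membership V V] [IsZFModel V] (𝒜 : RealizabilityAlgebra V)

/-! ### Reish names -/

theorem reishStep_def : DefPred fun e : ℕ → V => 𝒜.ReishStep (e 0) (e 1) := by
  unfold ReishStep
  infer_instance

instance (f g : (ℕ → V) → V) [DefFun f] [DefFun g] : DefPred fun e => 𝒜.IsReish (f e) (g e) :=
  Derivable.defPred 𝒜.reishStep_def _

theorem mem_succ_omega_of_mem {x y : V} (hx : x ∈ succ (omega : V)) (hy : y ∈ x) :
    y ∈ (omega : V) := by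
  rcases mem_succ.1 hx with hx | rfl
  · exact omega_transitive hx hy
  · exact hy

/-- The values of the reish recursion at `ω` and its elements exist and are unique. -/
theorem reish_recursion {x : V} (hx : x ∈ succ (omega : V)) : (∃! a, 𝒜.IsReish x a) ∧
    ∀ a, 𝒜.IsReish x a ↔ ∀ z : V, z ∈ a ↔ ∃ y b π : V, y ∈ x ∧ 𝒜.IsReish y b ∧
      IsStack 𝒜.A 𝒜.B π ∧ z = opair b π := by
  have hK : ∀ x y : V, x ∈ succ (omega : V) → y ∈ x → y ∈ succ (omega : V) :=
    fun x y hx hy => mem_succ.2 (.inl (mem_succ_omega_of_mem hx hy))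
  obtain ⟨P, hP⟩ := 𝒜.exists_stacks
  refine Derivable.recursion (step := 𝒜.ReishStep) 𝒜.reishStep_def (K := succ omega) (J := opair)
    (dep := fun y x => y ∈ x) (Val := fun x G a => ∀ z : V, z ∈ a ↔ ∃ y b π : V, y ∈ x ∧ G y b ∧
      IsStack 𝒜.A 𝒜.B π ∧ z = opair b π) ?_ hK ?_ ?_ ?_ ?_ ?_ x hx
  · intro k s k' s' _ _ h
    exact opair_inj.1 h
  · intro Q hQ h
    exact mem_induction hK Q h
  · intro x hx G G' hG a ha z
    refine (ha z).trans (exists_congr fun y => exists_congr fun b => exists_congr fun π =>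
      and_congr_right fun hy => ?_)
    rw [hG y b hy]
  · intro x hx D a
    constructor
    · rintro ⟨x', a', h, h₁, h₂⟩
      obtain ⟨rfl, rfl⟩ := opair_inj.1 h
      exact ⟨h₁, h₂⟩
    · rintro ⟨h₁, h₂⟩
      exact ⟨x, a, rfl, h₁, h₂⟩
  · intro x hx G a a' h h'
    exact set_ext fun z => (h z).trans (h' z).symm
  · intro x hx G hG hex
    have hG' : ∀ f g : (ℕ → V) → V, [DefFun f] → [DefFun g] → DefPred fun e => G (f e) (g e) :=
      fun f g _ _ => DefPred.comp₂ hG f g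
    obtain ⟨a, ha⟩ := exists_image₂ (fun y π z : V => ∃ b, G y b ∧ z = opair b π) x P (by
      rintro y π z w hy - ⟨b, hb, rfl⟩ ⟨b', hb', rfl⟩
      rw [(hex y hy).unique hb hb'])
    refine ⟨a, fun z => (ha z).trans ⟨?_, ?_⟩⟩
    · rintro ⟨y, π, hy, hπ, b, hb, rfl⟩
      exact ⟨y, b, π, hy, hb, (hP π).1 hπ, rfl⟩
    · rintro ⟨y, b, π, hy, hb, hπ, rfl⟩
      exact ⟨y, π, hy, (hP π).2 hπ, b, hb, rfl⟩

theorem IsReish.isName {x a : V} (hx : x ∈ succ (omega : V)) (h : 𝒜.IsReish x a) :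
    Derivable 𝒜.NameStep a := by
  obtain ⟨N, hN⟩ := exists_image (fun x a : V => 𝒜.IsReish x a) (succ omega)
    fun x a b hx ha hb => (𝒜.reish_recursion hx).1.unique ha hb
  refine ⟨N, (hN a).2 ⟨x, hx, h⟩, fun b hb z hz => ?_⟩
  obtain ⟨y, hy, hyb⟩ := (hN b).1 hb
  obtain ⟨y', b', π, hy', hb', hπ, rfl⟩ := (((𝒜.reish_recursion hy).2 b).1 hyb z).1 hz
  exact ⟨b', π, (hN b').2 ⟨y', mem_succ.2 (.inl (mem_succ_omega_of_mem hy hy')), hb'⟩, hπ, rfl⟩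

/-- The reish name of an element of `ω ∪ {ω}`. -/
noncomputable def reish (x : V) (hx : x ∈ succ (omega : V)) : 𝒜.Name :=
  ⟨(𝒜.reish_recursion hx).1.choose, IsReish.isName 𝒜 hx (𝒜.reish_recursion hx).1.choose_spec.1⟩

/-- The reish name of a natural number. -/
noncomputable def reishNat (n : V) (hn : n ∈ (omega : V)) : 𝒜.Name :=
  𝒜.reish n (mem_succ.2 (.inl hn))

/-- The reish name of `ω`. -/
noncomputable def reishOmega : 𝒜.Name := 𝒜.reish omega (mem_succ.2 (.inr rfl))

theorem isReish_iff {x a : V} (hx : x ∈ succ (omega : V)) :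
    𝒜.IsReish x a ↔ a = (𝒜.reish x hx).1 := by
  have h := (𝒜.reish_recursion hx).1.choose_spec
  exact ⟨fun ha => h.2 a ha, fun ha => ha ▸ h.1⟩

theorem isReish_nat_iff {n a : V} (hn : n ∈ (omega : V)) :
    𝒜.IsReish n a ↔ a = (𝒜.reishNat n hn).1 := 𝒜.isReish_iff _

theorem opair_mem_reish {x : V} (hx : x ∈ succ (omega : V)) {c : 𝒜.Name} {π : V} :
    opair c.1 π ∈ (𝒜.reish x hx).1 ↔ IsStack 𝒜.A 𝒜.B π ∧ ∃ (y : V) (hy : y ∈ x),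
      c = 𝒜.reishNat y (mem_succ_omega_of_mem hx hy) := by
  rw [((𝒜.reish_recursion hx).2 _).1 ((𝒜.isReish_iff hx).2 rfl) (opair c.1 π)]
  constructor
  · rintro ⟨y, b, σ, hy, hb, hσ, h⟩
    obtain ⟨rfl, rfl⟩ := opair_inj.1 h
    exact ⟨hσ, y, hy, Subtype.ext ((𝒜.isReish_nat_iff _).1 hb)⟩
  · rintro ⟨hπ, y, hy, rfl⟩
    exact ⟨y, _, π, hy, (𝒜.isReish_nat_iff (mem_succ_omega_of_mem hx hy)).2 rfl, hπ, rfl⟩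

theorem opair_mem_reishNat {n : V} (hn : n ∈ (omega : V)) {c : 𝒜.Name} {π : V} :
    opair c.1 π ∈ (𝒜.reishNat n hn).1 ↔ IsStack 𝒜.A 𝒜.B π ∧ ∃ (y : V) (hy : y ∈ n),
      c = 𝒜.reishNat y (omega_transitive hn hy) := 𝒜.opair_mem_reish _

theorem mem_reishNats {a : 𝒜.Name} :
    a ∈ 𝒜.reishNats ↔ ∃ (n : V) (hn : n ∈ (omega : V)), a = 𝒜.reishNat n hn :=
  ⟨fun ⟨n, hn, h⟩ => ⟨n, hn, Subtype.ext ((𝒜.isReish_nat_iff hn).1 h)⟩,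
    fun ⟨n, hn, h⟩ => ⟨n, hn, (𝒜.isReish_nat_iff hn).2 (h ▸ rfl)⟩⟩

theorem opair_mem_reishOmega {c : 𝒜.Name} {π : V} :
    opair c.1 π ∈ 𝒜.reishOmega.1 ↔ IsStack 𝒜.A 𝒜.B π ∧ c ∈ 𝒜.reishNats := by
  rw [mem_reishNats]
  exact 𝒜.opair_mem_reish _

/-- The components of a value of the reish recursion are the values at the elements. -/
theorem IsReish.components {x a : V} (h : 𝒜.IsReish x a) :
    (∀ y, y ∈ x → ∃ b, 𝒜.IsReish y b ∧ ∀ π, IsStack 𝒜.A 𝒜.B π → opair b π ∈ a) ∧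
      ∀ b π, opair b π ∈ a → ∃ y, y ∈ x ∧ 𝒜.IsReish y b := by
  obtain ⟨D, hx, hD⟩ := h
  obtain ⟨x', a', e, h₁, h₂⟩ := hD _ hx
  obtain ⟨rfl, rfl⟩ := opair_inj.1 e
  refine ⟨fun y hy => ?_, fun b π hb => ?_⟩
  · obtain ⟨b, hb⟩ := h₁ y hy
    exact ⟨b, ⟨D, hb, hD⟩, fun π hπ => (h₂ _).2 ⟨y, b, π, hy, hb, hπ, rfl⟩⟩
  · obtain ⟨y, b', π', hy, hb', -, e⟩ := (h₂ _).1 hb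
    obtain ⟨rfl, rfl⟩ := opair_inj.1 e
    exact ⟨y, hy, D, hb', hD⟩

/-- A natural number is determined by its reish name, among all sets. -/
theorem IsReish.injective {n x a : V} (hn : n ∈ (omega : V)) :
    𝒜.IsReish n a → 𝒜.IsReish x a → x = n := by
  obtain ⟨π, hπ⟩ := 𝒜.exists_isStack
  refine mem_induction (K := omega) (fun _ _ => omega_transitive)
    (fun n => ∀ x a : V, 𝒜.IsReish n a → 𝒜.IsReish x a → x = n) (fun n hn ih x a h h' => ?_)
    n hn x a
  obtain ⟨h₁, h₂⟩ := IsReish.components 𝒜 h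
  obtain ⟨h₃, h₄⟩ := IsReish.components 𝒜 h'
  refine set_ext fun y => ⟨fun hy => ?_, fun hy => ?_⟩
  · obtain ⟨b, hb, hba⟩ := h₃ y hy
    obtain ⟨m, hm, hmb⟩ := h₂ b π (hba π hπ)
    rwa [ih m hm y b hmb hb]
  · obtain ⟨b, hb, hba⟩ := h₁ y hy
    obtain ⟨m, hm, hmb⟩ := h₄ b π (hba π hπ)
    rwa [← ih y hy m b hb hmb]

/-- The lifted successor function maps `ℸ n` to `ℸ (n + 1)`. -/
theorem applyLift_succGraph {n : V} (hn : n ∈ (omega : V)) (φ : 𝒜.Name → 𝒜.Fml) :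
    Fml.applyLift 𝒜.SuccGraph (𝒜.reishNat n hn) φ =
      φ (𝒜.reishNat (succ n) (succ_mem_omega hn)) := by
  have h : ∃ b, 𝒜.SuccGraph (𝒜.reishNat n hn) b :=
    ⟨𝒜.reishNat (succ n) (succ_mem_omega hn), n, isOrd_of_mem_omega hn,
      (𝒜.isReish_nat_iff hn).2 rfl, (𝒜.isReish_nat_iff (succ_mem_omega hn)).2 rfl⟩
  rw [Fml.applyLift, dif_pos h]
  obtain ⟨α, -, hα, hb⟩ := h.choose_spec
  obtain rfl := IsReish.injective 𝒜 hn ((𝒜.isReish_nat_iff hn).2 rfl) hα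
  congr 1
  exact Subtype.ext ((𝒜.isReish_nat_iff (succ_mem_omega hn)).1 hb)

end RealizabilityAlgebra

namespace RealizabilityAlgebra

variable {V : Type u} [Membership V V] [IsZFModel V] {𝒜 : RealizabilityAlgebra V}

/-! ### Typing rules for realizers -/

theorem isStack_of_mem_falsity {φ : 𝒜.Fml} : ∀ {π : V}, π ∈ falsity φ → IsStack 𝒜.A 𝒜.B π := by
  induction φ with
  | top => exact fun h => h.elim
  | bot => exact id
  | notEps a b => exact And.left
  | ne a b => exact And.left
  | notMem a b =>
    intro ρ h
    obtain ⟨c, π, t, t', hc, ht, ht', rfl⟩ := mem_falsNotin.1 h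
    exact ((b.component hc).2.push ht'.1).push ht.1
  | sub a b =>
    intro ρ h
    obtain ⟨c, π, t, hc, ht, rfl⟩ := mem_falsSub.1 h
    exact (a.component hc).2.push ht.1
  | imp φ ψ _ ih =>
    rintro _ ⟨t, π, ht, hπ, rfl⟩
    exact (ih hπ).push ht.1
  | all φ ih => exact fun ⟨a, ha⟩ => ih a ha
  | allIn X φ ih => exact fun ⟨a, _, ha⟩ => ih a ha

theorem pole_app {t s π : V} (ht : IsTerm 𝒜.A 𝒜.B t) (hs : IsTerm 𝒜.A 𝒜.B s)
    (hπ : IsStack 𝒜.A 𝒜.B π) (h : opair t (sPush s π) ∈ 𝒜.pole) : opair (tApp t s) π ∈ 𝒜.pole :=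
  𝒜.pole_up _ _ (𝒜.push t s π ht hs hπ) h

theorem isTerm_app {t s : V} (ht : IsTerm 𝒜.A 𝒜.B t) (hs : IsTerm 𝒜.A 𝒜.B s) :
    IsTerm 𝒜.A 𝒜.B (tApp t s) := IsOpenTerm.app emp_mem_omega ht hs

theorem pole_lam {t : Tm V} {s π : V} (ht : t.Ok 𝒜.A 𝒜.B True 1) (hs : IsTerm 𝒜.A 𝒜.B s)
    (hπ : IsStack 𝒜.A 𝒜.B π) (h : opair (t.subst s 0).toV π ∈ 𝒜.pole) :
    opair (Tm.lam t).toV (sPush s π) ∈ 𝒜.pole :=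
  𝒜.pole_up _ _ (𝒜.grab _ _ _ _ (Tm.Ok.isOpenTerm (t := .lam t) (k := 0) ht) hs hπ
    ht.derivable_subst) h

@[simp] theorem isOpenTerm_emp_iff {A B t : V} :
    IsOpenTerm A B True emp t ↔ IsTerm A B t := Iff.rfl

theorem verity_app {φ ψ : 𝒜.Fml} {t s : V} (ht : t ∈ verity (.imp φ ψ)) (hs : s ∈ verity φ) :
    tApp t s ∈ verity ψ :=
  ⟨isTerm_app ht.1 hs.1, fun _ hπ => pole_app ht.1 hs.1 (isStack_of_mem_falsity hπ)
    (ht.2 _ ⟨_, _, hs, hπ, rfl⟩)⟩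

theorem verity_lam {φ ψ : 𝒜.Fml} {t : Tm V} (ht : t.Ok 𝒜.A 𝒜.B True 1)
    (h : ∀ s, s ∈ verity φ → (t.subst s 0).toV ∈ verity ψ) :
    (Tm.lam t).toV ∈ verity (.imp φ ψ) := by
  refine ⟨Tm.Ok.isOpenTerm (t := .lam t) (k := 0) ht, ?_⟩
  rintro _ ⟨s, π, hs, hπ, rfl⟩
  exact pole_lam ht hs.1 (isStack_of_mem_falsity hπ) ((h s hs).2 π hπ)

theorem verity_bot_elim {φ : 𝒜.Fml} {t : V} (ht : t ∈ verity (.bot : 𝒜.Fml)) : t ∈ verity φ :=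
  ⟨ht.1, fun π hπ => ht.2 π (isStack_of_mem_falsity hπ)⟩

theorem verity_cont {φ ψ : 𝒜.Fml} {π : V} (hπ : π ∈ falsity φ) :
    tCont π ∈ verity (.imp φ ψ) := by
  have hs := isStack_of_mem_falsity hπ
  refine ⟨hs.isTerm_cont, ?_⟩
  rintro _ ⟨t, σ, ht, hσ, rfl⟩
  exact 𝒜.pole_up _ _ (𝒜.restore t σ π ht.1 (isStack_of_mem_falsity hσ) hs) (ht.2 π hπ)

theorem verity_cc {φ ψ : 𝒜.Fml} : tCC ∈ verity (.imp (.imp (.imp φ ψ) φ) φ) := by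
  refine ⟨𝒜.isTerm_cc, ?_⟩
  rintro _ ⟨t, π, ht, hπ, rfl⟩
  have hs := isStack_of_mem_falsity hπ
  exact 𝒜.pole_up _ _ (𝒜.save t π ht.1 hs) (ht.2 _ ⟨_, _, verity_cont hπ, hπ, rfl⟩)

/-! ### Uniform realizability -/

/-- `t` is a closed term built from variables, application, abstraction and `cc` only, so that it is
a realizer in every realizability algebra. -/
def IsCombinator (t : V) : Prop := ∀ A B : V, IsRealizer A B t

/-- All the formulas of the family `φ` are realized by one combinator. Families of formulas stand
for formulas with free variables. -/
def Valid {I : Type*} (φ : I → 𝒜.Fml) : Prop :=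
  ∃ t : V, IsCombinator t ∧ ∀ i, t ∈ verity (φ i)

theorem IsCombinator.isTerm {A B c : V} (h : IsCombinator c) : IsTerm A B c := (h A B).isTerm

theorem isOpenTerm_of_combinator {A B c : V} {cont : Prop} (h : IsCombinator c) :
    IsOpenTerm A B cont emp c := IsOpenTerm.mono (fun _ => id) False.elim (h A B)

theorem isCombinator_toV {p : Tm V} (hp : ∀ A B, p.Ok A B False 0) : IsCombinator p.toV :=
  fun A B => (hp A B).isOpenTerm

section

variable {I : Type*} {φ ψ χ γ : I → 𝒜.Fml}

theorem Valid.forcesPurely {φ : 𝒜.Fml} (h : Valid fun _ : Unit => φ) : ForcesPurely φ :=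
  let ⟨t, ht, h⟩ := h
  ⟨t, ht _ _, ht _ _, h ()⟩

theorem Valid.comp {J : Type*} (h : Valid φ) (f : J → I) : Valid fun j => φ (f j) :=
  h.imp fun _ ht => ⟨ht.1, fun j => ht.2 (f j)⟩

/-- The preorder of entailment between families of formulas. -/
def Entails (φ ψ : I → 𝒜.Fml) : Prop := Valid fun i => (φ i).imp (ψ i)

theorem Valid.mp (h : Entails φ ψ) (h' : Valid φ) : Valid ψ := by
  obtain ⟨t, ht, h⟩ := h
  obtain ⟨s, hs, h'⟩ := h'
  exact ⟨tApp t s, fun A B => IsOpenTerm.app emp_mem_omega (ht A B) (hs A B),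
    fun i => verity_app (h i) (h' i)⟩

theorem Entails.refl (φ : I → 𝒜.Fml) : Entails φ φ :=
  ⟨(Tm.lam (.var 0)).toV, isCombinator_toV (by simp [Tm.Ok]), fun i =>
    verity_lam (by simp [Tm.Ok]) fun s hs => hs⟩

theorem Entails.trans (h : Entails φ ψ) (h' : Entails ψ χ) : Entails φ χ := by
  obtain ⟨t, ht, h⟩ := h
  obtain ⟨s, hs, h'⟩ := h'
  refine ⟨(Tm.lam (.app (.const s) (.app (.const t) (.var 0)))).toV, isCombinator_toV ?_,
    fun i => verity_lam ?_ fun u hu => ?_⟩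
  · simp [Tm.Ok, isOpenTerm_of_combinator, hs, ht]
  · simp [Tm.Ok, isOpenTerm_of_combinator, hs, ht]
  · exact verity_app (h' i) (verity_app (h i) hu)

theorem Valid.entails (h : Valid ψ) : Entails φ ψ := by
  obtain ⟨t, ht, h⟩ := h
  refine ⟨(Tm.lam (.const t)).toV, isCombinator_toV ?_, fun i => verity_lam ?_ fun u hu => h i⟩
  · simp [Tm.Ok, isOpenTerm_of_combinator, ht]
  · simp [Tm.Ok, isOpenTerm_of_combinator, ht]

theorem Entails.mp (h : Entails γ fun i => (φ i).imp (ψ i)) (h' : Entails γ φ) : Entails γ ψ := by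
  obtain ⟨t, ht, h⟩ := h
  obtain ⟨s, hs, h'⟩ := h'
  refine ⟨(Tm.lam (.app (.app (.const t) (.var 0)) (.app (.const s) (.var 0)))).toV,
    isCombinator_toV ?_, fun i => verity_lam ?_ fun u hu => ?_⟩
  · simp [Tm.Ok, isOpenTerm_of_combinator, hs, ht]
  · simp [Tm.Ok, isOpenTerm_of_combinator, hs, ht]
  · exact verity_app (verity_app (h i) hu) (verity_app (h' i) hu)

theorem Entails.and_left : Entails (fun i => (φ i).and (ψ i)) φ := by
  refine ⟨(Tm.lam (.app .cc (.lam (.app (.var 1) (.lam (.lam (.app (.var 2) (.var 1)))))))).toV,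
    isCombinator_toV (by simp [Tm.Ok]), fun i => verity_lam (by simp [Tm.Ok]) fun c hc => ?_⟩
  refine verity_app (verity_cc (ψ := .bot))
    (verity_lam (by simp [Tm.Ok, Tm.subst, hc.1]) fun k hk => verity_bot_elim ?_)
  refine verity_app hc (verity_lam (by simp [Tm.Ok, Tm.subst, hk.1]) fun x hx => ?_)
  exact verity_lam (by simp [Tm.Ok, Tm.subst, hk.1, hx.1]) fun y hy => verity_app hk hx

theorem Entails.and_right : Entails (fun i => (φ i).and (ψ i)) ψ := by
  refine ⟨(Tm.lam (.app .cc (.lam (.app (.var 1) (.lam (.lam (.app (.var 2) (.var 0)))))))).toV,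
    isCombinator_toV (by simp [Tm.Ok]), fun i => verity_lam (by simp [Tm.Ok]) fun c hc => ?_⟩
  refine verity_app (verity_cc (ψ := .bot))
    (verity_lam (by simp [Tm.Ok, Tm.subst, hc.1]) fun k hk => verity_bot_elim ?_)
  refine verity_app hc (verity_lam (by simp [Tm.Ok, Tm.subst, hk.1]) fun x hx => ?_)
  exact verity_lam (by simp [Tm.Ok, Tm.subst, hk.1]) fun y hy => verity_app hk hy

theorem Entails.curry (h : Entails (fun i => (γ i).and (φ i)) ψ) :
    Entails γ fun i => (φ i).imp (ψ i) := by
  obtain ⟨t, ht, h⟩ := h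
  refine ⟨(Tm.lam (.lam (.app (.const t) (.lam (.app (.app (.var 0) (.var 2)) (.var 1)))))).toV,
    isCombinator_toV ?_, fun i => verity_lam ?_ fun u hu => verity_lam ?_ fun v hv => ?_⟩
  · simp [Tm.Ok, isOpenTerm_of_combinator, ht]
  · simp [Tm.Ok, isOpenTerm_of_combinator, ht]
  · simp [Tm.Ok, Tm.subst, IsCombinator.isTerm, ht, hu.1]
  · refine verity_app (h i) (verity_lam ?_ fun k hk => verity_app (verity_app hk hu) hv)
    simp [Tm.Ok, Tm.subst, hu.1, hv.1]

theorem Entails.bot_elim (h : Entails γ fun _ => .bot) : Entails γ φ :=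
  h.imp fun _ ht => ⟨ht.1, fun i => ⟨(ht.2 i).1, by
    rintro _ ⟨u, π, hu, hπ, rfl⟩
    exact (ht.2 i).2 _ ⟨u, π, hu, isStack_of_mem_falsity hπ, rfl⟩⟩⟩

/-- Classical reasoning: a formula that follows from its negation holds. -/
theorem Entails.by_contra (h : Entails (fun i => (γ i).and ((φ i).imp .bot)) fun _ => .bot) :
    Entails γ φ := by
  refine Entails.trans h.curry ⟨(Tm.lam (.app .cc (.lam (.app (.var 1) (.var 0))))).toV,
    isCombinator_toV (by simp [Tm.Ok]), fun i => verity_lam (by simp [Tm.Ok]) fun c hc => ?_⟩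
  exact verity_app (verity_cc (ψ := .bot)) (verity_lam (by simp [Tm.Ok, Tm.subst, hc.1])
    fun k hk => verity_bot_elim (verity_app hc hk))

theorem Entails.all_elim {φ : I → 𝒜.Name → 𝒜.Fml} (a : I → 𝒜.Name) :
    Entails (fun i => .all (φ i)) fun i => φ i (a i) := by
  refine ⟨(Tm.lam (.var 0)).toV, isCombinator_toV (by simp [Tm.Ok]), fun i =>
    verity_lam (by simp [Tm.Ok]) fun s hs => ⟨hs.1, fun π hπ => hs.2 π ⟨a i, hπ⟩⟩⟩

theorem Valid.all {φ : I → 𝒜.Name → 𝒜.Fml} (h : Valid fun p : I × 𝒜.Name => φ p.1 p.2) :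
    Valid fun i => .all (φ i) := by
  obtain ⟨t, ht, h⟩ := h
  exact ⟨t, ht, fun i => ⟨isOpenTerm_of_combinator ht, fun π ⟨a, hπ⟩ => (h (i, a)).2 π hπ⟩⟩

theorem Entails.all_intro {φ : I → 𝒜.Name → 𝒜.Fml}
    (h : Entails (fun p : I × 𝒜.Name => γ p.1) fun p => φ p.1 p.2) :
    Entails γ fun i => .all (φ i) := by
  obtain ⟨t, ht, h⟩ := h
  refine ⟨t, ht, fun i => ⟨isOpenTerm_of_combinator ht, ?_⟩⟩
  rintro _ ⟨s, π, hs, ⟨a, hπ⟩, rfl⟩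
  exact (h (i, a)).2 _ ⟨s, π, hs, hπ, rfl⟩

end

end RealizabilityAlgebra

/-! ### First-order formulas -/

/-- First-order formulas in the symbols `ε̸`, `∉` and `⊆`, with de Bruijn indices for variables. -/
inductive Fo : Type
  | bot
  | notEps (i j : ℕ)
  | notMem (i j : ℕ)
  | sub (i j : ℕ)
  | imp (φ ψ : Fo)
  | all (φ : Fo)

/-- A structure for the symbols of `Fo`. -/
structure Rels (M : Type*) where
  notEps : M → M → Prop
  notMem : M → M → Prop
  sub : M → M → Prop

namespace Fo

/-- Tarski's truth definition, at the assignment `e`. -/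
def Sat {M : Type*} (R : Rels M) : Fo → (ℕ → M) → Prop
  | bot, _ => False
  | notEps i j, e => R.notEps (e i) (e j)
  | notMem i j, e => R.notMem (e i) (e j)
  | sub i j, e => R.sub (e i) (e j)
  | imp φ ψ, e => φ.Sat R e → ψ.Sat R e
  | all φ, e => ∀ a, φ.Sat R (push a e)

/-- The renaming `g` below one more quantifier. -/
def lift (g : ℕ → ℕ) : ℕ → ℕ
  | 0 => 0
  | n + 1 => g n + 1

/-- Renaming of the free variables. -/
def rename : (ℕ → ℕ) → Fo → Fo
  | _, bot => bot
  | g, notEps i j => notEps (g i) (g j)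
  | g, notMem i j => notMem (g i) (g j)
  | g, sub i j => sub (g i) (g j)
  | g, imp φ ψ => imp (φ.rename g) (ψ.rename g)
  | g, all φ => all (φ.rename (lift g))

theorem push_lift {M : Type*} (a : M) (e : ℕ → M) (g : ℕ → ℕ) :
    (fun n => push a e (lift g n)) = push a fun n => e (g n) := by
  funext n; cases n <;> rfl

theorem sat_rename {M : Type*} (R : Rels M) (φ : Fo) : ∀ (g : ℕ → ℕ) (e : ℕ → M),
    (φ.rename g).Sat R e ↔ φ.Sat R fun n => e (g n) := by
  induction φ with
  | imp φ ψ ih₁ ih₂ => exact fun g e => imp_congr (ih₁ g e) (ih₂ g e)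
  | all φ ih => exact fun g e => forall_congr' fun a => by rw [ih, push_lift]
  | _ => exact fun g e => Iff.rfl

/-- Gödel numbers, which are used only to enumerate the formulas. -/
def code : Fo → ℕ
  | bot => Nat.pair 0 0
  | notEps i j => Nat.pair 1 (Nat.pair i j)
  | notMem i j => Nat.pair 2 (Nat.pair i j)
  | sub i j => Nat.pair 3 (Nat.pair i j)
  | imp φ ψ => Nat.pair 4 (Nat.pair φ.code ψ.code)
  | all φ => Nat.pair 5 φ.code

theorem code_injective : Function.Injective code := by
  intro φ
  induction φ with
  | imp φ ψ ih₁ ih₂ =>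
    intro χ h
    cases χ <;> simp only [code, Nat.pair_eq_pair] at h <;> grind
  | all φ ih =>
    intro χ h
    cases χ <;> simp only [code, Nat.pair_eq_pair] at h <;> grind
  | _ =>
    intro χ h
    cases χ <;> simp only [code, Nat.pair_eq_pair] at h <;> grind

instance : Countable Fo := code_injective.countable

variable {V : Type u} [Membership V V] [IsZFModel V] {𝒜 : RealizabilityAlgebra V}

open RealizabilityAlgebra

/-- The closed formula that arises when the names `e` are put for the free variables. -/
def eval : Fo → (ℕ → 𝒜.Name) → 𝒜.Fml
  | bot, _ => .bot
  | notEps i j, e => .notEps (e i) (e j)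
  | notMem i j, e => .notMem (e i) (e j)
  | sub i j, e => .sub (e i) (e j)
  | imp φ ψ, e => .imp (φ.eval e) (ψ.eval e)
  | all φ, e => .all fun a => φ.eval (push a e)

theorem eval_rename (φ : Fo) : ∀ (g : ℕ → ℕ) (e : ℕ → 𝒜.Name),
    (φ.rename g).eval e = φ.eval fun n => e (g n) := by
  induction φ with
  | imp φ ψ ih₁ ih₂ => exact fun g e => congrArg₂ Fml.imp (ih₁ g e) (ih₂ g e)
  | all φ ih => exact fun g e => congrArg Fml.all (funext fun a => by rw [ih, push_lift])
  | _ => exact fun g e => rfl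

/-- Falsity values of first-order formulas are first-order definable over `V`. -/
theorem falsity_eval_definable (φ : Fo) : ∃ F : (ℕ → V) → Prop, DefPred F ∧
    ∀ (e : ℕ → 𝒜.Name) (π : V), π ∈ falsity (φ.eval e) ↔ F (push π fun n => (e n).1) := by
  induction φ with
  | bot => exact ⟨fun e => IsStack 𝒜.A 𝒜.B (e 0), inferInstance, fun e π => Iff.rfl⟩
  | notEps i j =>
    exact ⟨fun e => IsStack 𝒜.A 𝒜.B (e 0) ∧ opair (e (i + 1)) (e 0) ∈ e (j + 1), by infer_instance,
      fun e π => Iff.rfl⟩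
  | notMem i j =>
    exact ⟨fun e => e 0 ∈ 𝒜.falsNotin (e (i + 1)) (e (j + 1)), by infer_instance,
      fun e π => Iff.rfl⟩
  | sub i j =>
    exact ⟨fun e => e 0 ∈ 𝒜.falsSub (e (i + 1)) (e (j + 1)), by infer_instance, fun e π => Iff.rfl⟩
  | imp φ ψ ih₁ ih₂ =>
    obtain ⟨F₁, h₁, hF₁⟩ := ih₁
    obtain ⟨F₂, h₂, hF₂⟩ := ih₂
    have h : ∀ {F : (ℕ → V) → Prop}, DefPred F → ∀ (k : ℕ) (g : ℕ → ℕ),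
        DefPred fun e => F (push (e k) fun n => e (g n)) := fun {F} hF k g => by
      refine (hF.reindex fun n => Nat.casesOn n k g).congr fun e => iff_of_eq (congrArg F ?_)
      funext n; cases n <;> rfl
    have h₁ := h h₁
    have h₂ := h h₂
    refine ⟨fun e => ∃ t π, (IsTerm 𝒜.A 𝒜.B t ∧
      ∀ σ, F₁ (push σ fun n => e (n + 1)) → opair t σ ∈ 𝒜.pole) ∧
      F₂ (push π fun n => e (n + 1)) ∧ e 0 = sPush t π, by infer_instance, fun e π => ?_⟩
    simp only [eval, falsity, orth, mem_ofPred_eq, hF₁, hF₂]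
    rfl
  | all φ ih =>
    obtain ⟨F, hF, hF'⟩ := ih
    have : ∀ (k l : ℕ) (g : ℕ → ℕ),
        DefPred fun e => F (push (e k) (push (e l) fun n => e (g n))) := fun k l g => by
      refine (hF.reindex fun n => Nat.casesOn n k fun n => Nat.casesOn n l g).congr
        fun e => iff_of_eq (congrArg F ?_)
      funext n; rcases n with _ | _ | n <;> rfl
    refine ⟨fun e => ∃ a, Derivable 𝒜.NameStep a ∧ F (push (e 0) (push a fun n => e (n + 1))),
      by infer_instance, fun e π => ?_⟩
    have key : ∀ a : 𝒜.Name, π ∈ falsity (φ.eval (push a e)) ↔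
        F (push π (push a.1 fun n => (e n).1)) := fun a => by
      rw [hF']
      refine iff_of_eq (congrArg F ?_)
      funext n; rcases n with _ | _ | n <;> rfl
    constructor
    · rintro ⟨a, ha⟩
      exact ⟨a.1, a.2, (key a).1 ha⟩
    · rintro ⟨a, ha, h⟩
      exact ⟨⟨a, ha⟩, (key ⟨a, ha⟩).2 h⟩

/-- Induction along `ε` for the property `φ` of the variable `0`. -/
def epsInduction (φ : Fo) : Fo :=
  imp (all (imp (all (imp (imp (φ.rename (lift (· + 1))) bot) (notEps 0 1))) φ)) (all φ)

theorem sat_epsInduction {M : Type*} (R : Rels M) (φ : Fo) (e : ℕ → M) :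
    φ.epsInduction.Sat R e ↔
      ((∀ x, (∀ y, (¬ φ.Sat R (push y e)) → R.notEps y x) → φ.Sat R (push x e)) →
        ∀ x, φ.Sat R (push x e)) := by
  have h : ∀ x y, (fun n => push y (push x e) (lift (· + 1) n)) = push y e := fun x y => by
    rw [push_lift]; rfl
  simp only [epsInduction, Sat, sat_rename, h]
  rfl

/-- `λ z f. f (λ k. k (z z f))`. -/
def fixStep : Tm V :=
  .lam (.lam (.app (.var 0) (.lam (.app (.var 0) (.app (.app (.var 2) (.var 2)) (.var 1))))))

/-- The fixed point combinator `Z Z`, with `Z = λ z f. f (λ k. k (z z f))`, realizes induction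
along `ε`, by induction in `V` along the components of names. -/
theorem valid_epsInduction (φ : Fo) : Valid fun e : ℕ → 𝒜.Name => φ.epsInduction.eval e := by
  have hok : ∀ (A B : V) (cont : Prop), (fixStep : Tm V).Ok A B cont 0 := fun A B cont => by
    simp [fixStep, Tm.Ok]
  have hZ : IsCombinator (fixStep : Tm V).toV := isCombinator_toV fun A B => hok A B False
  have hT : IsCombinator (tApp (fixStep : Tm V).toV (fixStep : Tm V).toV) :=
    fun A B => IsOpenTerm.app emp_mem_omega (hZ A B) (hZ A B)
  refine ⟨tApp (fixStep : Tm V).toV (fixStep : Tm V).toV, hT, fun e => ⟨hT.isTerm, ?_⟩⟩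
  rintro _ ⟨f, π, hf, ⟨a, hπ⟩, rfl⟩
  obtain ⟨F, hF, hF'⟩ := φ.falsity_eval_definable (𝒜 := 𝒜)
  have hP : DefPred fun v : ℕ → V => ∀ σ, F (push σ (push (v 0) fun n => (e n).1)) →
      opair (tApp (fixStep : Tm V).toV (fixStep : Tm V).toV) (sPush f σ) ∈ 𝒜.pole := by
    have : DefPred fun v : ℕ → V => F (push (v 0) (push (v 1) fun n => (e n).1)) := by
      refine (hF.specialize fun n => Nat.casesOn n (.inl 0) fun n => Nat.casesOn n (.inl 1)
        fun n => .inr (e n).1).congr fun v => iff_of_eq (congrArg F ?_)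
      funext n; rcases n with _ | _ | n <;> rfl
    have : DefPred fun v : ℕ → V => F (push (v 0) (push (tail v 0) fun n => (e n).1)) := this
    infer_instance
  have key : ∀ (a : 𝒜.Name) (σ : V), σ ∈ falsity (φ.eval (push a e)) ↔
      F (push σ (push a.1 fun n => (e n).1)) := fun a σ => by
    rw [hF']
    refine iff_of_eq (congrArg F ?_)
    funext n; rcases n with _ | _ | n <;> rfl
  obtain ⟨N, ha, hN⟩ := a.2
  refine (IsNameSet.induction (𝒜 := 𝒜) hN (fun a => ∀ σ, F (push σ (push a fun n => (e n).1)) →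
    opair (tApp (fixStep : Tm V).toV (fixStep : Tm V).toV) (sPush f σ) ∈ 𝒜.pole) ?_ a.1 ha) π
    ((key a π).1 hπ)
  intro b hbN ih σ hσ
  have hσ := (key ⟨b, N, hbN, hN⟩ σ).2 hσ
  have hσs := isStack_of_mem_falsity hσ
  refine pole_app hZ.isTerm hZ.isTerm (hσs.push hf.1) (pole_lam (by simp [Tm.Ok]) hZ.isTerm
    (hσs.push hf.1) (pole_lam (by simp [Tm.Ok, Tm.subst, hZ.isTerm]) hf.1 hσs ?_))
  -- the realizer of the induction hypothesis
  let W : Tm V := .lam (.app (.var 0) (.app (.app (.const (fixStep : Tm V).toV)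
    (.const (fixStep : Tm V).toV)) (.const f)))
  have hW : W.Ok 𝒜.A 𝒜.B True 0 := by simp [W, Tm.Ok, hZ.isTerm, hf.1]
  refine pole_app (s := W.toV) hf.1 hW.isOpenTerm hσs (hf.2 _ ⟨⟨b, N, hbN, hN⟩, W.toV, σ,
    ⟨hW.isOpenTerm, ?_⟩, hσ, rfl⟩)
  rintro _ ⟨c, k, τ, hk, ⟨hτ, hcb⟩, rfl⟩
  refine pole_lam (by simp [Tm.Ok, hZ.isTerm, hf.1]) hk.1 hτ ?_
  have hT' := isTerm_app (𝒜 := 𝒜) hZ.isTerm hZ.isTerm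
  refine pole_app hk.1 (isTerm_app hT' hf.1) hτ (hk.2 _ ⟨_, τ, ⟨isTerm_app hT' hf.1, ?_⟩, hτ, rfl⟩)
  intro υ hυ
  have e₁ : ((φ.rename (lift (· + 1))).eval (push c (push ⟨b, N, hbN, hN⟩ e))) =
      φ.eval (push c e) := by
    rw [eval_rename, push_lift]; rfl
  rw [e₁] at hυ
  exact pole_app hT' hf.1 (isStack_of_mem_falsity hυ) (ih c.1 τ hcb υ ((key c υ).1 hυ))

/-! ### Completeness -/

/-- The formula `p.1` with the free variables `p.2`, as a family indexed by the values of the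
variables `1, 2, …`; the variable `0` is a constant for `w`. -/
def family (w : 𝒜.Name) (p : Fo × List ℕ) (e : ℕ → 𝒜.Name) : 𝒜.Fml :=
  p.1.eval fun i => push w e (p.2.getD i 0)

/-- The family depends on finitely many variables only. -/
def FinSupp (γ : (ℕ → 𝒜.Name) → 𝒜.Fml) : Prop :=
  ∃ n, ∀ e e' : ℕ → 𝒜.Name, (∀ i, i < n → e i = e' i) → γ e = γ e'

/-- A consistent family with finite support. -/
def Consistent (γ : (ℕ → 𝒜.Name) → 𝒜.Fml) : Prop :=
  FinSupp γ ∧ ¬ Entails γ fun _ => .bot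

theorem exists_bound (l : List ℕ) : ∃ n, ∀ i, l.getD i 0 ≤ n := by
  induction l with
  | nil => exact ⟨0, by simp⟩
  | cons a l ih =>
    obtain ⟨n, hn⟩ := ih
    refine ⟨max a n, fun i => ?_⟩
    cases i with
    | zero => simp
    | succ i => simpa using Or.inr (hn i)

theorem push_congr {M : Type*} {w : M} {e e' : ℕ → M} {n k : ℕ} (h : ∀ i, i < n → e i = e' i)
    (hk : k ≤ n) : push w e k = push w e' k := by
  cases k with
  | zero => rfl
  | succ k => exact h k hk

theorem family_congr (w : 𝒜.Name) {p : Fo × List ℕ} {n : ℕ} (hn : ∀ i, p.2.getD i 0 ≤ n)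
    {e e' : ℕ → 𝒜.Name} (h : ∀ i, i < n → e i = e' i) : family w p e = family w p e' :=
  congrArg p.1.eval (funext fun i => push_congr h (hn i))

theorem finSupp_family (w : 𝒜.Name) (p : Fo × List ℕ) : FinSupp (family w p) :=
  (exists_bound p.2).imp fun _ hn _ _ h => family_congr w hn h

theorem FinSupp.map₂ {γ δ : (ℕ → 𝒜.Name) → 𝒜.Fml} (f : 𝒜.Fml → 𝒜.Fml → 𝒜.Fml)
    (hγ : FinSupp γ) (hδ : FinSupp δ) : FinSupp fun e => f (γ e) (δ e) := by
  obtain ⟨m, hm⟩ := hγ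
  obtain ⟨n, hn⟩ := hδ
  refine ⟨max m n, fun e e' h => ?_⟩
  exact congrArg₂ f (hm e e' fun i hi => h i (lt_max_of_lt_left hi))
    (hn e e' fun i hi => h i (lt_max_of_lt_right hi))

theorem FinSupp.neg {γ : (ℕ → 𝒜.Name) → 𝒜.Fml} (hγ : FinSupp γ) :
    FinSupp fun e => (γ e).imp .bot := hγ.map₂ (fun φ _ => φ.imp .bot) hγ

/-- A consistent family can be strengthened so as to decide a given formula, with a witness if a
universal formula is refuted: a variable that has not occurred so far is such a witness. -/
theorem Consistent.extend {γ : (ℕ → 𝒜.Name) → 𝒜.Fml} (hγ : Consistent γ) (w : 𝒜.Name)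
    (p : Fo × List ℕ) : ∃ γ', Consistent γ' ∧ Entails γ' γ ∧ (Entails γ' (family w p) ∨
      Entails γ' (fun e => (family w p e).imp .bot) ∧ ∀ ψ l, p = (all ψ, l) →
        ∃ m, Entails γ' fun e => (family w (ψ, m :: l) e).imp .bot) := by
  obtain ⟨hs, hc⟩ := hγ
  by_cases hp : Entails (fun e => (γ e).and (family w p e)) fun _ => .bot
  swap
  · exact ⟨_, ⟨hs.map₂ Fml.and (finSupp_family w p), hp⟩, .and_left, .inl .and_right⟩
  have hneg := hp.curry
  by_cases hall : ∃ ψ l, p = (all ψ, l)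
  swap
  · exact ⟨γ, ⟨hs, hc⟩, .refl γ, .inr ⟨hneg, fun ψ l h => (hall ⟨ψ, l, h⟩).elim⟩⟩
  obtain ⟨ψ, l, rfl⟩ := hall
  obtain ⟨n₁, h₁⟩ := hs
  obtain ⟨n₂, h₂⟩ := exists_bound l
  let k := max n₁ n₂
  refine ⟨fun e => (γ e).and ((family w (ψ, (k + 1) :: l) e).imp .bot),
    ⟨FinSupp.map₂ Fml.and ⟨n₁, h₁⟩ (finSupp_family w _).neg, fun hbot => hc ?_⟩, .and_left,
    .inr ⟨Entails.and_left.trans hneg, ?_⟩⟩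
  · refine hneg.mp (Entails.all_intro ?_)
    have hfresh := Valid.comp hbot.by_contra fun q : (ℕ → 𝒜.Name) × 𝒜.Name =>
      Function.update q.1 k q.2
    have hup : ∀ (e : ℕ → 𝒜.Name) (a : 𝒜.Name) (i : ℕ), i < k → Function.update e k a i = e i :=
      fun e a i hi => Function.update_of_ne hi.ne _ _
    refine Eq.mp (congrArg Valid (funext fun q => congrArg₂ Fml.imp ?_ ?_)) hfresh
    · exact h₁ _ _ fun i hi => hup _ _ i (lt_max_of_lt_left hi)
    · refine congrArg ψ.eval (funext fun i => ?_)
      cases i with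
      | zero => simp [push]
      | succ i =>
        simp only [List.getD_cons_succ, push]
        exact push_congr (hup _ _) ((h₂ i).trans (le_max_right _ _))
  · rintro ψ' l' h
    simp only [Prod.mk.injEq, all.injEq] at h
    obtain ⟨rfl, rfl⟩ := h
    exact ⟨_, .and_right⟩

/-- Completeness: a first-order formula about `w` that holds in every structure in which all
uniformly realized formulas about `w` hold is itself uniformly realized. -/
theorem valid_of_sat (w : 𝒜.Name) (φ : Fo) (h : ∀ R : Rels ℕ,
      (∀ χ : Fo, (Valid fun _ : Unit => χ.eval fun _ => w) → χ.Sat R fun _ => 0) →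
      φ.Sat R fun _ => 0) :
    Valid fun _ : Unit => φ.eval fun _ => w := by
  by_contra hφ
  have : Nonempty (Fo × List ℕ) := ⟨(bot, [])⟩
  obtain ⟨enum, henum⟩ := exists_surjective_nat (Fo × List ℕ)
  have hempty : ∀ χ : Fo, family w (χ, []) = fun _ => χ.eval fun _ => w := fun χ => by
    funext e; simp [family, push]
  -- the sequence of consistent families that decides all formulas
  let γ₀ : {γ : (ℕ → 𝒜.Name) → 𝒜.Fml // Consistent γ} :=
    ⟨fun e => (family w (φ, []) e).imp .bot, (finSupp_family w _).neg, fun hbot => hφ (by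
      have h1 := (Entails.and_right (φ := family w (bot.imp bot, [])).trans hbot).by_contra
      have h2 := Valid.mp h1 (Entails.refl fun _ => .bot)
      rw [hempty] at h2
      exact h2.comp fun _ _ => w)⟩
  choose next hnext using fun (γ : {γ : (ℕ → 𝒜.Name) → 𝒜.Fml // Consistent γ}) (p : Fo × List ℕ) =>
    γ.2.extend w p
  let γ : ℕ → {γ : (ℕ → 𝒜.Name) → 𝒜.Fml // Consistent γ} := fun k =>
    Nat.rec γ₀ (fun k g => ⟨next g (enum k), (hnext g (enum k)).1⟩) k
  have hmono : ∀ m n, m ≤ n → Entails (γ n).1 (γ m).1 := fun m n hmn => by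
    induction hmn with
    | refl => exact .refl _
    | @step n _ ih => exact (hnext (γ n) (enum n)).2.1.trans ih
  let U : Fo × List ℕ → Prop := fun p => ∃ k, Entails (γ k).1 (family w p)
  let U' : Fo × List ℕ → Prop := fun p => ∃ k, Entails (γ k).1 fun e => (family w p e).imp .bot
  have hnot : ∀ p, U p → ¬ U' p := by
    rintro p ⟨m, hm⟩ ⟨n, hn⟩
    exact (γ (max m n)).2.2 (((hmono n _ (le_max_right m n)).trans hn).mp
      ((hmono m _ (le_max_left m n)).trans hm))
  have hdec : ∀ p, U p ∨ U' p ∧ ∀ ψ l, p = (all ψ, l) → ∃ m, U' (ψ, m :: l) := fun p => by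
    obtain ⟨k, rfl⟩ := henum p
    rcases (hnext (γ k) (enum k)).2.2 with h | ⟨h, h'⟩
    · exact .inl ⟨k + 1, h⟩
    · exact .inr ⟨⟨k + 1, h⟩, fun ψ l hp => (h' ψ l hp).imp fun m hm => ⟨k + 1, hm⟩⟩
  let R : Rels ℕ := ⟨fun i j => U (notEps 0 1, [i, j]), fun i j => U (notMem 0 1, [i, j]),
    fun i j => U (sub 0 1, [i, j])⟩
  have hcons : ∀ (l : List ℕ) m, (push m fun i => l.getD i 0) = fun i => (m :: l).getD i 0 :=
    fun l m => by funext i; cases i <;> simp [push]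
  have truth : ∀ (χ : Fo) (l : List ℕ), χ.Sat R (fun i => l.getD i 0) ↔ U (χ, l) := by
    intro χ
    induction χ with
    | bot => exact fun l => ⟨False.elim, fun ⟨k, hk⟩ => (γ k).2.2 hk⟩
    | notEps i j => exact fun l => Iff.rfl
    | notMem i j => exact fun l => Iff.rfl
    | sub i j => exact fun l => Iff.rfl
    | imp χ ψ ih₁ ih₂ =>
      intro l
      rw [Sat, ih₁, ih₂]
      constructor
      · intro himp
        by_contra hU
        rcases hdec (χ, l) with hχ | ⟨⟨k, hk⟩, -⟩
        · obtain ⟨k, hk⟩ := himp hχ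
          exact hU ⟨k, (Entails.and_left.trans hk).curry⟩
        · refine hU ⟨k, Entails.curry ?_⟩
          exact ((Entails.and_left.trans hk).mp .and_right).bot_elim
      · rintro ⟨m, hm⟩ ⟨n, hn⟩
        exact ⟨max m n, ((hmono m _ (le_max_left m n)).trans hm).mp
          ((hmono n _ (le_max_right m n)).trans hn)⟩
    | all ψ ih =>
      intro l
      simp only [Sat, hcons, ih]
      constructor
      · intro hall
        rcases hdec (all ψ, l) with h | ⟨-, h⟩
        · exact h
        · obtain ⟨m, hm⟩ := h ψ l rfl
          exact (hnot _ (hall m) hm).elim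
      · rintro ⟨k, hk⟩ m
        refine ⟨k, hk.trans ?_⟩
        have := Entails.all_elim (φ := fun (e : ℕ → 𝒜.Name) a =>
          ψ.eval (push a fun i => push w e (l.getD i 0))) fun e => push w e m
        refine Eq.mp (congrArg (Entails _) (funext fun e =>
          congrArg ψ.eval (funext fun i => ?_))) this
        cases i <;> simp [push]
  have hφU := (truth φ []).1 (by
    simpa using h R fun χ hχ => by
      simpa using (truth χ []).2 ⟨0, by
        rw [hempty]
        exact (hχ.comp fun _ => ()).entails⟩)
  exact hnot _ hφU ⟨0, .refl _⟩

end Fo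

namespace Fo

/-! ### Set theory in first-order formulas -/

/- The abbreviations for closed formulas, in the same shape, so that `Fo.eval` turns each of them
into its namesake for closed formulas by definition. A quantifier shifts the indices by one. -/

def and (φ ψ : Fo) : Fo := imp (imp φ (imp ψ bot)) bot

def or (φ ψ : Fo) : Fo := imp (imp φ bot) (imp (imp ψ bot) bot)

def iff (φ ψ : Fo) : Fo := and (imp φ ψ) (imp ψ φ)

def ex (φ : Fo) : Fo := imp (all (imp φ bot)) bot

/-- The variable `i` is a strong element of the variable `j`. -/
def eps (i j : ℕ) : Fo := imp (notEps i j) bot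

/-- Extensional membership `i ∈ j`. -/
def mem (i j : ℕ) : Fo := imp (notMem i j) bot

/-- Extensional equality `i ≃ j`. -/
def exteq (i j : ℕ) : Fo := and (sub i j) (sub j i)

/-- `∀ x ∈ i, φ`, where `x` is the variable `0` of `φ`. -/
def allMem (i : ℕ) (φ : Fo) : Fo := all (imp (mem 0 (i + 1)) φ)

/-- `i` is transitive. -/
def isTransitive (i : ℕ) : Fo := allMem i (allMem 0 (mem 0 (i + 2)))

/-- `i` is a transitive set of transitive sets. -/
def isOrdinal (i : ℕ) : Fo := and (isTransitive i) (allMem i (isTransitive 0))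

/-- `i` is empty. -/
def isEmpty (i : ℕ) : Fo := all (notMem 0 (i + 1))

/-- `i` is the successor `j ∪ {j}` of `j`. -/
def isSuccessor (i j : ℕ) : Fo := all (iff (mem 0 (i + 1)) (or (mem 0 (j + 1)) (exteq 0 (j + 1))))

/-- `i` is a nonzero limit ordinal. -/
def isLimitOrdinal (i : ℕ) : Fo :=
  and (isOrdinal i) (and (ex (and (isEmpty 0) (mem 0 (i + 1))))
    (allMem i (ex (and (isSuccessor 0 1) (mem 0 (i + 2))))))

/-- `i` is the least nonzero limit ordinal. -/
def isFirstInfiniteOrdinal (i : ℕ) : Fo :=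
  and (isLimitOrdinal i) (all (imp (isLimitOrdinal 0) (sub (i + 1) 0)))

end Fo

namespace Rels

open Fo

variable {M : Type*} (R : Rels M)

/-- `x` is a strong element of `y`. -/
def Eps (x y : M) : Prop := ¬ R.notEps x y

/-- `x` is an extensional element of `y`. -/
def Mem (x y : M) : Prop := ¬ R.notMem x y

/-- `x` and `y` are extensionally equal. -/
def Eqv (x y : M) : Prop := R.sub x y ∧ R.sub y x

/-- `a` is transitive with respect to extensional membership. -/
def IsTrans (a : M) : Prop := ∀ x, R.Mem x a → ∀ y, R.Mem y x → R.Mem y a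

/-- `a` is a nonzero limit ordinal. -/
def IsLim (a : M) : Prop :=
  (R.IsTrans a ∧ ∀ x, R.Mem x a → R.IsTrans x) ∧ (∃ e, (∀ y, ¬ R.Mem y e) ∧ R.Mem e a) ∧
    ∀ x, R.Mem x a → ∃ s, (∀ y, R.Mem y s ↔ R.Mem y x ∨ R.Eqv y x) ∧ R.Mem s a

variable {R}

theorem sat_and {φ ψ : Fo} {e : ℕ → M} : (φ.and ψ).Sat R e ↔ φ.Sat R e ∧ ψ.Sat R e := by
  simp only [Fo.and, Sat]; tauto

theorem sat_or {φ ψ : Fo} {e : ℕ → M} : (φ.or ψ).Sat R e ↔ φ.Sat R e ∨ ψ.Sat R e := by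
  simp only [Fo.or, Sat]; tauto

theorem sat_iff {φ ψ : Fo} {e : ℕ → M} : (φ.iff ψ).Sat R e ↔ (φ.Sat R e ↔ ψ.Sat R e) := by
  simp only [Fo.iff, sat_and, Sat]; tauto

theorem sat_ex {φ : Fo} {e : ℕ → M} : φ.ex.Sat R e ↔ ∃ a, φ.Sat R (push a e) := by
  simp only [Fo.ex, Sat, not_forall, imp_false, not_not]

theorem sat_exteq {i j : ℕ} {e : ℕ → M} : (Fo.exteq i j).Sat R e ↔ R.Eqv (e i) (e j) := sat_and

theorem sat_isTransitive {i : ℕ} {e : ℕ → M} :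
    (Fo.isTransitive i).Sat R e ↔ R.IsTrans (e i) := Iff.rfl

theorem sat_isLimitOrdinal {i : ℕ} {e : ℕ → M} :
    (Fo.isLimitOrdinal i).Sat R e ↔ R.IsLim (e i) := by
  have h₁ : ∀ {i j : ℕ} {e : ℕ → M}, (Fo.isSuccessor i j).Sat R e ↔
      ∀ y, R.Mem y (e i) ↔ R.Mem y (e j) ∨ R.Eqv y (e j) := fun {i j e} =>
    forall_congr' fun y => by rw [sat_iff, sat_or, sat_exteq]; rfl
  have h₂ : ∀ {i : ℕ} {e : ℕ → M}, (Fo.isEmpty i).Sat R e ↔ ∀ y, ¬ R.Mem y (e i) := fun {i e} =>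
    forall_congr' fun y => not_not.symm
  simp only [Fo.isLimitOrdinal, Fo.isOrdinal, Fo.allMem, sat_and, sat_ex, Sat, h₁, h₂,
    sat_isTransitive]
  rfl

theorem sat_isFirstInfiniteOrdinal {i : ℕ} {e : ℕ → M} :
    (Fo.isFirstInfiniteOrdinal i).Sat R e ↔
      R.IsLim (e i) ∧ ∀ b, R.IsLim b → R.sub (e i) b := by
  simp only [Fo.isFirstInfiniteOrdinal, sat_and, sat_isLimitOrdinal, Sat]
  rfl

/-- The properties of `ε`, `∈`, `⊆` and of `w = ℸ ω` from which it follows that `w` is the first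
infinite ordinal. The elements of `w` are nested like `ℸ n`: a nonempty one has a largest element,
and each is the largest element of another one. -/
structure IsReishModel (R : Rels M) (w : M) : Prop where
  sub_iff : ∀ a b, R.sub a b ↔ ∀ c, R.Eps c a → R.Mem c b
  mem_iff : ∀ a b, R.Mem a b ↔ ∃ c, R.Eps c b ∧ R.Eqv a c
  sub_refl : ∀ a, R.sub a a
  induction : ∀ (φ : Fo) (b : M), φ.epsInduction.Sat R (push b fun _ => w)
  eps_omega : ∀ x y, R.Eps x w → R.Eps y x → R.Eps y w
  eps_trans : ∀ x y z, R.Eps x w → R.Eps y x → R.Eps z y → R.Eps z x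
  max : ∀ x y, R.Eps x w → R.Eps y x → ∃ m, R.Eps m x ∧ ∀ z, R.Eps z x → R.sub z m
  succ : ∀ x, R.Eps x w → ∃ s, R.Eps s w ∧ R.Eps x s ∧ ∀ z, R.Eps z s → R.sub z x
  zero : ∃ e, R.Eps e w ∧ ∀ y, ¬ R.Eps y e

namespace IsReishModel

variable {w : M} (h : R.IsReishModel w)

include h

/-- Induction along `ε` for properties that are expressible with the parameter `b`, taken from the
variable `1`, and `w`, from the later ones. -/
theorem ind (φ : Fo) (b : M)
    (step : ∀ x, (∀ y, R.Eps y x → φ.Sat R (push y (push b fun _ => w))) →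
      φ.Sat R (push x (push b fun _ => w))) (x : M) : φ.Sat R (push x (push b fun _ => w)) :=
  (sat_epsInduction R φ _).1 (h.induction φ b)
    (fun x ih => step x fun y hy => by_contra fun hn => hy (ih y hn)) x

/-- By induction on `y`, since `a ⊆ b` depends on inclusions between elements in both
directions. -/
theorem sub_trans {x y z : M} : R.sub x y → R.sub y z → R.sub x z := by
  refine h.ind (.all (.all (.imp (.sub 1 2) (.imp (.sub 2 0) (.sub 1 0))))) w ?_ y x z
  intro y ih x z hxy hyz
  refine (h.sub_iff _ _).2 fun c hc => ?_
  obtain ⟨d, hd, hcd⟩ := (h.mem_iff _ _).1 ((h.sub_iff _ _).1 hxy c hc)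
  obtain ⟨f, hf, hdf⟩ := (h.mem_iff _ _).1 ((h.sub_iff _ _).1 hyz d hd)
  exact (h.mem_iff _ _).2 ⟨f, hf, ih d hd c f hcd.1 hdf.1, ih d hd f c hdf.2 hcd.2⟩

theorem eqv_trans {x y z : M} (h₁ : R.Eqv x y) (h₂ : R.Eqv y z) : R.Eqv x z :=
  ⟨h.sub_trans h₁.1 h₂.1, h.sub_trans h₂.2 h₁.2⟩

theorem mem_of_eps {x y : M} (hxy : R.Eps x y) : R.Mem x y :=
  (h.mem_iff _ _).2 ⟨x, hxy, h.sub_refl x, h.sub_refl x⟩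

theorem mem_of_eqv {x y z : M} (hxy : R.Eqv x y) (hyz : R.Mem y z) : R.Mem x z := by
  obtain ⟨c, hc, hyc⟩ := (h.mem_iff _ _).1 hyz
  exact (h.mem_iff _ _).2 ⟨c, hc, h.eqv_trans hxy hyc⟩

theorem mem_of_sub {x y z : M} (hxy : R.Mem x y) (hyz : R.sub y z) : R.Mem x z := by
  obtain ⟨c, hc, hxc⟩ := (h.mem_iff _ _).1 hxy
  exact h.mem_of_eqv hxc ((h.sub_iff _ _).1 hyz c hc)

/-- An element of `w` that is included in another one belongs or is equal to it. -/
theorem mem_or_sub {y z : M} (hy : R.Eps y w) (hz : R.Eps z w) (hzy : R.sub z y) :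
    R.Mem z y ∨ R.sub y z := by
  refine or_iff_not_imp_left.2 fun hn => h.ind (.imp (.eps 0 1) (.all (.imp (.eps 0 2)
    (.imp (.sub 0 1) (.imp (.imp (.mem 0 1) .bot) (.sub 1 0)))))) w ?_ y hy z hz hzy hn
  intro y ih hy z hz hzy hn
  have ih : ∀ y', R.Eps y' y → ∀ z, R.Eps z w → R.sub z y' → R.Mem z y' ∨ R.sub y' z :=
    fun y' hy' z hz hzy => or_iff_not_imp_left.2 (ih y' hy' (h.eps_omega y y' hy hy') z hz hzy)
  show R.sub y z
  refine (h.sub_iff _ _).2 fun v hv => ?_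
  obtain ⟨m, hm, hmax⟩ := h.max y v hy hv
  have hmw := h.eps_omega y m hy hm
  -- the largest element of `y` belongs to `z`, since otherwise `z` would be included in it
  have hmz : R.Mem m z := by
    by_contra hmz
    have hzm : R.sub z m := by
      refine (h.sub_iff _ _).2 fun u hu => ?_
      obtain ⟨u', hu', huu'⟩ := (h.mem_iff _ _).1 ((h.sub_iff _ _).1 hzy u hu)
      refine h.mem_of_eqv huu' ((ih m hm u' (h.eps_omega y u' hy hu') (hmax u' hu')).resolve_right
        fun hmu => hmz ((h.mem_iff _ _).2 ⟨u, hu, ?_⟩))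
      exact ⟨h.sub_trans hmu huu'.2, h.sub_trans huu'.1 (hmax u' hu')⟩
    rcases ih m hm z hz hzm with hzm' | hmz'
    · obtain ⟨c, hc, hzc⟩ := (h.mem_iff _ _).1 hzm'
      exact hn (h.mem_of_eqv hzc (h.mem_of_eps (h.eps_trans y m c hy hm hc)))
    · exact hn (h.mem_of_eqv ⟨hzm, hmz'⟩ (h.mem_of_eps hm))
  obtain ⟨m', hm', hmm'⟩ := (h.mem_iff _ _).1 hmz
  rcases ih m hm v (h.eps_omega y v hy hv) (hmax v hv) with hvm | hmv
  · obtain ⟨c, hc, hvc⟩ := (h.mem_iff _ _).1 (h.mem_of_sub hvm hmm'.1)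
    exact h.mem_of_eqv hvc (h.mem_of_eps (h.eps_trans z m' c hz hm' hc))
  · exact h.mem_of_eqv ⟨hmax v hv, hmv⟩ hmz

/-- Elements of elements of `w`, up to extensional equality. -/
theorem mem_of_mem_of_eps {x y z : M} (hx : R.Eps x w) (hy : R.Eps y x) (hz : R.Mem z y) :
    R.Mem z x := by
  obtain ⟨c, hc, hzc⟩ := (h.mem_iff _ _).1 hz
  exact h.mem_of_eqv hzc (h.mem_of_eps (h.eps_trans x y c hx hy hc))

/-- If `m` is the largest element of `s`, then `s` is the successor of `m`. -/
theorem mem_iff_of_max {s m : M} (hs : R.Eps s w) (hm : R.Eps m s)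
    (hmax : ∀ z, R.Eps z s → R.sub z m) (y : M) : R.Mem y s ↔ R.Mem y m ∨ R.Eqv y m := by
  constructor
  · intro hy
    obtain ⟨c, hc, hyc⟩ := (h.mem_iff _ _).1 hy
    rcases h.mem_or_sub (h.eps_omega s m hs hm) (h.eps_omega s c hs hc) (hmax c hc) with hcm | hmc
    · exact .inl (h.mem_of_eqv hyc hcm)
    · exact .inr (h.eqv_trans hyc ⟨hmax c hc, hmc⟩)
  · rintro (hy | hy)
    · exact h.mem_of_mem_of_eps hs hm hy
    · exact (h.mem_iff _ _).2 ⟨m, hm, hy⟩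

theorem isTrans_of_mem {x : M} (hx : R.Mem x w) : R.IsTrans x := by
  obtain ⟨x', hx', hxx'⟩ := (h.mem_iff _ _).1 hx
  intro y hy z hz
  obtain ⟨y', hy', hyy'⟩ := (h.mem_iff _ _).1 (h.mem_of_sub hy hxx'.1)
  exact h.mem_of_sub (h.mem_of_mem_of_eps hx' hy' (h.mem_of_sub hz hyy'.1)) hxx'.2

/-- The successor of an element of `w` is given by `succ`, and zero by `zero`. -/
theorem isLim : R.IsLim w := by
  refine ⟨⟨fun x hx y hy => ?_, fun x => h.isTrans_of_mem⟩, ?_, fun x hx => ?_⟩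
  · obtain ⟨x', hx', hxx'⟩ := (h.mem_iff _ _).1 hx
    obtain ⟨y', hy', hyy'⟩ := (h.mem_iff _ _).1 (h.mem_of_sub hy hxx'.1)
    exact h.mem_of_eqv hyy' (h.mem_of_eps (h.eps_omega x' y' hx' hy'))
  · obtain ⟨e, he, hempty⟩ := h.zero
    exact ⟨e, fun y hy => ((h.mem_iff _ _).1 hy).elim fun c hc => hempty c hc.1, h.mem_of_eps he⟩
  · obtain ⟨x', hx', hxx'⟩ := (h.mem_iff _ _).1 hx
    obtain ⟨s, hs, hxs, hmax⟩ := h.succ x' hx'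
    refine ⟨s, fun y => (h.mem_iff_of_max hs hxs hmax y).trans (or_congr ?_ ?_), h.mem_of_eps hs⟩
    · exact ⟨fun hy => h.mem_of_sub hy hxx'.2, fun hy => h.mem_of_sub hy hxx'.1⟩
    · exact ⟨fun hy => h.eqv_trans hy hxx'.symm, fun hy => h.eqv_trans hy hxx'⟩

/-- Every nonzero limit ordinal includes `w`, by induction along `ε` on the elements of `w`. -/
theorem sub_of_isLim {b : M} (hb : R.IsLim b) : R.sub w b := by
  refine (h.sub_iff _ _).2 fun x hx => h.ind (.imp (.eps 0 2) (.mem 0 1)) b ?_ x hx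
  intro x ih hx
  have ih : ∀ y, R.Eps y x → R.Mem y b := fun y hy => ih y hy (h.eps_omega x y hx hy)
  show R.Mem x b
  by_cases hne : ∃ y, R.Eps y x
  · obtain ⟨y, hy⟩ := hne
    obtain ⟨m, hm, hmax⟩ := h.max x y hx hy
    obtain ⟨s, hs, hsb⟩ := hb.2.2 m (ih m hm)
    refine h.mem_of_eqv ⟨?_, ?_⟩ hsb <;> refine (h.sub_iff _ _).2 fun c hc => ?_
    · exact (hs c).2 ((h.mem_iff_of_max hx hm hmax c).1 (h.mem_of_eps hc))
    · exact (h.mem_iff_of_max hx hm hmax c).2 ((hs c).1 (h.mem_of_eps hc))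
  · obtain ⟨e, he, heb⟩ := hb.2.1
    refine h.mem_of_eqv ⟨?_, ?_⟩ heb <;> refine (h.sub_iff _ _).2 fun c hc => ?_
    · exact (hne ⟨c, hc⟩).elim
    · exact (he c (h.mem_of_eps hc)).elim

end IsReishModel

end Rels

namespace RealizabilityAlgebra

variable {V : Type u} [Membership V V] [IsZFModel V] {𝒜 : RealizabilityAlgebra V}

/-! ### Reflexivity of inclusion -/

theorem isCombinator_theta : IsCombinator (theta : V) :=
  isCombinator_toV (p := .lam (.lam (.app (.app (.var 0) (.app (.var 1) (.var 1)))
    (.app (.var 1) (.var 1))))) (by simp [Tm.Ok])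

theorem isCombinator_wZero : IsCombinator (wZero : V) := fun A B =>
  IsOpenTerm.app emp_mem_omega (isCombinator_theta A B) (isCombinator_theta A B)

theorem isCombinator_wOne : IsCombinator (wOne : V) :=
  isCombinator_toV (p := .lam (.app (.app (.var 0) (.const wZero)) (.const wZero)))
    (by simp [Tm.Ok, isOpenTerm_of_combinator, isCombinator_wZero])

/-- `θ θ ⋆ t · π ≻ t ⋆ w₀ · w₀ · π`. -/
theorem pole_wZero {t π : V} (ht : IsTerm 𝒜.A 𝒜.B t) (hπ : IsStack 𝒜.A 𝒜.B π)
    (h : opair t (sPush wZero (sPush wZero π)) ∈ 𝒜.pole) : opair wZero (sPush t π) ∈ 𝒜.pole := by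
  have hθ := isCombinator_theta.isTerm (A := 𝒜.A) (B := 𝒜.B)
  have h₀ := isCombinator_wZero.isTerm (A := 𝒜.A) (B := 𝒜.B)
  refine pole_app hθ hθ (hπ.push ht) (pole_lam (t := .lam (.app (.app (.var 0)
    (.app (.var 1) (.var 1))) (.app (.var 1) (.var 1)))) (by simp [Tm.Ok]) hθ (hπ.push ht)
    (pole_lam (by simp [Tm.Ok, Tm.subst, hθ]) ht hπ ?_))
  exact pole_app (isTerm_app ht h₀) h₀ hπ (pole_app ht h₀ (hπ.push h₀) h)

/-- `w₀` realizes `a ⊆ a`, by induction in `V` along the components of names. -/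
theorem wZero_refl (a : 𝒜.Name) : (wZero : V) ∈ verity (.sub a a : 𝒜.Fml) := by
  refine ⟨isCombinator_wZero.isTerm, ?_⟩
  obtain ⟨N, ha, hN⟩ := a.2
  refine IsNameSet.induction (𝒜 := 𝒜) hN (fun a => ∀ σ, σ ∈ 𝒜.falsSub a a →
    opair wZero σ ∈ 𝒜.pole) (fun b hb ih σ hσ => ?_) a.1 ha
  obtain ⟨c, π, t, hc, ht, rfl⟩ := (mem_falsSub (a := ⟨b, N, hb, hN⟩) (b := ⟨b, N, hb, hN⟩)).1 hσ
  have hw : (wZero : V) ∈ 𝒜.orth (𝒜.falsSub c.1 c.1) := ⟨isCombinator_wZero.isTerm, ih c.1 π hc⟩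
  exact pole_wZero ht.1 (IsNameSet.mem hN hb hc).2 (ht.2 _ ((mem_falsNotin (b := ⟨b, N, hb, hN⟩)).2
    ⟨c, π, _, _, hc, hw, hw, rfl⟩))

/-- `w₀` realizes `a ⊆ b` if `a` is a subset of `b` in `V`. -/
theorem wZero_sub {a b : 𝒜.Name} (h : ∀ (c : 𝒜.Name) (π : V), opair c.1 π ∈ a.1 →
    opair c.1 π ∈ b.1) : (wZero : V) ∈ verity (.sub a b : 𝒜.Fml) := by
  refine ⟨isCombinator_wZero.isTerm, fun σ hσ => ?_⟩
  obtain ⟨c, π, t, hc, ht, rfl⟩ := mem_falsSub.1 hσ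
  exact pole_wZero ht.1 (a.component hc).2 (ht.2 _ (mem_falsNotin.2
    ⟨c, π, _, _, h c π hc, wZero_refl c, wZero_refl c, rfl⟩))

theorem wOne_mem_verity : (wOne : V) ∈ verity 𝒜.reflFml := by
  have h₀ := isCombinator_wZero.isTerm (A := 𝒜.A) (B := 𝒜.B)
  refine ⟨isCombinator_wOne.isTerm, fun π ⟨a, hπ⟩ => ?_⟩
  refine (verity_lam (t := .app (.app (.var 0) (.const wZero)) (.const wZero))
    (by simp [Tm.Ok, h₀]) fun s hs => ?_ : (wOne : V) ∈ verity (.exteq a a : 𝒜.Fml)).2 π hπ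
  exact verity_app (verity_app hs (wZero_refl a)) (wZero_refl a)

/-! ### Elements of `ℸ ω` are zero or successors -/

theorem isRealizer_etaTerm {A B w : V} (hw : IsRealizer A B w) : IsRealizer A B (etaTerm w) :=
  Tm.Ok.isOpenTerm (t := .lam (.app (.const w) (.var 0))) (k := 0) (by
    have : IsOpenTerm A B False emp w := hw
    simp [Tm.Ok, this])

/-- A strong element of `ℸ n` shows that `n = m + 1` in `V`, and then the premise applied to `ℸ m`
says that `ℸ n ≄ ℸ n`. -/
theorem etaTerm_mem_verity {w : V} (hw : w ∈ verity 𝒜.reflFml) :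
    etaTerm w ∈ verity 𝒜.zeroOrSuccFml := by
  have hok : (Tm.app (.const w) (.var 0)).Ok 𝒜.A 𝒜.B True 1 := by simp [Tm.Ok, hw.1]
  refine ⟨Tm.Ok.isOpenTerm (t := .lam (.app (.const w) (.var 0))) (k := 0) hok, ?_⟩
  rintro _ ⟨x, hx, t, π, ht, ⟨y, hπ, hy⟩, rfl⟩
  obtain ⟨n, hn, rfl⟩ := 𝒜.mem_reishNats.1 hx
  refine pole_lam hok ht.1 hπ (pole_app hw.1 ht.1 hπ (hw.2 _ ⟨𝒜.reishNat n hn, t, π,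
    ⟨ht.1, fun σ (hσ : σ ∈ falsity (.nexteq (𝒜.reishNat n hn) (𝒜.reishNat n hn))) => ?_⟩, hπ, rfl⟩))
  obtain ⟨-, z, hz, -⟩ := (𝒜.opair_mem_reishNat hn).1 hy
  rcases eq_emp_or_succ hn with rfl | ⟨m, hm, rfl⟩
  · exact (not_mem_emp z hz).elim
  · refine ht.2 σ ⟨𝒜.reishNat m hm, 𝒜.mem_reishNats.2 ⟨m, hm, rfl⟩, ?_⟩
    beta_reduce
    rw [𝒜.applyLift_succGraph hm]
    exact hσ

/-! ### Realized properties of names -/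

/-- The identity realizes an implication along an inclusion of falsity values. -/
theorem entails_of_falsity_subset {I : Type*} {φ ψ : I → 𝒜.Fml}
    (h : ∀ i, falsity (ψ i) ⊆ falsity (φ i)) : Entails φ ψ := by
  refine ⟨(Tm.lam (.var 0)).toV, isCombinator_toV (by simp [Tm.Ok]), fun i =>
    verity_lam (by simp [Tm.Ok]) fun s hs => ⟨hs.1, fun π hπ => hs.2 π (h i hπ)⟩⟩

theorem falsity_sub (a b : 𝒜.Name) : falsity (.sub a b : 𝒜.Fml) =
    falsity (.all fun c => .imp (.notMem c b) (.notEps c a) : 𝒜.Fml) := by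
  ext ρ
  refine (mem_falsSub (a := a) (b := b)).trans ⟨?_, ?_⟩
  · rintro ⟨c, π, t, hc, ht, rfl⟩
    exact ⟨c, t, π, ht, ⟨(a.component hc).2, hc⟩, rfl⟩
  · rintro ⟨c, t, π, ht, hc, rfl⟩
    exact ⟨c, π, t, hc.2, ht, rfl⟩

theorem falsity_notMem (a b : 𝒜.Name) : falsity (.notMem a b : 𝒜.Fml) =
    falsity (.all fun c => .imp (.sub a c) (.imp (.sub c a) (.notEps c b)) : 𝒜.Fml) := by
  ext ρ
  refine (mem_falsNotin (a := a) (b := b)).trans ⟨?_, ?_⟩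
  · rintro ⟨c, π, t, t', hc, ht, ht', rfl⟩
    exact ⟨c, t, _, ht, ⟨t', π, ht', ⟨(b.component hc).2, hc⟩, rfl⟩, rfl⟩
  · rintro ⟨c, t, _, ht, ⟨t', π, ht', hc, rfl⟩, rfl⟩
    exact ⟨c, π, t, t', hc.2, ht, ht', rfl⟩

theorem opair_reishNat_mem {n m π : V} (hn : n ∈ (omega : V)) (hm : m ∈ n)
    (hπ : IsStack 𝒜.A 𝒜.B π) :
    opair (𝒜.reishNat m (omega_transitive hn hm)).1 π ∈ (𝒜.reishNat n hn).1 :=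
  (𝒜.opair_mem_reishNat hn).2 ⟨hπ, m, hm, rfl⟩

theorem opair_reishNat_mem_reishOmega {n π : V} (hn : n ∈ (omega : V))
    (hπ : IsStack 𝒜.A 𝒜.B π) : opair (𝒜.reishNat n hn).1 π ∈ 𝒜.reishOmega.1 :=
  𝒜.opair_mem_reishOmega.2 ⟨hπ, 𝒜.mem_reishNats.2 ⟨n, hn, rfl⟩⟩

/-- A realizer that is common to all `φ (ℸ n)` gives one of `∀ x (x ε ℸ ω → φ x)`: in case `φ x` is
refuted, `x` is not of the form `ℸ n`, or else the refutation applies to the given realizer. -/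
theorem valid_forall_eps_omega {φ : 𝒜.Name → 𝒜.Fml} {p : Tm V} (hp : ∀ A B, p.Ok A B False 0)
    (h : ∀ n (hn : n ∈ (omega : V)), p.toV ∈ verity (φ (𝒜.reishNat n hn))) :
    Valid fun _ : Unit => Fml.all fun x => .imp (.imp (.notEps x 𝒜.reishOmega) .bot) (φ x) := by
  have hc := isCombinator_toV hp
  refine ⟨(Tm.lam (.app .cc (.lam (.app (.var 1) (.app (.var 0) (.const p.toV)))))).toV,
    isCombinator_toV (by simp [Tm.Ok, isOpenTerm_of_combinator, hc]), fun _ =>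
    ⟨(isCombinator_toV (by simp [Tm.Ok, isOpenTerm_of_combinator, hc])).isTerm, ?_⟩⟩
  rintro π ⟨x, hπ⟩
  refine (verity_lam (by simp [Tm.Ok, isOpenTerm_of_combinator, hc]) fun u hu => ?_).2 π hπ
  refine verity_app (verity_cc (ψ := .bot)) (verity_lam
    (by simp [Tm.Ok, Tm.subst, hu.1, isOpenTerm_of_combinator, hc]) fun k hk =>
    verity_bot_elim (verity_app hu ⟨isTerm_app hk.1 hc.isTerm, ?_⟩))
  rintro σ ⟨hσ, hx⟩
  obtain ⟨n, hn, rfl⟩ := 𝒜.mem_reishNats.1 (𝒜.opair_mem_reishOmega.1 hx).2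
  exact (verity_app hk (h n hn)).2 σ hσ

/-- The elements of `ℸ ω` are included in it. -/
theorem valid_eps_omega : Valid fun _ : Unit => (Fo.all (.imp (.eps 0 1) (.all (.imp (.notEps 0 2)
    (.notEps 0 1))))).eval fun _ => 𝒜.reishOmega := by
  refine valid_forall_eps_omega (p := .lam (.var 0)) (by simp [Tm.Ok]) fun n hn =>
    ⟨(isCombinator_toV (by simp [Tm.Ok])).isTerm, ?_⟩
  rintro _ ⟨y, u, π, hu, ⟨hπ, hy⟩, rfl⟩
  obtain ⟨-, m, hm, rfl⟩ := (𝒜.opair_mem_reishNat hn).1 hy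
  exact pole_lam (by simp [Tm.Ok]) hu.1 hπ (hu.2 π
    ⟨hπ, opair_reishNat_mem_reishOmega (omega_transitive hn hm) hπ⟩)

/-- The elements of `ℸ ω` are transitive with respect to `ε`. -/
theorem valid_eps_trans : Valid fun _ : Unit => (Fo.all (.imp (.eps 0 1) (.all (.all
    (.imp (.notEps 0 2) (.imp (.eps 1 2) (.notEps 0 1))))))).eval fun _ => 𝒜.reishOmega := by
  refine valid_forall_eps_omega (p := .lam (.lam (.app (.var 0) (.var 1)))) (by simp [Tm.Ok])
    fun n hn => ⟨(isCombinator_toV (by simp [Tm.Ok])).isTerm, ?_⟩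
  rintro _ ⟨y, z, t, _, ht, ⟨u, π, hu, ⟨hπ, hz⟩, rfl⟩, rfl⟩
  refine pole_lam (by simp [Tm.Ok]) ht.1 (hπ.push hu.1) (pole_lam (by simp [Tm.Ok, Tm.subst, ht.1])
    hu.1 hπ (pole_app hu.1 ht.1 hπ (hu.2 _ ⟨t, π, ⟨ht.1, ?_⟩, hπ, rfl⟩)))
  rintro σ ⟨hσ, hy⟩
  obtain ⟨-, m, hm, rfl⟩ := (𝒜.opair_mem_reishNat hn).1 hy
  obtain ⟨-, l, hl, rfl⟩ := (𝒜.opair_mem_reishNat (omega_transitive hn hm)).1 hz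
  exact ht.2 σ ⟨hσ, opair_reishNat_mem hn (nat_transitive hn hm hl) hσ⟩

/-- `λ k. k w₀` realizes that `ℸ m` is the largest element of `ℸ (m + 1)`. -/
theorem verity_max {m : V} (hm : m ∈ (omega : V)) :
    (Tm.lam (.app (.var 0) (.const wZero))).toV ∈ verity (Fml.all fun z =>
      .imp (.imp (.sub z (𝒜.reishNat m hm)) .bot)
        (.notEps z (𝒜.reishNat (succ m) (succ_mem_omega hm)))) := by
  have h₀ := isCombinator_wZero.isTerm (A := 𝒜.A) (B := 𝒜.B)
  refine ⟨Tm.Ok.isOpenTerm (k := 0) (by simp [Tm.Ok, h₀]), ?_⟩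
  rintro _ ⟨z, k, π, hk, ⟨hπ, hz⟩, rfl⟩
  obtain ⟨-, l, hl, rfl⟩ := (𝒜.opair_mem_reishNat _).1 hz
  refine pole_lam (by simp [Tm.Ok, h₀]) hk.1 hπ (pole_app hk.1 h₀ hπ (hk.2 _ ⟨wZero, π,
    wZero_sub fun c σ hc => ?_, hπ, rfl⟩))
  obtain ⟨hσ, j, hj, rfl⟩ := (𝒜.opair_mem_reishNat _).1 hc
  refine (𝒜.opair_mem_reishNat hm).2 ⟨hσ, j, ?_, rfl⟩
  rcases mem_succ.1 hl with hl | rfl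
  · exact nat_transitive hm hl hj
  · exact hj

/-- A nonempty element of `ℸ ω` has a largest element. -/
theorem valid_exists_max : Valid fun _ : Unit => (Fo.all (.imp (.eps 0 1) (.imp
    (.all (.imp (.all (.imp (.imp (.sub 0 1) .bot) (.notEps 0 2))) (.notEps 0 1)))
    (.all (.notEps 0 1))))).eval fun _ => 𝒜.reishOmega := by
  have h₀ := isCombinator_wZero.isTerm (A := 𝒜.A) (B := 𝒜.B)
  refine valid_forall_eps_omega (p := .lam (.app (.var 0) (.lam (.app (.var 0) (.const wZero)))))
    (by simp [Tm.Ok, isOpenTerm_of_combinator, isCombinator_wZero]) fun n hn =>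
    verity_lam (by simp [Tm.Ok, h₀]) fun t ht => ⟨isTerm_app ht.1 (Tm.Ok.isOpenTerm
      (t := .lam (.app (.var 0) (.const wZero))) (k := 0) (by simp [Tm.Ok, h₀])), ?_⟩
  rintro π ⟨y, hπ, hy⟩
  obtain ⟨-, l, hl, -⟩ := (𝒜.opair_mem_reishNat hn).1 hy
  rcases eq_emp_or_succ hn with rfl | ⟨m, hm, rfl⟩
  · exact (not_mem_emp l hl).elim
  · have hM := verity_max (𝒜 := 𝒜) hm
    exact pole_app ht.1 hM.1 hπ (ht.2 _ ⟨𝒜.reishNat m hm, _, π, hM,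
      ⟨hπ, opair_reishNat_mem hn (mem_succ.2 (.inr rfl)) hπ⟩, rfl⟩)

/-- An element of `ℸ ω` is the largest element of another one. -/
theorem valid_exists_succ : Valid fun _ : Unit => (Fo.all (.imp (.eps 0 1) (.imp
    (.all (.imp (.all (.imp (.imp (.sub 0 2) .bot) (.notEps 0 1)))
      (.imp (.eps 1 0) (.notEps 0 2)))) .bot))).eval fun _ => 𝒜.reishOmega := by
  have h₀ := isCombinator_wZero.isTerm (A := 𝒜.A) (B := 𝒜.B)
  refine valid_forall_eps_omega (p := .lam (.app (.app (.var 0)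
    (.lam (.app (.var 0) (.const wZero)))) (.lam (.var 0))))
    (by simp [Tm.Ok, isOpenTerm_of_combinator, isCombinator_wZero]) fun n hn =>
    verity_lam (by simp [Tm.Ok, h₀]) fun t ht => ?_
  have hM := verity_max (𝒜 := 𝒜) hn
  have hI : (Tm.lam (.var 0)).toV ∈ verity (.imp (.notEps (𝒜.reishNat n hn)
      (𝒜.reishNat (succ n) (succ_mem_omega hn))) .bot : 𝒜.Fml) :=
    verity_lam (by simp [Tm.Ok]) fun u hu => ⟨hu.1, fun σ hσ => hu.2 σ
      ⟨hσ, opair_reishNat_mem (succ_mem_omega hn) (mem_succ.2 (.inr rfl)) hσ⟩⟩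
  refine ⟨isTerm_app (isTerm_app ht.1 hM.1) hI.1, fun π hπ => ?_⟩
  refine pole_app (isTerm_app ht.1 hM.1) hI.1 hπ (pole_app ht.1 hM.1 (hπ.push hI.1)
    (ht.2 _ ⟨𝒜.reishNat (succ n) (succ_mem_omega hn), _, _, hM, ⟨_, π, hI, ⟨hπ, ?_⟩, rfl⟩, rfl⟩))
  exact opair_reishNat_mem_reishOmega (succ_mem_omega hn) hπ

/-- `ℸ ω` has an empty element. -/
theorem valid_exists_empty : Valid fun _ : Unit => (Fo.imp (.all (.imp (.all (.notEps 0 1))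
    (.notEps 0 1))) .bot).eval fun _ => 𝒜.reishOmega := by
  refine ⟨(Tm.lam (.app (.var 0) (.var 0))).toV, isCombinator_toV (by simp [Tm.Ok]), fun _ =>
    verity_lam (by simp [Tm.Ok]) fun t ht => ⟨isTerm_app ht.1 ht.1, fun π hπ => ?_⟩⟩
  refine pole_app ht.1 ht.1 hπ (ht.2 _ ⟨𝒜.reishNat emp emp_mem_omega, t, π, ⟨ht.1, ?_⟩,
    ⟨hπ, opair_reishNat_mem_reishOmega emp_mem_omega hπ⟩, rfl⟩)
  rintro σ ⟨y, hσ, hy⟩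
  obtain ⟨-, l, hl, -⟩ := (𝒜.opair_mem_reishNat emp_mem_omega).1 hy
  exact (not_mem_emp l hl).elim

/-! ### The first infinite ordinal of the realizability model -/

/-- A structure that satisfies the uniformly realized first-order properties of `ℸ ω` is a model of
the axioms from which `ℸ ω` is the first infinite ordinal. -/
theorem isReishModel {R : Rels ℕ} (hR : ∀ χ : Fo,
    (Valid fun _ : Unit => χ.eval fun _ => 𝒜.reishOmega) → χ.Sat R fun _ => 0) :
    R.IsReishModel 0 where
  sub_iff := by
    have h₁ := hR (.all (.all (.imp (.sub 1 0) (.all (.imp (.notMem 0 1) (.notEps 0 2))))))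
      (Valid.all (Valid.all (entails_of_falsity_subset fun p => (falsity_sub p.1.2 p.2).ge)))
    have h₂ := hR (.all (.all (.imp (.all (.imp (.notMem 0 1) (.notEps 0 2))) (.sub 1 0))))
      (Valid.all (Valid.all (entails_of_falsity_subset fun p => (falsity_sub p.1.2 p.2).le)))
    exact fun a b => ⟨fun hab c hc hcb => hc (h₁ a b hab c hcb),
      fun hab => h₂ a b fun c => not_imp_not.1 (hab c)⟩
  mem_iff := by
    have h₁ := hR (.all (.all (.imp (.notMem 1 0)
        (.all (.imp (.sub 2 0) (.imp (.sub 0 2) (.notEps 0 1)))))))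
      (Valid.all (Valid.all (entails_of_falsity_subset fun p => (falsity_notMem p.1.2 p.2).ge)))
    have h₂ := hR (.all (.all (.imp (.all (.imp (.sub 2 0) (.imp (.sub 0 2) (.notEps 0 1))))
        (.notMem 1 0))))
      (Valid.all (Valid.all (entails_of_falsity_subset fun p => (falsity_notMem p.1.2 p.2).le)))
    refine fun a b => ⟨fun hab => by_contra fun hn => hab (h₂ a b fun c hac hca => ?_), ?_⟩
    · exact by_contra fun hc => hn ⟨c, hc, hac, hca⟩
    · exact fun ⟨c, hc, hac, hca⟩ hab => hc (h₁ a b hab c hac hca)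
  sub_refl := hR (.all (.sub 0 0))
    (Valid.all ⟨wZero, isCombinator_wZero, fun p => wZero_refl p.2⟩)
  induction φ b := by
    have h : Valid fun _ : Unit => (Fo.all φ.epsInduction).eval fun _ => 𝒜.reishOmega := by
      have h := Fo.valid_epsInduction (𝒜 := 𝒜) φ
      generalize φ.epsInduction = ψ at h
      exact Valid.all (φ := fun _ b => ψ.eval (Realizability.push b fun _ => 𝒜.reishOmega))
        (h.comp fun p : Unit × 𝒜.Name => Realizability.push p.2 fun _ => 𝒜.reishOmega)
    have h := hR _ h
    generalize φ.epsInduction = ψ at h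
    exact h b
  eps_omega x y hx := mt (hR _ valid_eps_omega x hx y)
  eps_trans x y z hx hy := mt fun hz => hR _ valid_eps_trans x hx y z hz hy
  max x y hx hy := by
    by_contra! hn
    refine hy (hR _ valid_exists_max x hx (fun m hm => by_contra fun hmx => ?_) y)
    obtain ⟨z, hz, hzm⟩ := hn m hmx
    exact hz (hm z hzm)
  succ x hx := by
    by_contra! hn
    refine hR _ valid_exists_succ x hx fun s hs hxs => by_contra fun hsw => ?_
    obtain ⟨z, hz, hzx⟩ := hn s hsw hxs
    exact hz (hs z hzx)
  zero := by
    by_contra! hn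
    refine hR _ valid_exists_empty fun e he => by_contra fun hew => ?_
    obtain ⟨y, hy⟩ := hn e hew
    exact hy (he y)

theorem forcesPurely_exists_eqv : ForcesPurely (Fml.ex fun z =>
    Fml.and (Fml.isFirstInfiniteOrdinal z) (Fml.exteq 𝒜.reishOmega z)) := by
  refine (Fo.valid_of_sat 𝒜.reishOmega (.ex (.and (.isFirstInfiniteOrdinal 0) (.exteq 1 0)))
    fun R hR => ?_).forcesPurely
  have h := isReishModel hR
  refine Rels.sat_ex.2 ⟨0, Rels.sat_and.2 ⟨Rels.sat_isFirstInfiniteOrdinal.2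
    ⟨h.isLim, fun b => h.sub_of_isLim⟩, Rels.sat_exteq.2 ⟨h.sub_refl _, h.sub_refl _⟩⟩⟩

theorem forcesPurely_forall_eqv : ForcesPurely (Fml.all fun z =>
    Fml.imp (Fml.isFirstInfiniteOrdinal z) (Fml.exteq 𝒜.reishOmega z)) := by
  refine (Fo.valid_of_sat 𝒜.reishOmega (.all (.imp (.isFirstInfiniteOrdinal 0) (.exteq 1 0)))
    fun R hR z hz => ?_).forcesPurely
  have h := isReishModel hR
  obtain ⟨hz, hmin⟩ := Rels.sat_isFirstInfiniteOrdinal.1 hz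
  exact Rels.sat_exteq.2 ⟨h.sub_of_isLim hz, hmin 0 h.isLim⟩

end RealizabilityAlgebra

end Realizability

open Realizability Realizability.RealizabilityAlgebra in
theorem mainTheorem2 {V : Type u} [Membership V V] [IsZFModel V] (𝒜 : RealizabilityAlgebra V) :
    (∀ w : V, IsRealizer 𝒜.A 𝒜.B w → w ∈ verity 𝒜.reflFml →
      IsRealizer 𝒜.A 𝒜.B (etaTerm w) ∧ (IsPureRealizer 𝒜.B w → IsPureRealizer 𝒜.B (etaTerm w)) ∧
        etaTerm w ∈ verity 𝒜.zeroOrSuccFml) ∧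
    (IsRealizer 𝒜.A 𝒜.B wOne ∧ IsPureRealizer 𝒜.B wOne ∧ wOne ∈ verity 𝒜.reflFml) ∧
    ∃ reishOmega : 𝒜.Name, (∀ a : V, 𝒜.IsReish omega a ↔ a = reishOmega.1) ∧
      ForcesPurely (Fml.ex fun z =>
        Fml.and (Fml.isFirstInfiniteOrdinal z) (Fml.exteq reishOmega z)) ∧
      ForcesPurely (Fml.all fun z =>
        Fml.imp (Fml.isFirstInfiniteOrdinal z) (Fml.exteq reishOmega z)) :=
  ⟨fun _ hw hw' => ⟨isRealizer_etaTerm hw, isRealizer_etaTerm, etaTerm_mem_verity hw'⟩,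
    ⟨isCombinator_wOne _ _, isCombinator_wOne _ _, wOne_mem_verity⟩,
    𝒜.reishOmega, fun _ => 𝒜.isReish_iff _, forcesPurely_exists_eqv, forcesPurely_forall_eqv⟩
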